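/- All matroids are finite. Let $S$ be a finite set, let $r,r_1,\dots,r_q$ ($q\ge 0$) be nonnegative integers with $|S|\ge r$, and let $H_1,\dots,H_q\subseteq S$ satisfy $|H_i\cap H_j|\le r_i+r_j-r$ for all distinct $i,j$ and $|S\setminus H_i|+r_i\ge r$ for all $i$. The matroid on $S$ whose bases are the sets $X\subseteq S$ with $|X|=r$ and $|X\cap H_i|\le r_i$ for all $i$ is called an elementary split matroid. A split matroid is a direct sum of one elementary split matroid and finitely many (possibly zero) uniform matroids. Theorem. Let $M$ be a split matroid of rank $r$ on a ground set $S$ with $|S|=n$, and let $S=B_1\cup\dots\cup B_k$ be a partition of $S$ into $k$ pairwise disjoint bases of $M$. Then there is an ordering $s_1,\dots,s_n$ of $S$ such that (a) $\{s_i,s_{i+1},\dots,s_{i+r-1}\}$ is a basis of $M$ for every $i\in\{1,\dots,n\}$, where indices are taken cyclically modulo $n$; and (b) $B_i=\{s_{(i-1)r+1},\dots,s_{ir}\}$ for every $i\in\{1,\dots,k\}$; that is, each $B_i$ is an interval, and these intervals follow each other in the order $B_1,\dots,B_k$. Moreover, there are an algorithm and a polynomial $p$ such that, for every such $M$ and every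 such partition, the algorithm, given $B_1,\dots,B_k$ and access to an independence oracle for $M$ (which tells whether a given set is independent in $M$), makes at most $p(n)$ oracle calls and outputs an ordering with the properties (a) and (b). -/

import Mathlib

open scoped Function

namespace SplitMatroid

variable {α : Type*}

/-- The rank of a finite matroid as a natural number. -/
noncomputable def rk (M : Matroid α) : ℕ := M.eRank.toNat

/-- Elementary split matroids: for some nonnegative integers `r, ρ₁, …, ρ_q` and subsets
`H₁, …, H_q` of the (finite) ground set with `|H_i ∩ H_j| ≤ ρ_i + ρ_j - r` for `i ≠ j` and
`|E - H_i| + ρ_i ≥ r`, the bases are the `r`-subsets of `E` that meet each `H_i` in at most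
`ρ_i` elements. -/
def IsElementarySplit (M : Matroid α) : Prop :=
  M.E.Finite ∧ ∃ (r q : ℕ) (H : Fin q → Set α) (ρ : Fin q → ℕ),
    r ≤ M.E.ncard ∧
    (∀ i, H i ⊆ M.E) ∧
    (∀ i j, i ≠ j → (H i ∩ H j).ncard + r ≤ ρ i + ρ j) ∧
    (∀ i, r ≤ (M.E \ H i).ncard + ρ i) ∧
    ∀ X : Set α, M.IsBase X ↔ X ⊆ M.E ∧ X.ncard = r ∧ ∀ i, (X ∩ H i).ncard ≤ ρ i

/-- Uniform matroids on a finite ground set. -/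
def IsUniform (M : Matroid α) : Prop :=
  M.E.Finite ∧ ∃ r : ℕ, ∀ X : Set α, M.IsBase X ↔ X ⊆ M.E ∧ X.ncard = r

/-- Split matroids: the direct sum of one elementary split matroid and finitely many
(maybe zero) uniform matroids. -/
def IsSplit (M : Matroid α) : Prop :=
  ∃ (t : ℕ) (N : Fin (t + 1) → Matroid α) (h : Pairwise (Disjoint on fun i ↦ (N i).E)),
    IsElementarySplit (N 0) ∧ (∀ i : Fin t, IsUniform (N i.succ)) ∧ M = Matroid.disjointSigma N h

/-- `B 0, …, B (k - 1)` are pairwise disjoint bases whose union is the ground set. -/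
def IsBasePartition (M : Matroid α) {k : ℕ} (B : Fin k → Set α) : Prop :=
  (∀ i, M.IsBase (B i)) ∧ Pairwise (Disjoint on B) ∧ ⋃ i, B i = M.E

/-- The list `s` enumerates the ground set without repetition, and for every position `i` the
`rk M` elements that follow each other cyclically from position `i` on form a basis. -/
def IsCyclicOrdering (M : Matroid α) (s : List α) : Prop :=
  s.Nodup ∧ {x | x ∈ s} = M.E ∧
    ∀ i < s.length, M.IsBase {x | x ∈ (s.rotate i).take (rk M)}

/-- With `r = rk M` and positions counted from `0`, the set `B i` occupies exactly the positions
`i * r, …, (i + 1) * r - 1` of `s`: each `B i` is an interval, and these intervals follow each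
other in the order `B 0, B 1, …`. -/
def BlocksInOrder (M : Matroid α) {k : ℕ} (B : Fin k → Set α) (s : List α) : Prop :=
  ∀ i : Fin k, {x | x ∈ (s.drop (i * rk M)).take (rk M)} = B i

/-- A deterministic oracle procedure. Given the input (a list of bases, each a list of elements)
and the list of the oracle's answers so far, it either asks the oracle about a set
(`Sum.inl X`, the set of the members of `X`) or halts with an output (`Sum.inr s`). -/
abbrev OracleProcedure : Type := List (List ℕ) → List Bool → List ℕ ⊕ List ℕ

/-- `Reaches P M bs a`: on the input `bs`, with the independence oracle of `M`, the procedure `P`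
gets to the point where it has made `a.length` oracle calls, with the answers `a`. -/
inductive Reaches (P : OracleProcedure) (M : Matroid ℕ) (bs : List (List ℕ)) : List Bool → Prop
  | start : Reaches P M bs []
  | call {a : List Bool} {X : List ℕ} {b : Bool} (ha : Reaches P M bs a)
      (hX : P bs a = Sum.inl X) (hb : b = true ↔ M.Indep {x | x ∈ X}) : Reaches P M bs (a ++ [b])

/-- On the input `bs`, with the independence oracle of `M`, the procedure `P` halts with output `s`
after exactly `c` oracle calls. -/
def HaltsWith (P : OracleProcedure) (M : Matroid ℕ) (bs : List (List ℕ)) (s : List ℕ) (c : ℕ) :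
    Prop :=
  ∃ a : List Bool, Reaches P M bs a ∧ P bs a = Sum.inr s ∧ a.length = c

end SplitMatroid

namespace SplitMatroid

open Finset

/-! The ordering is built in layers. After `j` steps a set `P m` of `j` elements is chosen in each
block `B m` (indices cyclic), and all windows `(B m \ P m) ∪ P (m + 1)`, the cyclic intervals at
offset `j`, are bases. The next layer comes from a transversal: unchosen elements `e m` of the
blocks such that exchanging `e m` for `e (m + 1)` in window `m` gives a base for every `m`.

In a base `W`, two tight constraints of one component together cover the part of `W` in that
component and meet only inside `W` (`inter_card_add_le`). Hence the forbidden exchanges form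
rectangles with disjoint sides, one for each tight constraint (`Bad.rectangle`). Unreachability
along walks inherits the rectangle property, so a closed walk once around the cycle, which is a
transversal, exists unless at every level two tight constraints split both sides
(`exists_periodic_or_splitAt`, `DoublyTight`).

The invariant is therefore that no component is doubly tight at all levels. Components that are sums
of two uniform matroids are exempt: there any choice within one summand is a transversal. The
invariant holds initially (`not_classSplit_empty`). If a transversal destroys it, then some chosen
element lies outside both tight sets of the window that it leaves, or inside both tight sets of the
window that it enters. Trading this element for another one of its block keeps the windows bases and
breaks one of the two pairs (`DoublyTight.exists_exch`, `exists_good_modifyAt`).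

An oracle shows neither constraints nor components. Double tightness is therefore expressed by
exchanges (`splitAt_iff`), and components are replaced by classes reached by at most five exchanges
in the first block. Such a class is the whole component or lies in one of two uniform summands
(`connected_or_uniformPair`). In each round the algorithm tests one transversal and its changes in a
single block, which are polynomially many candidates. The transversal itself is found by exhaustive
search, but without oracle calls, as the answers of the current round already decide it
(`win_of_advances`). -/

/-- A direct sum of elementary split matroids, presented by finitely many disjoint components with
ranks and bounded subsets. -/
structure SplitSystem (α : Type*) [DecidableEq α] where
  /-- the number of components -/
  t : ℕ
  /-- the ground sets of the components -/
  E : Fin t → Finset α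
  /-- the ranks of the components -/
  r : Fin t → ℕ
  /-- the number of constraints of a component -/
  q : Fin t → ℕ
  /-- the constrained sets -/
  H : (i : Fin t) → Fin (q i) → Finset α
  /-- the bounds on the constrained sets -/
  ρ : (i : Fin t) → Fin (q i) → ℕ
  disj : ∀ i i' x, x ∈ E i → x ∈ E i' → i = i'
  subset : ∀ i j, H i j ⊆ E i
  inter : ∀ i a b, a ≠ b → #(H i a ∩ H i b) + r i ≤ ρ i a + ρ i b

/-- The exchange of `x` for `y`. -/
def exch {α : Type*} [DecidableEq α] (W : Finset α) (x y : α) : Finset α := insert y (W.erase x)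

/-! ### Exchanges and tight constraints in one base -/

section exch

variable {α : Type*} [DecidableEq α] {W : Finset α} {x y z : α}

lemma mem_exch : z ∈ exch W x y ↔ z = y ∨ (z ≠ x ∧ z ∈ W) := by
  simp [exch]

/-- The indicator terms stand on both sides in order to avoid subtraction. -/
lemma card_exch_inter (hx : x ∈ W) (hy : y ∉ W) (H : Finset α) :
    #(exch W x y ∩ H) + (if x ∈ H then 1 else 0) = #(W ∩ H) + if y ∈ H then 1 else 0 := by
  have hyx : y ≠ x := fun h ↦ hy (h ▸ hx)
  have e1 : #((W ∩ H).erase x) + (if x ∈ H then 1 else 0) = #(W ∩ H) := by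
    split_ifs with h
    · exact card_erase_add_one (by simp [hx, h])
    · rw [erase_eq_of_notMem (by simp [h])]; rfl
  have e2 : #(exch W x y ∩ H) = #((W ∩ H).erase x) + if y ∈ H then 1 else 0 := by
    split_ifs with h
    · rw [← card_insert_of_notMem (a := y) (by simp [hy])]
      congr 1; ext a; simp only [exch, mem_inter, mem_insert, mem_erase]
      constructor
      · rintro ⟨rfl | h1, h2⟩ <;> tauto
      · rintro (rfl | h1) <;> tauto
    · rw [add_zero]
      congr 1; ext a; simp only [exch, mem_inter, mem_insert, mem_erase]
      constructor
      · rintro ⟨rfl | h1, h2⟩ <;> tauto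
      · tauto
  omega

end exch

namespace SplitSystem

variable {α : Type*} [DecidableEq α] (D : SplitSystem α)

/-- The bases of the direct sum. -/
def IsBase (X : Finset α) : Prop :=
  (∀ x ∈ X, ∃ i, x ∈ D.E i) ∧ (∀ i, #(X ∩ D.E i) = D.r i) ∧ ∀ i j, #(X ∩ D.H i j) ≤ D.ρ i j

/-- The `j`-th constraint of component `i` holds with equality. -/
def Tight (W : Finset α) (i : Fin D.t) (j : Fin (D.q i)) : Prop := #(W ∩ D.H i j) = D.ρ i j

variable {D} {W : Finset α} {i : Fin D.t} {j j' : Fin (D.q i)} {x y z : α}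

/-- Since `#(W ∩ D.E i)` is the rank, inclusion-exclusion and the bound on `H j ∩ H j'` charge every
member of `W` outside both sets and every nonmember inside both. If both constraints are tight,
neither kind exists. All later arguments use the intersection bound through this inequality. -/
lemma inter_card_add_le (hW : #(W ∩ D.E i) = D.r i) (hj : j ≠ j') :
    #(W ∩ D.H i j) + #(W ∩ D.H i j') + #((W ∩ D.E i) \ (D.H i j ∪ D.H i j')) +
      #((D.H i j ∩ D.H i j') \ W) ≤ D.ρ i j + D.ρ i j' := by
  have h1 := card_union_add_card_inter (W ∩ D.H i j) (W ∩ D.H i j')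
  have h2 : #((W ∩ D.H i j) ∪ (W ∩ D.H i j')) + #((W ∩ D.E i) \ (D.H i j ∪ D.H i j')) =
      #(W ∩ D.E i) := by
    rw [← card_union_of_disjoint]
    · congr 1; ext a
      have := @D.subset i j a
      have := @D.subset i j' a
      simp only [mem_union, mem_inter, mem_sdiff]; tauto
    · rw [disjoint_left]; intro a; simp only [mem_union, mem_inter, mem_sdiff]; tauto
  have h3 : #((W ∩ D.H i j) ∩ (W ∩ D.H i j')) + #((D.H i j ∩ D.H i j') \ W) =
      #(D.H i j ∩ D.H i j') := by
    rw [← card_union_of_disjoint]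
    · congr 1; ext a
      simp only [mem_union, mem_inter, mem_sdiff]; tauto
    · rw [disjoint_left]; intro a; simp only [mem_inter, mem_sdiff]; tauto
  have := D.inter i j j' hj
  omega

/-- Two tight constraints cover the component's part of `W`, so a member of `W` misses at most one.
Dually, by `Tight.eq_of_mem`, a nonmember lies in at most one. These two facts identify tight
constraints from here on. -/
lemma Tight.eq_of_notMem (hW : D.IsBase W) (h : D.Tight W i j) (h' : D.Tight W i j')
    (hx : x ∈ W) (hxE : x ∈ D.E i) (hj : x ∉ D.H i j) (hj' : x ∉ D.H i j') : j = j' := by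
  by_contra hne
  have := inter_card_add_le (hW.2.1 i) hne
  have h1 : 0 < #((W ∩ D.E i) \ (D.H i j ∪ D.H i j')) := card_pos.2 ⟨x, by simp [*]⟩
  unfold Tight at h h'
  omega

lemma Tight.eq_of_mem (hW : D.IsBase W) (h : D.Tight W i j) (h' : D.Tight W i j')
    (hy : y ∉ W) (hj : y ∈ D.H i j) (hj' : y ∈ D.H i j') : j = j' := by
  by_contra hne
  have := inter_card_add_le (hW.2.1 i) hne
  have h1 : 0 < #((D.H i j ∩ D.H i j') \ W) := card_pos.2 ⟨y, by simp [*]⟩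
  unfold Tight at h h'
  omega

/-- If the bound of `j'` is missed by one, a member of `W` outside and a nonmember inside of both
constrained sets give `j = j'`. -/
lemma Tight.eq_of_mem_of_notMem (hW : D.IsBase W) (h : D.Tight W i j)
    (h' : D.ρ i j' ≤ #(W ∩ D.H i j') + 1)
    (hx : x ∈ W) (hxE : x ∈ D.E i) (hxj : x ∉ D.H i j) (hxj' : x ∉ D.H i j')
    (hy : y ∉ W) (hj : y ∈ D.H i j) (hj' : y ∈ D.H i j') : j = j' := by
  by_contra hne
  have := inter_card_add_le (hW.2.1 i) hne
  have h1 : 0 < #((D.H i j ∩ D.H i j') \ W) := card_pos.2 ⟨y, by simp [*]⟩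
  have h2 : 0 < #((W ∩ D.E i) \ (D.H i j ∪ D.H i j')) := card_pos.2 ⟨x, by simp [*]⟩
  unfold Tight at h
  omega

/-- The exchange of `x` for `y` violates a constraint of component `i`. -/
def Bad (D : SplitSystem α) (i : Fin D.t) (W : Finset α) (x y : α) : Prop :=
  ∃ j, D.Tight W i j ∧ x ∉ D.H i j ∧ y ∈ D.H i j

/-- An exchange raises the count of a constrained set by at most one, and only if `y` is inside and
`x` is not, so it can fail at tight constraints only. -/
lemma isBase_exch_iff (hW : D.IsBase W) (hx : x ∈ W) (hy : y ∉ W) (hxE : x ∈ D.E i)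
    (hyE : y ∈ D.E i) : D.IsBase (exch W x y) ↔ ¬ D.Bad i W x y := by
  constructor
  · rintro h ⟨j, hj, hxj, hyj⟩
    have h1 := card_exch_inter hx hy (D.H i j)
    have h2 := h.2.2 i j
    simp only [hxj, hyj, if_true, if_false] at h1
    unfold Tight at hj
    omega
  · intro h
    refine ⟨?_, ?_, ?_⟩
    · intro a ha
      rcases mem_exch.1 ha with rfl | ha
      · exact ⟨i, hyE⟩
      · exact hW.1 a ha.2
    · intro i'
      have h1 := card_exch_inter hx hy (D.E i')
      have h2 := hW.2.1 i'
      by_cases hi : i = i'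
      · subst hi; simp only [hxE, hyE, if_true] at h1; omega
      · have hx' : x ∉ D.E i' := fun h ↦ hi (D.disj _ _ _ hxE h)
        have hy' : y ∉ D.E i' := fun h ↦ hi (D.disj _ _ _ hyE h)
        simp only [hx', hy', if_false] at h1; omega
    · intro i' j
      have h1 := card_exch_inter hx hy (D.H i' j)
      have h2 := hW.2.2 i' j
      by_cases hi : i = i'
      · subst hi
        have : ¬ (D.Tight W i j ∧ x ∉ D.H i j ∧ y ∈ D.H i j) := fun h' ↦ h ⟨j, h'⟩
        unfold Tight at this
        split_ifs at h1 <;> first | omega | (simp_all; omega)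
      · have hy' : y ∉ D.H i' j := fun h ↦ hi (D.disj _ _ _ hyE (D.subset _ _ h))
        simp only [hy', if_false] at h1; omega

lemma mem_of_isBase_exch (hW : D.IsBase W) (h : D.IsBase (exch W x y)) (hx : x ∈ W) (hy : y ∉ W)
    (hxE : x ∈ D.E i) : y ∈ D.E i := by
  by_contra hyE
  have h1 := card_exch_inter hx hy (D.E i)
  have h2 := hW.2.1 i
  have h3 := h.2.1 i
  simp only [hxE, hyE, if_true, if_false] at h1
  omega

/-- A single tight constraint is responsible for all forbidden exchanges of a given `x`, and a
single one for those of a given `y`. Hence one constraint forbids all three corners, and with them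
the fourth. -/
lemma Bad.rectangle {x' y' : α} (hW : D.IsBase W) (hy : y ∉ W)
    (hx : x ∈ W) (hxE : x ∈ D.E i) (h1 : D.Bad i W x y) (h2 : D.Bad i W x y')
    (h3 : D.Bad i W x' y) : D.Bad i W x' y' := by
  obtain ⟨j1, t1, a1, b1⟩ := h1
  obtain ⟨j2, t2, a2, b2⟩ := h2
  obtain ⟨j3, t3, a3, b3⟩ := h3
  obtain rfl := t1.eq_of_notMem hW t2 hx hxE a1 a2
  obtain rfl := t1.eq_of_mem hW t3 hy b1 b3
  exact ⟨_, t1, a3, b2⟩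

/-- Two tight constraints `F`, `G` of component `i` separate the members of `Q` and those of `Q'`
into two nonempty classes each. -/
structure DoublyTight (D : SplitSystem α) (i : Fin D.t) (W Q Q' : Finset α) (F G : Fin (D.q i)) :
    Prop where
  ne : F ≠ G
  tightF : D.Tight W i F
  tightG : D.Tight W i G
  notMem : ∀ z ∈ Q, z ∈ D.E i → z ∉ D.H i F ∨ z ∉ D.H i G
  mem : ∀ y ∈ Q', y ∈ D.E i → y ∈ D.H i F ∨ y ∈ D.H i G
  leftF : ∃ z ∈ Q, z ∈ D.E i ∧ z ∉ D.H i F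
  leftG : ∃ z ∈ Q, z ∈ D.E i ∧ z ∉ D.H i G
  rightF : ∃ y ∈ Q', y ∈ D.H i F
  rightG : ∃ y ∈ Q', y ∈ D.H i G

lemma DoublyTight.symm {Q Q' : Finset α} {F G : Fin (D.q i)} (h : D.DoublyTight i W Q Q' F G) :
    D.DoublyTight i W Q Q' G F :=
  ⟨h.ne.symm, h.tightG, h.tightF, fun z hz hz' ↦ (h.notMem z hz hz').symm,
    fun z hz hz' ↦ (h.mem z hz hz').symm, h.leftG, h.leftF, h.rightG, h.rightF⟩

lemma DoublyTight.cover {Q Q' : Finset α} {F G : Fin (D.q i)} (h : D.DoublyTight i W Q Q' F G)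
    (hW : D.IsBase W) (hx : x ∈ W) (hxE : x ∈ D.E i) : x ∈ D.H i F ∨ x ∈ D.H i G := by
  by_contra! hc
  exact h.ne (h.tightF.eq_of_notMem hW h.tightG hx hxE hc.1 hc.2)

lemma DoublyTight.mem_of_mem {Q Q' : Finset α} {F G : Fin (D.q i)}
    (h : D.DoublyTight i W Q Q' F G) (hW : D.IsBase W) (hF : x ∈ D.H i F) (hG : x ∈ D.H i G) :
    x ∈ W := by
  by_contra hc
  exact h.ne (h.tightF.eq_of_mem hW h.tightG hc hF hG)

/-- A pair of classes covering both sides, in terms of the exchanges inside of `C`: the condition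
that an independence oracle can decide. -/
def SplitAt (g : α → α → Prop) (C : α → Prop) (Q Q' : Finset α) : Prop :=
  ∃ z₀ ∈ Q, ∃ z₁ ∈ Q, ∃ y₀ ∈ Q', ∃ y₁ ∈ Q', C z₀ ∧ C z₁ ∧ C y₀ ∧ C y₁ ∧
    ¬ g z₀ y₀ ∧ ¬ g z₁ y₁ ∧ g z₀ y₁ ∧ (∀ z ∈ Q, C z → ¬ g z y₀ ∨ ¬ g z y₁) ∧
    ∀ y ∈ Q', C y → ¬ g z₀ y ∨ ¬ g z₁ y

/-- The forbidden exchanges `z₀, y₀` and `z₁, y₁` reveal `F` and `G`, and the allowed exchange `z₀,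
y₁` shows `F ≠ G`. Among tight constraints only `F` contains `y₀` and only `G` contains `y₁`, so the
clause about `z` says that no `z` lies in both. The clause about `y` is dual, with `z₀` and `z₁`. -/
lemma splitAt_iff {Q Q' : Finset α} (hW : D.IsBase W) (hQ : Q ⊆ W) (hQ' : ∀ y ∈ Q', y ∉ W) :
    SplitAt (fun x y ↦ D.IsBase (exch W x y)) (· ∈ D.E i) Q Q' ↔
      ∃ F G, D.DoublyTight i W Q Q' F G := by
  have hb : ∀ z ∈ Q, ∀ y ∈ Q', z ∈ D.E i → y ∈ D.E i →
      (D.IsBase (exch W z y) ↔ ¬ D.Bad i W z y) := fun z hz y hy hzE hyE ↦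
    isBase_exch_iff hW (hQ hz) (hQ' y hy) hzE hyE
  unfold SplitAt
  beta_reduce
  constructor
  · rintro ⟨z₀, hz₀, z₁, hz₁, y₀, hy₀, y₁, hy₁, cz₀, cz₁, cy₀, cy₁, h00, h11, h01, hz, hy⟩
    rw [hb _ hz₀ _ hy₀ cz₀ cy₀, not_not] at h00
    rw [hb _ hz₁ _ hy₁ cz₁ cy₁, not_not] at h11
    rw [hb _ hz₀ _ hy₁ cz₀ cy₁] at h01
    obtain ⟨F, tF, zF, yF⟩ := h00
    obtain ⟨G, tG, zG, yG⟩ := h11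
    refine ⟨F, G, ?_, tF, tG, ?_, ?_, ⟨z₀, hz₀, cz₀, zF⟩, ⟨z₁, hz₁, cz₁, zG⟩, ⟨y₀, hy₀, yF⟩,
      ⟨y₁, hy₁, yG⟩⟩
    · rintro rfl; exact h01 ⟨_, tF, zF, yG⟩
    · intro z hzQ hzE
      have := hz z hzQ hzE
      rw [hb _ hzQ _ hy₀ hzE cy₀, hb _ hzQ _ hy₁ hzE cy₁, not_not, not_not] at this
      rcases this with ⟨j, tj, zj, yj⟩ | ⟨j, tj, zj, yj⟩
      · obtain rfl := tF.eq_of_mem hW tj (hQ' _ hy₀) yF yj; exact .inl zj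
      · obtain rfl := tG.eq_of_mem hW tj (hQ' _ hy₁) yG yj; exact .inr zj
    · intro y hyQ hyE
      have := hy y hyQ hyE
      rw [hb _ hz₀ _ hyQ cz₀ hyE, hb _ hz₁ _ hyQ cz₁ hyE, not_not, not_not] at this
      rcases this with ⟨j, tj, zj, yj⟩ | ⟨j, tj, zj, yj⟩
      · obtain rfl := tF.eq_of_notMem hW tj (hQ hz₀) cz₀ zF zj; exact .inl yj
      · obtain rfl := tG.eq_of_notMem hW tj (hQ hz₁) cz₁ zG zj; exact .inr yj
  · rintro ⟨F, G, h⟩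
    obtain ⟨z₀, hz₀, cz₀, zF⟩ := h.leftF
    obtain ⟨z₁, hz₁, cz₁, zG⟩ := h.leftG
    obtain ⟨y₀, hy₀, yF⟩ := h.rightF
    obtain ⟨y₁, hy₁, yG⟩ := h.rightG
    have cy₀ := D.subset _ _ yF
    have cy₁ := D.subset _ _ yG
    refine ⟨z₀, hz₀, z₁, hz₁, y₀, hy₀, y₁, hy₁, cz₀, cz₁, cy₀, cy₁, ?_, ?_, ?_, ?_, ?_⟩
    · rw [hb _ hz₀ _ hy₀ cz₀ cy₀, not_not]; exact ⟨F, h.tightF, zF, yF⟩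
    · rw [hb _ hz₁ _ hy₁ cz₁ cy₁, not_not]; exact ⟨G, h.tightG, zG, yG⟩
    · rw [hb _ hz₀ _ hy₁ cz₀ cy₁]
      rintro ⟨j, tj, zj, yj⟩
      obtain rfl := h.tightF.eq_of_notMem hW tj (hQ hz₀) cz₀ zF zj
      exact hQ' _ hy₁ (h.mem_of_mem hW yj yG)
    · intro z hzQ hzE
      rw [hb _ hzQ _ hy₀ hzE cy₀, hb _ hzQ _ hy₁ hzE cy₁, not_not, not_not]
      rcases h.notMem z hzQ hzE with h' | h'
      · exact .inl ⟨F, h.tightF, h', yF⟩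
      · exact .inr ⟨G, h.tightG, h', yG⟩
    · intro y hyQ hyE
      rw [hb _ hz₀ _ hyQ cz₀ hyE, hb _ hz₁ _ hyQ cz₁ hyE, not_not, not_not]
      rcases h.mem y hyQ hyE with h' | h'
      · exact .inl ⟨F, h.tightF, zF, h'⟩
      · exact .inr ⟨G, h.tightG, zG, h'⟩

end SplitSystem

open Finset

/-! ### Closed walks around a cycle of levels -/

section Cyclic

variable {α : Type*}

/-- Walks of `n + 1` steps from level `m` to level `m + n + 1`. -/
def Reach (Q : ℕ → Finset α) (g : ℕ → α → α → Prop) (m : ℕ) : ℕ → α → α → Prop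
  | 0, x, z => g m x z
  | n + 1, x, z => ∃ y ∈ Q (m + n + 1), Reach Q g m n x y ∧ g (m + n + 1) y z

variable {Q : ℕ → Finset α} {g : ℕ → α → α → Prop} {m : ℕ}

lemma Reach.exists_right (right : ∀ m, ∀ x ∈ Q m, ∃ y ∈ Q (m + 1), g m x y) (n : ℕ) :
    ∀ x ∈ Q m, ∃ z ∈ Q (m + n + 1), Reach Q g m n x z := by
  induction n with
  | zero => exact right m
  | succ n ih =>
    intro x hx
    obtain ⟨y, hy, hxy⟩ := ih x hx
    obtain ⟨z, hz, hyz⟩ := right _ y hy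
    exact ⟨z, hz, y, hy, hxy, hyz⟩

/-- Only the last step matters. A vertex `u` reached from `x` one level earlier has no step to `z`
or `z'`, and a vertex `y` reached from `x'` has none to `z`, so the rectangle property of the last
level applies to `u` and `y`. -/
lemma Reach.rectangle (right : ∀ m, ∀ x ∈ Q m, ∃ y ∈ Q (m + 1), g m x y)
    (rect : ∀ m, ∀ x ∈ Q m, ∀ x' ∈ Q m, ∀ y ∈ Q (m + 1), ∀ y' ∈ Q (m + 1),
      ¬ g m x y → ¬ g m x y' → ¬ g m x' y → ¬ g m x' y') (n : ℕ) :
    ∀ x ∈ Q m, ∀ x' ∈ Q m, ∀ y ∈ Q (m + n + 1), ∀ y' ∈ Q (m + n + 1),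
      ¬ Reach Q g m n x y → ¬ Reach Q g m n x y' → ¬ Reach Q g m n x' y →
        ¬ Reach Q g m n x' y' := by
  cases n with
  | zero => exact rect m
  | succ n =>
    intro x hx x' hx' z hz z' hz' h1 h2 h3 ⟨y, hy, hxy, hyz⟩
    obtain ⟨u, hu, hxu⟩ := Reach.exists_right right n x hx
    refine rect _ u hu y hy z hz z' hz' ?_ ?_ ?_ hyz
    · exact fun h ↦ h1 ⟨u, hu, hxu, h⟩
    · exact fun h ↦ h2 ⟨u, hu, hxu, h⟩
    · exact fun h ↦ h3 ⟨y, hy, hxy, h⟩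

lemma Reach.exists_path {n : ℕ} : ∀ {x z : α}, x ∈ Q m → z ∈ Q (m + n + 1) → Reach Q g m n x z →
    ∃ p : ℕ → α, p 0 = x ∧ p (n + 1) = z ∧ (∀ l ≤ n + 1, p l ∈ Q (m + l)) ∧
      ∀ l ≤ n, g (m + l) (p l) (p (l + 1)) := by
  induction n with
  | zero =>
    intro x z hx hz h
    refine ⟨fun l ↦ if l = 0 then x else z, rfl, rfl, ?_, ?_⟩
    · intro l hl
      interval_cases l
      · exact hx
      · exact hz
    · intro l hl
      obtain rfl : l = 0 := by omega
      exact h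
  | succ n ih =>
    rintro x z hx hz ⟨y, hy, hxy, hyz⟩
    obtain ⟨p, p0, pn, pQ, pg⟩ := ih hx hy hxy
    refine ⟨fun l ↦ if l ≤ n + 1 then p l else z, by simpa using p0, by simp, ?_, ?_⟩
    · intro l hl
      by_cases h : l ≤ n + 1
      · simpa [h] using pQ l h
      · obtain rfl : l = n + 1 + 1 := by omega
        simpa [add_assoc] using hz
    · intro l hl
      by_cases h : l ≤ n
      · simpa [h, show l ≤ n + 1 by omega] using pg l h
      · obtain rfl : l = n + 1 := by omega
        simpa [pn, add_assoc] using hyz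

lemma exists_periodic_of_closed_path {k : ℕ} (hQ : Function.Periodic Q k)
    (hg : Function.Periodic g k) {n : ℕ} (hk : k = n + 2) {x z : α} (hx : x ∈ Q (m + 1))
    (hz : z ∈ Q m) (hr : Reach Q g (m + 1) n x z) (hzx : g m z x) :
    ∃ e : ℕ → α, Function.Periodic e k ∧ (∀ a, e a ∈ Q a) ∧ ∀ a, g a (e a) (e (a + 1)) := by
  have hmk : m + 1 + n + 1 = m + k := by omega
  obtain ⟨p, p0, pn, pQ, pg⟩ := hr.exists_path hx (by rw [hmk, hQ]; exact hz)
  -- The path starts at level `m + 1`, so level `a` takes its entry number `a - (m + 1)` modulo `k`.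
  -- Multiplying `m + 1` by `k - 1` replaces the subtraction.
  have key : ∀ a, (m + 1 + (a + (k - 1) * (m + 1)) % k) % k = a % k := by
    intro a
    rw [Nat.add_mod, Nat.mod_mod, ← Nat.add_mod]
    have : m + 1 + (a + (k - 1) * (m + 1)) = a + k * (m + 1) := by
      obtain ⟨c, rfl⟩ : ∃ c, k = c + 1 := ⟨n + 1, by omega⟩
      simp only [Nat.add_sub_cancel]; ring
    rw [this, Nat.add_mul_mod_self_left]
  have hQa : ∀ a, Q (m + 1 + (a + (k - 1) * (m + 1)) % k) = Q a := fun a ↦ by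
    rw [← hQ.map_mod_nat, key, hQ.map_mod_nat]
  have hga : ∀ a, g (m + 1 + (a + (k - 1) * (m + 1)) % k) = g a := fun a ↦ by
    rw [← hg.map_mod_nat, key, hg.map_mod_nat]
  refine ⟨fun a ↦ p ((a + (k - 1) * (m + 1)) % k), ?_, ?_, ?_⟩
  · intro a
    simp only
    rw [show a + k + (k - 1) * (m + 1) = a + (k - 1) * (m + 1) + k by ring, Nat.add_mod_right]
  · intro a
    have hl : (a + (k - 1) * (m + 1)) % k < k := Nat.mod_lt _ (by omega)
    rw [← hQa]
    exact pQ _ (by omega)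
  · intro a
    have hl : (a + (k - 1) * (m + 1)) % k < k := Nat.mod_lt _ (by omega)
    rw [← hga]
    have hs : (a + 1 + (k - 1) * (m + 1)) % k = ((a + (k - 1) * (m + 1)) % k + 1) % k := by
      rw [Nat.mod_add_mod]; congr 1; ring
    beta_reduce
    rw [hs]
    generalize (a + (k - 1) * (m + 1)) % k = l at hl
    by_cases h : l ≤ n
    · rw [Nat.mod_eq_of_lt (by omega)]; exact pg l h
    · obtain rfl : l = n + 1 := by omega
      rw [show n + 1 + 1 = k by omega, Nat.mod_self, p0, pn,
        show m + 1 + (n + 1) = m + k by omega, hg]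
      exact hzx

/-- If exchanges along the levels of a cycle are forbidden in rectangles only, there is a closed
walk once around the cycle, unless two rectangles cover every level. -/
lemma exists_periodic_or_splitAt {k : ℕ} (hk : 2 ≤ k) (hQ : Function.Periodic Q k)
    (hg : Function.Periodic g k) (hne : ∀ m, (Q m).Nonempty)
    (right : ∀ m, ∀ x ∈ Q m, ∃ y ∈ Q (m + 1), g m x y)
    (rect : ∀ m, ∀ x ∈ Q m, ∀ x' ∈ Q m, ∀ y ∈ Q (m + 1), ∀ y' ∈ Q (m + 1),
      ¬ g m x y → ¬ g m x y' → ¬ g m x' y → ¬ g m x' y') :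
    (∃ e : ℕ → α, Function.Periodic e k ∧ (∀ a, e a ∈ Q a) ∧ ∀ a, g a (e a) (e (a + 1))) ∨
      ∀ m, SplitSystem.SplitAt (g m) (fun _ ↦ True) (Q m) (Q (m + 1)) := by
  by_contra! hcon
  obtain ⟨hno, m, hm⟩ := hcon
  apply hm
  obtain ⟨n, rfl⟩ : ∃ n, k = n + 2 := ⟨k - 2, by omega⟩
  have hQm : Q (m + 1 + n + 1) = Q m := by
    rw [show m + 1 + n + 1 = m + (n + 2) by omega, hQ]
  -- Without a closed walk, a pair connected the long way around cannot be joined by the closing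
  -- step from level `m` to level `m + 1`.
  have hor : ∀ z ∈ Q m, ∀ x ∈ Q (m + 1), Reach Q g (m + 1) n x z → ¬ g m z x := by
    intro z hz x hx hr hzx
    obtain ⟨e, h1, h2, h3⟩ := exists_periodic_of_closed_path hQ hg rfl hx hz hr hzx
    obtain ⟨a, ha⟩ := hno e h1 h2
    exact ha (h3 a)
  have hright := Reach.exists_right (m := m + 1) right n
  have hrect := Reach.rectangle (m := m + 1) right rect n
  rw [hQm] at hright hrect
  obtain ⟨x₀, hx₀⟩ := hne (m + 1)
  obtain ⟨z₀, hz₀, hr₀⟩ := hright x₀ hx₀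
  obtain ⟨x₁, hx₁, hg₁⟩ := right m z₀ hz₀
  obtain ⟨z₁, hz₁, hr₁⟩ := hright x₁ hx₁
  have hn : ¬ Reach Q g (m + 1) n x₁ z₀ := fun h ↦ hor _ hz₀ _ hx₁ h hg₁
  refine ⟨z₀, hz₀, z₁, hz₁, x₀, hx₀, x₁, hx₁, trivial, trivial, trivial, trivial,
    hor _ hz₀ _ hx₀ hr₀, hor _ hz₁ _ hx₁ hr₁, hg₁, ?_, ?_⟩
  -- A `z` with steps to both `x₀` and `x₁` is reached from neither. As `x₁` does not reach `z₀`,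
  -- the rectangle property would keep `x₀` from `z₀` too.
  · intro z hz _
    by_contra! hc
    exact hrect x₁ hx₁ x₀ hx₀ z hz z₀ hz₀ (fun h ↦ hor _ hz _ hx₁ h hc.2) hn
      (fun h ↦ hor _ hz _ hx₀ h hc.1) hr₀
  · intro x hx _
    by_contra! hc
    exact hrect x hx x₁ hx₁ z₀ hz₀ z₁ hz₁ (fun h ↦ hor _ hz₀ _ hx h hc.1)
      (fun h ↦ hor _ hz₁ _ hx h hc.2) hn hr₁

end Cyclic

/-! ### Breaking a pair of tight constraints by one exchange -/

namespace SplitSystem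

variable {α : Type*} [DecidableEq α] {D : SplitSystem α} {i : Fin D.t}

/-- The exchange of `f` for `d` in `Wr` destroys the pair of tight constraints. -/
lemma DoublyTight.not_exch_right {Wr Q Qr : Finset α} {F G : Fin (D.q i)} {d f : α}
    (hWr : D.IsBase Wr) (hr : D.DoublyTight i Wr Q Qr F G) (hQWr : Q ⊆ Wr)
    (hQrWr : ∀ y ∈ Qr, y ∉ Wr) (hdE : d ∈ D.E i) (hdWr : d ∉ Wr) (hdQr : d ∉ Qr) (hf : f ∈ Q)
    (hdF : d ∉ D.H i F) (hdG : d ∉ D.H i G) (hfF : f ∉ D.H i F) (hfG : f ∈ D.H i G)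
    (hB : D.IsBase (exch Wr f d)) {F' G' : Fin (D.q i)}
    (h' : D.DoublyTight i (exch Wr f d) (exch Q f d) Qr F' G') : False := by
  have hfW := hQWr hf
  have tF : D.Tight (exch Wr f d) i F := by
    have := card_exch_inter hfW hdWr (D.H i F)
    have h2 := hr.tightF
    unfold Tight at *
    simp only [hfF, hdF, if_false] at this
    omega
  have tG : #(exch Wr f d ∩ D.H i G) + 1 = D.ρ i G := by
    have := card_exch_inter hfW hdWr (D.H i G)
    have h2 := hr.tightG
    unfold Tight at *
    simp only [hfG, hdG, if_false, if_true] at this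
    omega
  have hdW' : d ∈ exch Wr f d := mem_exch.2 (.inl rfl)
  have hdQ' : d ∈ exch Q f d := mem_exch.2 (.inl rfl)
  -- The new member `d` misses one of `F'`, `G'`. It also misses `F`, which is still tight, so the
  -- two coincide.
  wlog hF : d ∉ D.H i F' generalizing F' G'
  · exact this h'.symm ((h'.notMem d hdQ' hdE).resolve_left hF)
  obtain rfl : F = F' := tF.eq_of_notMem hB h'.tightF hdW' hdE hdF hF
  obtain ⟨x₁, hx₁, hx₁G⟩ := hr.rightG
  have hx₁F : x₁ ∉ D.H i F := fun h ↦ hQrWr _ hx₁ (hr.mem_of_mem hWr h hx₁G)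
  have hx₁G' := (h'.mem x₁ hx₁ (D.subset _ _ hx₁G)).resolve_left hx₁F
  obtain ⟨z₁, hz₁, hz₁E, hz₁G⟩ := hr.leftG
  have hz₁f : z₁ ≠ f := by rintro rfl; exact hz₁G hfG
  have hz₁F := (hr.cover hWr (hQWr hz₁) hz₁E).resolve_right hz₁G
  have hz₁G' := (h'.notMem z₁ (mem_exch.2 (.inr ⟨hz₁f, hz₁⟩)) hz₁E).resolve_left (by simpa)
  have hx₁W' : x₁ ∉ exch Wr f d := by
    rw [mem_exch]
    rintro (rfl | h)
    · exact hdQr hx₁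
    · exact hQrWr _ hx₁ h.2
  -- `z₁` lies outside and `x₁` inside both `G'` and `G`. Since `G` misses its bound by only one,
  -- this still forces `G' = G`, although `G` is no longer tight.
  obtain rfl := h'.tightG.eq_of_mem_of_notMem hB tG.ge
    (mem_exch.2 (.inr ⟨hz₁f, hQWr hz₁⟩)) hz₁E hz₁G' hz₁G hx₁W' hx₁G' hx₁G
  have := h'.tightG
  unfold Tight at this
  omega

/-- The exchange of `d` for `f` in `Wl` destroys the pair of tight constraints. -/
lemma DoublyTight.not_exch_left {Wl Ql Q : Finset α} {F G : Fin (D.q i)} {d f : α}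
    (hWl : D.IsBase Wl) (hl : D.DoublyTight i Wl Ql Q F G) (hQlWl : Ql ⊆ Wl)
    (hQWl : ∀ y ∈ Q, y ∉ Wl) (hdWl : d ∈ Wl) (hdQl : d ∉ Ql) (hf : f ∈ Q)
    (hdF : d ∈ D.H i F) (hdG : d ∈ D.H i G) (hfF : f ∉ D.H i F) (hfG : f ∈ D.H i G)
    (hB : D.IsBase (exch Wl d f)) {F' G' : Fin (D.q i)}
    (h' : D.DoublyTight i (exch Wl d f) Ql (exch Q f d) F' G') : False := by
  have hfW := hQWl _ hf
  -- Mirror image of the exchange on the right: now `F` drops by one and `G` stays tight. The member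
  -- `z₁` outside `G` yields `G' = G`, and then `z₀` and `x₀` yield `F' = F`.
  have tF : #(exch Wl d f ∩ D.H i F) + 1 = D.ρ i F := by
    have := card_exch_inter hdWl hfW (D.H i F)
    have h2 := hl.tightF
    unfold Tight at *
    simp only [hfF, hdF, if_false, if_true] at this
    omega
  have tG : D.Tight (exch Wl d f) i G := by
    have := card_exch_inter hdWl hfW (D.H i G)
    have h2 := hl.tightG
    unfold Tight at *
    simp only [hfG, hdG, if_true] at this
    omega
  have hW' : ∀ z ∈ Ql, z ∈ exch Wl d f := fun z hz ↦
    mem_exch.2 (.inr ⟨fun h ↦ hdQl (h ▸ hz), hQlWl hz⟩)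
  obtain ⟨z₁, hz₁, hz₁E, hz₁G⟩ := hl.leftG
  wlog hG : z₁ ∉ D.H i G' generalizing F' G'
  · exact this h'.symm ((h'.notMem z₁ hz₁ hz₁E).resolve_right hG)
  obtain rfl : G = G' := tG.eq_of_notMem hB h'.tightG (hW' _ hz₁) hz₁E hz₁G hG
  obtain ⟨x₀, hx₀, hx₀F⟩ := hl.rightF
  have hx₀G : x₀ ∉ D.H i G := fun h ↦ hQWl _ hx₀ (hl.mem_of_mem hWl hx₀F h)
  have hx₀f : x₀ ≠ f := by rintro rfl; exact hfF hx₀F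
  have hx₀F' := (h'.mem x₀ (mem_exch.2 (.inr ⟨hx₀f, hx₀⟩)) (D.subset _ _ hx₀F)).resolve_right hx₀G
  obtain ⟨z₀, hz₀, hz₀E, hz₀F⟩ := hl.leftF
  have hz₀G := (hl.cover hWl (hQlWl hz₀) hz₀E).resolve_left hz₀F
  have hz₀F' := (h'.notMem z₀ hz₀ hz₀E).resolve_right (by simpa)
  have hx₀W' : x₀ ∉ exch Wl d f := by
    rw [mem_exch]
    rintro (rfl | h)
    · exact hfF hx₀F
    · exact hQWl _ hx₀ h.2
  obtain rfl := h'.tightF.eq_of_mem_of_notMem hB tF.ge (hW' _ hz₀) hz₀E hz₀F' hz₀F hx₀W' hx₀F' hx₀F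
  have := h'.tightF
  unfold Tight at this
  omega

/-- `d` is the element that the current step moved from the right window to the left one. In the
first case of `hd`, `f` is taken from a tight set of the left window that contains `d`, and the
right pair breaks. In the second case, `f` is taken outside a tight set of the right window that
misses `d`, and the left pair breaks. This choice allows one of the two exchanges, and `hd` allows
the other. -/
lemma DoublyTight.exists_exch {Wl Wr Ql Q Qr : Finset α} {Fl Gl Fr Gr : Fin (D.q i)} {d : α}
    (hWl : D.IsBase Wl) (hWr : D.IsBase Wr)
    (hl : D.DoublyTight i Wl Ql Q Fl Gl) (hr : D.DoublyTight i Wr Q Qr Fr Gr)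
    (hQlWl : Ql ⊆ Wl) (hQWl : ∀ y ∈ Q, y ∉ Wl) (hQWr : Q ⊆ Wr) (hQrWr : ∀ y ∈ Qr, y ∉ Wr)
    (hdE : d ∈ D.E i) (hdWl : d ∈ Wl) (hdWr : d ∉ Wr) (hdQl : d ∉ Ql) (hdQr : d ∉ Qr)
    (hd : (d ∉ D.H i Fr ∧ d ∉ D.H i Gr) ∨ (d ∈ D.H i Fl ∧ d ∈ D.H i Gl)) :
    ∃ f ∈ Q, D.IsBase (exch Wl d f) ∧ D.IsBase (exch Wr f d) ∧
      ¬ ((∃ F G, D.DoublyTight i (exch Wl d f) Ql (exch Q f d) F G) ∧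
        ∃ F G, D.DoublyTight i (exch Wr f d) (exch Q f d) Qr F G) := by
  by_cases hA : d ∉ D.H i Fr ∧ d ∉ D.H i Gr
  · clear hd
    wlog hdF : d ∈ D.H i Fl generalizing Fl Gl
    · exact this hl.symm ((hl.cover hWl hdWl hdE).resolve_left hdF)
    obtain ⟨f, hf, hfF⟩ := hl.rightF
    have hfE := D.subset _ _ hfF
    have hBr : D.IsBase (exch Wr f d) := by
      rw [isBase_exch_iff hWr (hQWr hf) hdWr hfE hdE]
      rintro ⟨j, tj, hfj, hdj⟩
      rcases hr.notMem f hf hfE with h | h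
      · obtain rfl := hr.tightF.eq_of_notMem hWr tj (hQWr hf) hfE h hfj
        exact hA.1 hdj
      · obtain rfl := hr.tightG.eq_of_notMem hWr tj (hQWr hf) hfE h hfj
        exact hA.2 hdj
    refine ⟨f, hf, ?_, hBr, ?_⟩
    · rw [isBase_exch_iff hWl hdWl (hQWl _ hf) hdE hfE]
      rintro ⟨j, tj, hdj, hfj⟩
      obtain rfl := hl.tightF.eq_of_mem hWl tj (hQWl _ hf) hfF hfj
      exact hdj hdF
    · rintro ⟨-, F', G', h'⟩
      rcases hr.notMem f hf hfE with h | h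
      · exact hr.not_exch_right hWr hQWr hQrWr hdE hdWr hdQr hf hA.1 hA.2 h
          ((hr.cover hWr (hQWr hf) hfE).resolve_left h) hBr h'
      · exact hr.symm.not_exch_right hWr hQWr hQrWr hdE hdWr hdQr hf hA.2 hA.1 h
          ((hr.cover hWr (hQWr hf) hfE).resolve_right h) hBr h'
  · replace hd := hd.resolve_left hA
    wlog hdr : d ∈ D.H i Fr generalizing Fr Gr
    · refine this hr.symm (by tauto) ?_
      by_contra h
      exact hA ⟨hdr, h⟩
    obtain ⟨f, hf, hfE, hfG⟩ := hr.leftG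
    have hBl : D.IsBase (exch Wl d f) := by
      rw [isBase_exch_iff hWl hdWl (hQWl _ hf) hdE hfE]
      rintro ⟨j, tj, hdj, hfj⟩
      rcases hl.mem f hf hfE with h | h
      · obtain rfl := hl.tightF.eq_of_mem hWl tj (hQWl _ hf) h hfj
        exact hdj hd.1
      · obtain rfl := hl.tightG.eq_of_mem hWl tj (hQWl _ hf) h hfj
        exact hdj hd.2
    refine ⟨f, hf, hBl, ?_, ?_⟩
    · rw [isBase_exch_iff hWr (hQWr hf) hdWr hfE hdE]
      rintro ⟨j, tj, hfj, hdj⟩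
      obtain rfl := hr.tightG.eq_of_notMem hWr tj (hQWr hf) hfE hfG hfj
      exact hdWr (hr.mem_of_mem hWr hdr hdj)
    · rintro ⟨⟨F', G', h'⟩, -⟩
      by_cases h : f ∈ D.H i Fl
      · exact hl.symm.not_exch_left hWl hQlWl hQWl hdWl hdQl hf hd.2 hd.1
          (fun h2 ↦ hQWl _ hf (hl.mem_of_mem hWl h h2)) h hBl h'.symm
      · exact hl.not_exch_left hWl hQlWl hQWl hdWl hdQl hf hd.1 hd.2 h
          ((hl.mem f hf hfE).resolve_left h) hBl h'

end SplitSystem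

open Finset

namespace SplitSystem

variable {α : Type*} [DecidableEq α] {D : SplitSystem α}

/-! ### Classes of elements -/

/-- The trivial exchange, or an exchange of a member of `B` for a nonmember allowed by `R`. -/
def Arrow (R : α → α → Prop) (B : Finset α) (x y : α) : Prop := x = y ∨ (y ∉ B ∧ R x y)

/-- The class of `c`: what is reached by at most five exchanges between `B` and `S`. -/
def InClass (R : α → α → Prop) (B S : Finset α) (c y : α) : Prop :=
  ∃ z₁ ∈ B, ∃ z₂ ∈ B, (∃ u ∈ S, Arrow R B c u ∧ Arrow R B z₁ u) ∧
    (∃ u ∈ S, Arrow R B z₁ u ∧ Arrow R B z₂ u) ∧ Arrow R B z₂ y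

/-- Exchanges that keep the base `W` a base. -/
def Exchanges (D : SplitSystem α) (W : Finset α) (x y : α) : Prop := D.IsBase (exch W x y)

variable {i : Fin D.t} {B S : Finset α} {c x y : α}

lemma Arrow.mem_iff (hB : D.IsBase B) (hx : x ∈ B) (h : Arrow (D.Exchanges B) B x y) :
    x ∈ D.E i ↔ y ∈ D.E i := by
  rcases h with rfl | ⟨hy, h⟩
  · rfl
  · refine ⟨fun hxE ↦ mem_of_isBase_exch hB h hx hy hxE, fun hyE ↦ ?_⟩
    obtain ⟨i', hi'⟩ := hB.1 x hx
    have := mem_of_isBase_exch hB h hx hy hi'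
    rwa [D.disj _ _ _ hyE this]

lemma InClass.iff_of_arrow {p : α → Prop} (h : InClass (D.Exchanges B) B S c y) (hc : c ∈ B)
    (hp : ∀ x ∈ B, ∀ y, Arrow (D.Exchanges B) B x y → (p x ↔ p y)) : p c ↔ p y := by
  obtain ⟨z₁, hz₁, z₂, hz₂, ⟨u, -, h1, h2⟩, ⟨v, -, h3, h4⟩, h5⟩ := h
  rw [hp c hc u h1, ← hp z₁ hz₁ u h2, hp z₁ hz₁ v h3, ← hp z₂ hz₂ v h4, hp z₂ hz₂ y h5]

lemma InClass.mem_iff (hB : D.IsBase B) (hc : c ∈ B) (h : InClass (D.Exchanges B) B S c y) :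
    c ∈ D.E i ↔ y ∈ D.E i :=
  h.iff_of_arrow hc fun _ hx _ ↦ Arrow.mem_iff hB hx

/-- The component `i` is the direct sum of two uniform matroids on the constrained sets `F`
and `G`. -/
structure UniformPair (D : SplitSystem α) (i : Fin D.t) (F G : Fin (D.q i)) : Prop where
  ne : F ≠ G
  cover : ∀ x ∈ D.E i, x ∈ D.H i F ∨ x ∈ D.H i G
  disjoint : ∀ x ∈ D.H i F, x ∉ D.H i G
  tight : ∀ W, D.IsBase W → D.Tight W i F ∧ D.Tight W i G

lemma UniformPair.symm {F G : Fin (D.q i)} (h : D.UniformPair i F G) : D.UniformPair i G F :=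
  ⟨h.ne.symm, fun x hx ↦ (h.cover x hx).symm, fun x hx hx' ↦ h.disjoint x hx' hx,
    fun W hW ↦ (h.tight W hW).symm⟩

/-- In `B` the disjoint sets `F` and `G` show that the two bounds add up to at most the rank. A base
covered by them within the component needs the full rank from them, so it meets both bounds. -/
lemma tight_of_cover {W : Finset α} {F G : Fin (D.q i)} (hB : D.IsBase B) (hW : D.IsBase W)
    (disjoint : ∀ x ∈ D.H i F, x ∉ D.H i G) (hF : D.Tight B i F) (hG : D.Tight B i G)
    (cover : ∀ x ∈ W, x ∈ D.E i → x ∈ D.H i F ∨ x ∈ D.H i G) :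
    D.Tight W i F ∧ D.Tight W i G := by
  have h1 : #(W ∩ D.H i F) + #(W ∩ D.H i G) = #(W ∩ D.E i) := by
    rw [← card_union_of_disjoint]
    · congr 1; ext a
      have := cover a
      have := @D.subset i F a
      have := @D.subset i G a
      simp only [mem_union, mem_inter]; tauto
    · rw [disjoint_left]; intro a; have := disjoint a; simp only [mem_inter]; tauto
  have h2 : #(B ∩ D.H i F) + #(B ∩ D.H i G) ≤ #(B ∩ D.E i) := by
    rw [← card_union_of_disjoint]
    · refine card_le_card fun a ↦ ?_
      have := @D.subset i F a
      have := @D.subset i G a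
      simp only [mem_union, mem_inter]; tauto
    · rw [disjoint_left]; intro a; have := disjoint a; simp only [mem_inter]; tauto
  have h3 := hB.2.1 i
  have h4 := hW.2.1 i
  have h5 := hW.2.2 i F
  have h6 := hW.2.2 i G
  unfold Tight at *
  omega

lemma UniformPair.isBase_exch {W : Finset α} {F G : Fin (D.q i)} (h : D.UniformPair i F G)
    (hW : D.IsBase W) (hx : x ∈ W) (hy : y ∉ W) (hxE : x ∈ D.E i) (hyE : y ∈ D.E i)
    (hxy : x ∈ D.H i F ↔ y ∈ D.H i F) : D.IsBase (exch W x y) := by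
  rw [isBase_exch_iff hW hx hy hxE hyE]
  rintro ⟨j, tj, hxj, hyj⟩
  obtain ⟨tF, tG⟩ := h.tight W hW
  rcases h.cover y hyE with hyF | hyG
  · obtain rfl := tF.eq_of_mem hW tj hy hyF hyj
    exact hxj (hxy.2 hyF)
  · obtain rfl := tG.eq_of_mem hW tj hy hyG hyj
    have hyF : y ∉ D.H i F := fun hF ↦ h.disjoint _ hF hyG
    rcases h.cover x hxE with hx' | hx'
    · exact hyF (hxy.1 hx')
    · exact hxj hx'

/-- As both constraints are always tight, an allowed exchange cannot leave its summand, and neither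
can a chain of exchanges. -/
lemma UniformPair.class_mem_iff {F G : Fin (D.q i)} (h : D.UniformPair i F G) (hB : D.IsBase B)
    (hc : c ∈ B) (hy : InClass (D.Exchanges B) B S c y) :
    c ∈ D.H i F ↔ y ∈ D.H i F := by
  refine hy.iff_of_arrow hc fun x hx y hxy ↦ ?_
  rcases hxy with rfl | ⟨hy, hxy⟩
  · rfl
  obtain ⟨tF, tG⟩ := h.tight B hB
  have hE : x ∈ D.E i ↔ y ∈ D.E i := Arrow.mem_iff hB hx (.inr ⟨hy, hxy⟩)
  have hbad : x ∈ D.E i → ¬ D.Bad i B x y := fun hxE ↦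
    (isBase_exch_iff hB hx hy hxE (hE.1 hxE)).1 hxy
  constructor
  · intro hxF
    have hxE := D.subset _ _ hxF
    by_contra hyF
    exact hbad hxE ⟨G, tG, h.disjoint _ hxF, (h.cover y (hE.1 hxE)).resolve_left hyF⟩
  · intro hyF
    have hxE := hE.2 (D.subset _ _ hyF)
    by_contra hxF
    exact hbad hxE ⟨F, tF, hxF, hyF⟩

/-- The component `i` is a single class. -/
def Connected (D : SplitSystem α) (i : Fin D.t) (B S : Finset α) : Prop :=
  ∀ c ∈ B, c ∈ D.E i → ∀ y ∈ D.E i, InClass (D.Exchanges B) B S c y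

lemma Connected.inClass_eq (h : D.Connected i B S) (hB : D.IsBase B) (hc : c ∈ B)
    (hcE : c ∈ D.E i) : InClass (D.Exchanges B) B S c = (· ∈ D.E i) := by
  ext y
  exact ⟨fun hy ↦ (InClass.mem_iff hB hc hy).1 hcE, h c hc hcE y⟩

/-- If `y` could not enter, the only tight constraint `F` containing `y` would be missed by every
member of `B` in the component. Its bound would then be zero, against `y ∈ B'`. -/
lemma exists_exch_of_mem {B' : Finset α} (hB : D.IsBase B) (hB' : D.IsBase B') (hyB' : y ∈ B')
    (hy : y ∉ B) (hyE : y ∈ D.E i) : ∃ x ∈ B, x ∈ D.E i ∧ D.IsBase (exch B x y) := by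
  have h0 : 0 < #(B ∩ D.E i) := by
    rw [hB.2.1 i, ← hB'.2.1 i]; exact card_pos.2 ⟨y, by simp [*]⟩
  obtain ⟨x, hx⟩ := card_pos.1 h0
  rw [mem_inter] at hx
  by_contra! hno
  have hbad : ∀ z ∈ B, z ∈ D.E i → D.Bad i B z y := fun z hz hzE ↦ by
    have := hno z hz hzE
    rwa [isBase_exch_iff hB hz hy hzE hyE, not_not] at this
  obtain ⟨F, tF, -, hyF⟩ := hbad x hx.1 hx.2
  have h1 : #(B ∩ D.H i F) = 0 := by
    rw [card_eq_zero, eq_empty_iff_forall_notMem]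
    intro z hz
    rw [mem_inter] at hz
    obtain ⟨j, tj, hzj, hyj⟩ := hbad z hz.1 (D.subset _ _ hz.2)
    obtain rfl := tF.eq_of_mem hB tj hy hyF hyj
    exact hzj hz.2
  have h2 : 0 < #(B' ∩ D.H i F) := card_pos.2 ⟨y, by simp [*]⟩
  have h3 := hB'.2.2 i F
  unfold Tight at tF
  omega

/-- A component is a single class, or the direct sum of two uniform matroids. -/
lemma connected_or_uniformPair (hB : D.IsBase B) (hS : D.E i ⊆ S)
    (hout : ∀ x ∈ B, ∃ y, y ∉ B ∧ D.IsBase (exch B x y))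
    (hin : ∀ y ∈ D.E i, ∃ B', D.IsBase B' ∧ y ∈ B') :
    D.Connected i B S ∨ ∃ F G, D.UniformPair i F G := by
  -- Unless the component decomposes, three arrows reach every `y ∉ B`; a member of `B` takes two
  -- more.
  by_cases hpath : ∃ c ∈ B, c ∈ D.E i ∧ ∃ y ∈ D.E i, y ∉ B ∧ ¬ ∃ z ∈ B, ∃ u ∈ S,
      Arrow (D.Exchanges B) B c u ∧ Arrow (D.Exchanges B) B z u ∧ Arrow (D.Exchanges B) B z y
  · right
    obtain ⟨c, hc, hcE, y, hyE, hy, hno⟩ := hpath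
    push Not at hno
    obtain ⟨y₀, hy₀, hcy₀⟩ := hout c hc
    have hy₀E := mem_of_isBase_exch hB hcy₀ hc hy₀ hcE
    obtain ⟨B', hB', hyB'⟩ := hin y hyE
    obtain ⟨x₁, hx₁, hx₁E, hx₁y⟩ := exists_exch_of_mem hB hB' hyB' hy hyE
    have hbad : ∀ x ∈ B, x ∈ D.E i → ∀ u ∉ B, u ∈ D.E i →
        (¬ D.IsBase (exch B x u) → D.Bad i B x u) := fun x hx hxE u hu huE h ↦ by
      rwa [isBase_exch_iff hB hx hu hxE huE, not_not] at h
    have h1 : D.Bad i B c y := hbad c hc hcE y hy hyE fun h ↦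
      hno c hc y (hS hyE) (.inr ⟨hy, h⟩) (.inr ⟨hy, h⟩) (.inr ⟨hy, h⟩)
    have hz : ∀ z ∈ B, z ∈ D.E i → D.Bad i B z y₀ ∨ D.Bad i B z y := by
      intro z hz hzE
      by_contra! hc'
      rw [← isBase_exch_iff hB hz hy₀ hzE hy₀E, ← isBase_exch_iff hB hz hy hzE hyE] at hc'
      exact hno z hz y₀ (hS hy₀E) (.inr ⟨hy₀, hcy₀⟩) (.inr ⟨hy₀, hc'.1⟩) (.inr ⟨hy, hc'.2⟩)
    have hu : ∀ u ∉ B, u ∈ D.E i → D.Bad i B c u ∨ D.Bad i B x₁ u := by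
      intro u hu huE
      by_contra! hc'
      rw [← isBase_exch_iff hB hc hu hcE huE, ← isBase_exch_iff hB hx₁ hu hx₁E huE] at hc'
      exact hno x₁ hx₁ u (hS huE) (.inr ⟨hu, hc'.1⟩) (.inr ⟨hu, hc'.2⟩) (.inr ⟨hy, hx₁y⟩)
    have h2 : D.Bad i B x₁ y₀ := (hz x₁ hx₁ hx₁E).resolve_right
      ((isBase_exch_iff hB hx₁ hy hx₁E hyE).1 hx₁y)
    obtain ⟨F, tF, cF, yF⟩ := h1
    obtain ⟨G, tG, xG, yG⟩ := h2
    have hFG : F ≠ G := by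
      rintro rfl
      exact (isBase_exch_iff hB hc hy₀ hcE hy₀E).1 hcy₀ ⟨F, tF, cF, yG⟩
    -- A common element lies in `B` because both sets are tight. By `hz` it then misses the only
    -- tight set containing `y₀` or the only one containing `y`, that is, `G` or `F`.
    have hdisj : ∀ x ∈ D.H i F, x ∉ D.H i G := by
      intro x hxF hxG
      have hxB : x ∈ B := by
        by_contra hxB
        exact hFG (tF.eq_of_mem hB tG hxB hxF hxG)
      rcases hz x hxB (D.subset _ _ hxF) with ⟨j, tj, xj, yj⟩ | ⟨j, tj, xj, yj⟩
      · obtain rfl := tG.eq_of_mem hB tj hy₀ yG yj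
        exact xj hxG
      · obtain rfl := tF.eq_of_mem hB tj hy yF yj
        exact xj hxF
    have hcov : ∀ x ∈ D.E i, x ∈ D.H i F ∨ x ∈ D.H i G := by
      intro x hxE
      by_cases hxB : x ∈ B
      · by_contra! hc'
        exact hFG (tF.eq_of_notMem hB tG hxB hxE hc'.1 hc'.2)
      · rcases hu x hxB hxE with ⟨j, tj, cj, xj⟩ | ⟨j, tj, cj, xj⟩
        · obtain rfl := tF.eq_of_notMem hB tj hc hcE cF cj
          exact .inl xj
        · obtain rfl := tG.eq_of_notMem hB tj hx₁ hx₁E xG cj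
          exact .inr xj
    exact ⟨F, G, hFG, hcov, hdisj,
      fun W hW ↦ tight_of_cover hB hW hdisj tF tG fun x _ hx ↦ hcov x hx⟩
  · left
    push Not at hpath
    have hrefl : ∀ z, Arrow (D.Exchanges B) B z z := fun z ↦ .inl rfl
    intro c hc hcE y hyE
    by_cases hy : y ∈ B
    · obtain ⟨u, hu, hyu⟩ := hout y hy
      have huE := mem_of_isBase_exch hB hyu hy hu hyE
      obtain ⟨z, hz, v, hv, h1, h2, h3⟩ := hpath c hc hcE u huE hu
      exact ⟨z, hz, y, hy, ⟨v, hv, h1, h2⟩, ⟨u, hS huE, h3, .inr ⟨hu, hyu⟩⟩, hrefl y⟩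
    · obtain ⟨z, hz, v, hv, h1, h2, h3⟩ := hpath c hc hcE y hyE hy
      exact ⟨z, hz, z, hz, ⟨v, hv, h1, h2⟩, ⟨v, hv, h2, h2⟩, h3⟩

/-! ### Layers -/

/-- The windows of a layer. -/
def window (B P : ℕ → Finset α) (m : ℕ) : Finset α := (B m \ P m) ∪ P (m + 1)

/-- The data of a layer: a cyclic sequence of disjoint bases with chosen subsets `P m` such that
all windows `(B m \ P m) ∪ P (m + 1)` are bases. -/
structure Layer (D : SplitSystem α) (k : ℕ) (B P : ℕ → Finset α) : Prop where
  two_le : 2 ≤ k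
  periodicB : Function.Periodic B k
  periodicP : Function.Periodic P k
  disjoint : ∀ m, Disjoint (B m) (B (m + 1))
  sub : ∀ m, P m ⊆ B m
  baseB : ∀ m, D.IsBase (B m)
  base : ∀ m, D.IsBase (window B P m)
  ground : ∀ i, ∀ x ∈ D.E i, ∃ m, x ∈ B m
  exchange : ∀ X Y, D.IsBase X → D.IsBase Y → ∀ x ∈ X, x ∉ Y →
    ∃ y ∈ Y, y ∉ X ∧ D.IsBase (exch X x y)

/-- The component `i` is doubly tight at level `m`. -/
def DT (D : SplitSystem α) (B P : ℕ → Finset α) (i : Fin D.t) (m : ℕ) : Prop :=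
  ∃ F G, D.DoublyTight i (window B P m) (B m \ P m) (B (m + 1) \ P (m + 1)) F G

/-- The class of `c` is split at level `m`. -/
def ClassSplit (D : SplitSystem α) (B P : ℕ → Finset α) (S : Finset α) (c : α) (m : ℕ) : Prop :=
  SplitAt (D.Exchanges (window B P m)) (InClass (D.Exchanges (B 0)) (B 0) S c) (B m \ P m)
    (B (m + 1) \ P (m + 1))

lemma sdiff_subset_window {B P : ℕ → Finset α} (m : ℕ) : B m \ P m ⊆ window B P m :=
  subset_union_left

namespace Layer

variable {k : ℕ} {B P : ℕ → Finset α}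

lemma notMem_window (L : D.Layer k B P) {m : ℕ} {y : α}
    (hy : y ∈ B (m + 1) \ P (m + 1)) : y ∉ window B P m := by
  rw [mem_sdiff] at hy
  have : y ∈ B m → y ∉ B (m + 1) := fun h ↦ disjoint_left.1 (L.disjoint m) h
  simp only [window, mem_union, mem_sdiff]
  tauto

lemma periodic_window (L : D.Layer k B P) : Function.Periodic (window B P) k := by
  intro m
  have h1 := L.periodicB m
  have h2 := L.periodicP m
  have h3 := L.periodicP (m + 1)
  rw [show m + 1 + k = m + k + 1 by ring] at h3
  simp only [window, h1, h2, h3]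

lemma splitAt_iff_DT (L : D.Layer k B P) (i : Fin D.t) (m : ℕ) :
    SplitAt (D.Exchanges (window B P m)) (· ∈ D.E i) (B m \ P m) (B (m + 1) \ P (m + 1)) ↔
      D.DT B P i m :=
  splitAt_iff (L.base m) (sdiff_subset_window m) fun _ hy ↦ L.notMem_window hy

lemma connected_or_uniformPair (L : D.Layer k B P) {S : Finset α} (hS : ∀ i, D.E i ⊆ S)
    (i : Fin D.t) :
    D.Connected i (B 0) S ∨ ∃ F G, D.UniformPair i F G := by
  refine SplitSystem.connected_or_uniformPair (L.baseB 0) (hS i) ?_ ?_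
  · intro x hx
    obtain ⟨y, -, hy, h⟩ := L.exchange _ _ (L.baseB 0) (L.baseB 1) x hx
      (disjoint_left.1 (L.disjoint 0) hx)
    exact ⟨y, hy, h⟩
  · intro y hy
    obtain ⟨m, hm⟩ := L.ground i y hy
    exact ⟨_, L.baseB m, hm⟩

lemma classSplit_iff (L : D.Layer k B P) {S : Finset α} (hi : D.Connected i (B 0) S) {c : α}
    (hc : c ∈ B 0)
    (hcE : c ∈ D.E i) (m : ℕ) : D.ClassSplit B P S c m ↔ D.DT B P i m := by
  rw [ClassSplit, hi.inClass_eq (L.baseB 0) hc hcE, L.splitAt_iff_DT]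

/-- A class stays inside one uniform summand, where every exchange is allowed, whereas a split needs
a forbidden one. -/
lemma not_classSplit (L : D.Layer k B P) {S : Finset α} {F G : Fin (D.q i)}
    (hi : D.UniformPair i F G) {c : α}
    (hc : c ∈ B 0) (hcE : c ∈ D.E i) (m : ℕ) : ¬ D.ClassSplit B P S c m := by
  rintro ⟨z, hz, -, -, y, hy, -, -, cz, -, cy, -, h, -⟩
  refine h (hi.isBase_exch (L.base m) (sdiff_subset_window m hz) (L.notMem_window hy)
    ((InClass.mem_iff (L.baseB 0) hc cz).1 hcE) ((InClass.mem_iff (L.baseB 0) hc cy).1 hcE) ?_)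
  rw [← hi.class_mem_iff (L.baseB 0) hc cz, ← hi.class_mem_iff (L.baseB 0) hc cy]

/-- Window `m` and block `m + 1` share `P (m + 1)` and meet `A` equally often, hence so do the
remainders `B m \ P m` and `B (m + 1) \ P (m + 1)`. -/
lemma card_sdiff_inter (L : D.Layer k B P) {A : Finset α} {n : ℕ}
    (hA : ∀ X, D.IsBase X → #(X ∩ A) = n) (m : ℕ) :
    #((B m \ P m) ∩ A) = #((B 0 \ P 0) ∩ A) := by
  induction m with
  | zero => rfl
  | succ m ih =>
    rw [← ih]
    have h1 : #(window B P m ∩ A) = #((B m \ P m) ∩ A) + #(P (m + 1) ∩ A) := by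
      rw [← card_union_of_disjoint, ← union_inter_distrib_right, window]
      rw [disjoint_left]
      intro a
      have : a ∈ B m → a ∉ B (m + 1) := fun h ↦ disjoint_left.1 (L.disjoint m) h
      have : a ∈ P (m + 1) → a ∈ B (m + 1) := fun h ↦ L.sub (m + 1) h
      simp only [mem_inter, mem_sdiff]; tauto
    have h2 : #(B (m + 1) ∩ A) = #((B (m + 1) \ P (m + 1)) ∩ A) + #(P (m + 1) ∩ A) := by
      rw [← card_union_of_disjoint, ← union_inter_distrib_right,
        sdiff_union_of_subset (L.sub (m + 1))]
      rw [disjoint_left]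
      intro a
      simp only [mem_inter, mem_sdiff]; tauto
    have h3 : #(window B P m ∩ A) = n := hA _ (L.base m)
    have h4 := hA _ (L.baseB (m + 1))
    omega

lemma exists_periodic_mem (L : D.Layer k B P) {A : Finset α} {n : ℕ}
    (hA : ∀ X, D.IsBase X → #(X ∩ A) = n)
    {m : ℕ} {x : α} (hx : x ∈ B m \ P m) (hxA : x ∈ A) (a : ℕ) :
    ((B a \ P a) ∩ A).Nonempty := by
  rw [← card_pos, L.card_sdiff_inter hA a, ← L.card_sdiff_inter hA m, card_pos]
  exact ⟨x, by simp_all⟩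

/-- As long as the classes are not split all around, there is a transversal for the next layer. -/
lemma exists_transversal (L : D.Layer k B P) {S : Finset α} (hS : ∀ i, D.E i ⊆ S)
    (hok : ∀ c ∈ B 0, ¬ ∀ m, D.ClassSplit B P S c m) {m : ℕ} {x : α} (hx : x ∈ B m \ P m) :
    ∃ e : ℕ → α, Function.Periodic e k ∧ (∀ a, e a ∈ B a \ P a) ∧
      ∀ a, D.IsBase (exch (window B P a) (e a) (e (a + 1))) := by
  obtain ⟨i, hxE⟩ := (L.baseB m).1 x (mem_sdiff.1 hx).1
  rcases L.connected_or_uniformPair hS i with hi | ⟨F, G, hi⟩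
  · have hne := L.exists_periodic_mem (fun X hX ↦ hX.2.1 i) hx hxE
    have hc : ∃ c ∈ B 0, c ∈ D.E i := by
      obtain ⟨c, hc⟩ := hne 0
      simp only [mem_inter, mem_sdiff] at hc
      exact ⟨c, hc.1.1, hc.2⟩
    obtain ⟨c, hc, hcE⟩ := hc
    have hQ : Function.Periodic (fun a ↦ (B a \ P a) ∩ D.E i) k := fun a ↦ by
      simp only [L.periodicB a, L.periodicP a]
    have hg : Function.Periodic (fun a ↦ D.Exchanges (window B P a)) k := fun a ↦ by
      simp only [L.periodic_window a]
    have hright : ∀ a, ∀ x ∈ (B a \ P a) ∩ D.E i, ∃ y ∈ (B (a + 1) \ P (a + 1)) ∩ D.E i,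
        D.Exchanges (window B P a) x y := by
      intro a z hz
      rw [mem_inter] at hz
      have hzW := sdiff_subset_window a hz.1
      -- Exchange against the whole block `B (a + 1)`: the new element is outside the window, so it
      -- has not been chosen yet.
      obtain ⟨y, hy, hyW, hb⟩ := L.exchange _ _ (L.base a) (L.baseB (a + 1)) z hzW
        (disjoint_left.1 (L.disjoint a) (mem_sdiff.1 hz.1).1)
      refine ⟨y, mem_inter.2 ⟨mem_sdiff.2 ⟨hy, fun hyP ↦ hyW (mem_union_right _ hyP)⟩,
        mem_of_isBase_exch (L.base a) hb hzW hyW hz.2⟩, hb⟩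
    have hrect : ∀ a, ∀ x ∈ (B a \ P a) ∩ D.E i, ∀ x' ∈ (B a \ P a) ∩ D.E i,
        ∀ y ∈ (B (a + 1) \ P (a + 1)) ∩ D.E i, ∀ y' ∈ (B (a + 1) \ P (a + 1)) ∩ D.E i,
        ¬ D.Exchanges (window B P a) x y → ¬ D.Exchanges (window B P a) x y' →
        ¬ D.Exchanges (window B P a) x' y → ¬ D.Exchanges (window B P a) x' y' := by
      intro a x hx x' hx' y hy y' hy'
      simp only [mem_inter] at hx hx' hy hy'
      have hw : ∀ z ∈ B a \ P a, z ∈ D.E i → ∀ u ∈ B (a + 1) \ P (a + 1), u ∈ D.E i →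
          (¬ D.Exchanges (window B P a) z u ↔ D.Bad i (window B P a) z u) := by
        intro z hz hzE u hu huE
        rw [Exchanges, isBase_exch_iff (L.base a) (sdiff_subset_window a hz)
          (L.notMem_window hu) hzE huE, not_not]
      rw [hw _ hx.1 hx.2 _ hy.1 hy.2, hw _ hx.1 hx.2 _ hy'.1 hy'.2, hw _ hx'.1 hx'.2 _ hy.1 hy.2,
        hw _ hx'.1 hx'.2 _ hy'.1 hy'.2]
      exact Bad.rectangle (L.base a) (L.notMem_window hy.1) (sdiff_subset_window a hx.1) hx.2
    rcases exists_periodic_or_splitAt L.two_le hQ hg hne hright hrect with ⟨e, h1, h2, h3⟩ | hsplit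
    · exact ⟨e, h1, fun a ↦ (mem_inter.1 (h2 a)).1, h3⟩
    · refine absurd (fun m ↦ ?_) (hok c hc)
      rw [L.classSplit_iff hi hc hcE, ← L.splitAt_iff_DT]
      obtain ⟨z₀, hz₀, z₁, hz₁, y₀, hy₀, y₁, hy₁, -, -, -, -, h1, h2, h3, h4, h5⟩ := hsplit m
      rw [mem_inter] at hz₀ hz₁ hy₀ hy₁
      exact ⟨z₀, hz₀.1, z₁, hz₁.1, y₀, hy₀.1, y₁, hy₁.1, hz₀.2, hz₁.2, hy₀.2, hy₁.2, h1, h2, h3,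
        fun z hz hzE ↦ h4 z (mem_inter.2 ⟨hz, hzE⟩) trivial,
        fun y hy hyE ↦ h5 y (mem_inter.2 ⟨hy, hyE⟩) trivial⟩
  -- In a sum of two uniform matroids, arbitrary unchosen elements of one summand form a
  -- transversal.
  · wlog hxF : x ∈ D.H i F generalizing F G
    · exact this G F hi.symm ((hi.cover x hxE).resolve_left hxF)
    have hne := L.exists_periodic_mem (fun X hX ↦ (hi.tight X hX).1) hx hxF
    choose e he using hne
    simp only [mem_inter] at he
    have h' : ∀ a, e (a % k) ∈ B a \ P a ∧ e (a % k) ∈ D.H i F := fun a ↦ by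
      have := he (a % k)
      rwa [L.periodicB.map_mod_nat, L.periodicP.map_mod_nat] at this
    refine ⟨fun a ↦ e (a % k), fun a ↦ by simp, fun a ↦ (h' a).1, fun a ↦ ?_⟩
    exact hi.isBase_exch (L.base a) (sdiff_subset_window a (h' a).1)
      (L.notMem_window (h' (a + 1)).1) (D.subset _ _ (h' a).2) (D.subset _ _ (h' (a + 1)).2)
      ⟨fun _ ↦ (h' (a + 1)).2, fun _ ↦ (h' a).2⟩

end Layer

end SplitSystem

open Finset

/-! ### Passing to the next layer and repairing a transversal -/

section exch

variable {α : Type*} [DecidableEq α] {W : Finset α} {d f x y : α}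

lemma exch_exch_of_notMem (hd : d ∉ W) : exch (exch W x d) d f = exch W x f := by
  ext z
  have hz : z ∈ W → z ≠ d := fun h h' ↦ hd (h' ▸ h)
  simp only [mem_exch]; tauto

lemma exch_exch_of_mem (hd : d ∈ W) (hdf : d ≠ f) (hfy : f ≠ y) :
    exch (exch W d y) f d = exch W f y := by
  ext z
  have hz : z = d → z ≠ f ∧ z ∈ W := by rintro rfl; exact ⟨hdf, hd⟩
  have hz' : z = y → z ≠ f := by rintro rfl; exact hfy.symm
  simp only [mem_exch]; tauto

lemma exch_erase (hd : d ∈ W) (hdf : d ≠ f) : exch (W.erase d) f d = W.erase f := by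
  ext z
  have hz : z = d → z ≠ f ∧ z ∈ W := by rintro rfl; exact ⟨hdf, hd⟩
  simp only [mem_exch, mem_erase]; tauto

end exch

namespace SplitSystem

variable {α : Type*} [DecidableEq α] {D : SplitSystem α} {i : Fin D.t}

/-- The chosen subsets of the next layer. -/
def next (P : ℕ → Finset α) (e : ℕ → α) (m : ℕ) : Finset α := insert (e m) (P m)

lemma DoublyTight.congr {W W' Q Q₁ R R₁ : Finset α} {F G : Fin (D.q i)}
    (h : D.DoublyTight i W Q R F G) (hW : ∀ x ∈ D.E i, x ∈ W ↔ x ∈ W')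
    (hQ : ∀ x ∈ D.E i, x ∈ Q ↔ x ∈ Q₁) (hR : ∀ x ∈ D.E i, x ∈ R ↔ x ∈ R₁) :
    D.DoublyTight i W' Q₁ R₁ F G := by
  have hT : ∀ j, D.Tight W i j → D.Tight W' i j := by
    intro j hj
    unfold Tight at *
    rw [← hj]
    congr 1; ext x
    have := hW x
    have := @D.subset i j x
    simp only [mem_inter]; tauto
  obtain ⟨z₀, hz₀, hz₀E, h1⟩ := h.leftF
  obtain ⟨z₁, hz₁, hz₁E, h2⟩ := h.leftG
  obtain ⟨y₀, hy₀, h3⟩ := h.rightF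
  obtain ⟨y₁, hy₁, h4⟩ := h.rightG
  exact ⟨h.ne, hT _ h.tightF, hT _ h.tightG, fun z hz hzE ↦ h.notMem z ((hQ z hzE).2 hz) hzE,
    fun y hy hyE ↦ h.mem y ((hR y hyE).2 hy) hyE, ⟨z₀, (hQ _ hz₀E).1 hz₀, hz₀E, h1⟩,
    ⟨z₁, (hQ _ hz₁E).1 hz₁, hz₁E, h2⟩, ⟨y₀, (hR _ (D.subset _ _ h3)).1 hy₀, h3⟩,
    ⟨y₁, (hR _ (D.subset _ _ h4)).1 hy₁, h4⟩⟩

namespace Layer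

variable {k : ℕ} {B P : ℕ → Finset α} {e : ℕ → α}

lemma window_next (L : D.Layer k B P) (he : ∀ a, e a ∈ B a \ P a) (m : ℕ) :
    window B (next P e) m = exch (window B P m) (e m) (e (m + 1)) := by
  ext x
  have h1 := he m
  rw [mem_sdiff] at h1
  have h3 : e m ∉ P (m + 1) := fun h ↦ disjoint_left.1 (L.disjoint m) h1.1 (L.sub _ h)
  have h4 : x = e m → x ∉ P (m + 1) := fun h ↦ h ▸ h3
  simp only [window, next, mem_exch, mem_union, mem_sdiff, mem_insert]
  tauto

lemma sdiff_next (m : ℕ) : B m \ next P e m = (B m \ P m).erase (e m) := by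
  ext x
  simp only [next, mem_sdiff, mem_insert, mem_erase]
  tauto

lemma nextLayer (L : D.Layer k B P) (hper : Function.Periodic e k) (he : ∀ a, e a ∈ B a \ P a)
    (hb : ∀ a, D.IsBase (exch (window B P a) (e a) (e (a + 1)))) : D.Layer k B (next P e) where
  two_le := L.two_le
  periodicB := L.periodicB
  periodicP m := by simp only [next, hper m, L.periodicP m]
  disjoint := L.disjoint
  sub m := insert_subset (mem_sdiff.1 (he m)).1 (L.sub m)
  baseB := L.baseB
  base m := by
    have := hb m
    rwa [← L.window_next he] at this
  ground := L.ground
  exchange := L.exchange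

/-- Allowed exchanges preserve the component, so a transversal lives in a single one. -/
lemma transversal_mem_iff (L : D.Layer k B P) (he : ∀ a, e a ∈ B a \ P a)
    (hb : ∀ a, D.IsBase (exch (window B P a) (e a) (e (a + 1)))) (a : ℕ) :
    e a ∈ D.E i ↔ e 0 ∈ D.E i := by
  have hstep : ∀ i a, e a ∈ D.E i → e (a + 1) ∈ D.E i := fun i a h ↦
    mem_of_isBase_exch (L.base a) (hb a) (sdiff_subset_window a (he a)) (L.notMem_window (he _)) h
  obtain ⟨i', hi'⟩ := (L.baseB 0).1 _ (mem_sdiff.1 (he 0)).1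
  have hall : ∀ a, e a ∈ D.E i' := fun a ↦ by
    induction a with
    | zero => exact hi'
    | succ a ih => exact hstep _ _ ih
  constructor
  · intro h; rwa [D.disj _ _ _ h (hall a)]
  · intro h; rw [D.disj _ _ _ h (hall 0)]; exact hall a

lemma DT_next_iff (L : D.Layer k B P) (he : ∀ a, e a ∈ B a \ P a) (hE : ∀ a, e a ∉ D.E i)
    (m : ℕ) : D.DT B (next P e) i m ↔ D.DT B P i m := by
  have hne : ∀ a, ∀ x ∈ D.E i, x ≠ e a := fun a x hx h ↦ hE a (h ▸ hx)
  have hW : ∀ x ∈ D.E i, x ∈ window B (next P e) m ↔ x ∈ window B P m := fun x hx ↦ by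
    rw [L.window_next he, mem_exch]
    have := hne m x hx
    have := hne (m + 1) x hx
    tauto
  have hQ : ∀ a, ∀ x ∈ D.E i, x ∈ B a \ next P e a ↔ x ∈ B a \ P a := fun a x hx ↦ by
    rw [sdiff_next, mem_erase]
    have := hne a x hx
    tauto
  constructor
  · rintro ⟨F, G, h⟩
    exact ⟨F, G, h.congr hW (hQ _) (hQ _)⟩
  · rintro ⟨F, G, h⟩
    exact ⟨F, G, h.congr (fun x hx ↦ (hW x hx).symm) (fun x hx ↦ (hQ _ x hx).symm)
      fun x hx ↦ (hQ _ x hx).symm⟩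

/-- The new window attains the bounds and the old one obeys them, so `e m ∈ F` forces `e (m + 1) ∈
F`, and likewise for `G`. By `h1` and `h2` both elements then lie in exactly one of the two sets,
and in the same one. The exchange changes neither count, so the pair was tight before. -/
lemma doublyTight_of_next (L : D.Layer k B P) (he : ∀ a, e a ∈ B a \ P a)
    (hb : ∀ a, D.IsBase (exch (window B P a) (e a) (e (a + 1)))) (hE : ∀ a, e a ∈ D.E i)
    {m : ℕ} {F G : Fin (D.q i)}
    (h : D.DoublyTight i (window B (next P e) m) (B m \ next P e m)
      (B (m + 1) \ next P e (m + 1)) F G)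
    (h1 : e m ∈ D.H i F ∨ e m ∈ D.H i G) (h2 : ¬ (e (m + 1) ∈ D.H i F ∧ e (m + 1) ∈ D.H i G)) :
    D.DoublyTight i (window B P m) (B m \ P m) (B (m + 1) \ P (m + 1)) F G := by
  have hcF := card_exch_inter (sdiff_subset_window m (he m)) (L.notMem_window (he (m + 1)))
    (D.H i F)
  have hcG := card_exch_inter (sdiff_subset_window m (he m)) (L.notMem_window (he (m + 1)))
    (D.H i G)
  have hlF := (L.base m).2.2 i F
  have hlG := (L.base m).2.2 i G
  change #(window B P m ∩ D.H i F) ≤ _ at hlF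
  change #(window B P m ∩ D.H i G) ≤ _ at hlG
  have htF := h.tightF
  have htG := h.tightG
  have hB' := hb m
  rw [L.window_next he] at htF htG
  unfold Tight at htF htG
  have hcov : e (m + 1) ∈ D.H i F ∨ e (m + 1) ∈ D.H i G :=
    h.cover (by rw [L.window_next he]; exact hb m)
      (by rw [L.window_next he]; exact mem_exch.2 (.inl rfl)) (hE _)
  have hsingle : (e m ∈ D.H i F ↔ e (m + 1) ∈ D.H i F) ∧ (e m ∈ D.H i G ↔ e (m + 1) ∈ D.H i G) := by
    have hF : e m ∈ D.H i F → e (m + 1) ∈ D.H i F := by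
      intro hm; by_contra hm'
      simp only [hm, hm', if_true, if_false] at hcF; omega
    have hG : e m ∈ D.H i G → e (m + 1) ∈ D.H i G := by
      intro hm; by_contra hm'
      simp only [hm, hm', if_true, if_false] at hcG; omega
    tauto
  rw [if_congr hsingle.1 rfl rfl] at hcF
  rw [if_congr hsingle.2 rfl rfl] at hcG
  have herase : ∀ a, ∀ x ∈ B a \ next P e a, x ∈ B a \ P a := fun a x hx ↦ by
    rw [sdiff_next] at hx; exact mem_of_mem_erase hx
  refine ⟨h.ne, ?_, ?_, ?_, ?_, ?_, ?_, ?_, ?_⟩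
  · unfold Tight; omega
  · unfold Tight; omega
  · intro z hz hzE
    by_cases hze : z = e m
    · subst hze; tauto
    · exact h.notMem z (by rw [sdiff_next]; exact mem_erase.2 ⟨hze, hz⟩) hzE
  · intro y hy hyE
    by_cases hye : y = e (m + 1)
    · subst hye; exact hcov
    · exact h.mem y (by rw [sdiff_next]; exact mem_erase.2 ⟨hye, hy⟩) hyE
  · obtain ⟨z, hz, h'⟩ := h.leftF; exact ⟨z, herase _ _ hz, h'⟩
  · obtain ⟨z, hz, h'⟩ := h.leftG; exact ⟨z, herase _ _ hz, h'⟩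
  · obtain ⟨z, hz, h'⟩ := h.rightF; exact ⟨z, herase _ _ hz, h'⟩
  · obtain ⟨z, hz, h'⟩ := h.rightG; exact ⟨z, herase _ _ hz, h'⟩

end Layer

/-- Change the value at the levels congruent to `p`. -/
def modifyAt {β : Type*} (k : ℕ) (e : ℕ → β) (p : ℕ) (f : β) (a : ℕ) : β :=
  if a % k = p % k then f else e a

lemma periodic_modifyAt {β : Type*} {k : ℕ} {e : ℕ → β} (hper : Function.Periodic e k) (m : ℕ)
    (f : β) :
    Function.Periodic (modifyAt k e m f) k := by
  intro a
  simp only [modifyAt, Nat.add_mod_right, hper a]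

namespace Layer

variable {k : ℕ} {B P : ℕ → Finset α} {e : ℕ → α}

lemma modifyAt_mem (L : D.Layer k B P) (he : ∀ a, e a ∈ B a \ P a) {m : ℕ} {f : α}
    (hf : f ∈ B m \ P m) (a : ℕ) : modifyAt k e m f a ∈ B a \ P a := by
  by_cases ha : a % k = m % k
  · rw [← L.periodicB.map_mod_nat, ← L.periodicP.map_mod_nat, ha, L.periodicB.map_mod_nat,
      L.periodicP.map_mod_nat, modifyAt, if_pos ha]
    exact hf
  · rw [modifyAt, if_neg ha]; exact he a

/-- The choice at level `m + 1` affects only the windows at levels `m` and `m + 1`. Replacing it by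
`f` is exactly the double exchange of `DoublyTight.exists_exch` in these two windows of the next
layer. -/
lemma exists_modifyAt_of_doublyTight (L : D.Layer k B P) (hper : Function.Periodic e k)
    (he : ∀ a, e a ∈ B a \ P a)
    (hb : ∀ a, D.IsBase (exch (window B P a) (e a) (e (a + 1)))) (hE : ∀ a, e a ∈ D.E i)
    {m : ℕ} {Fl Gl Fr Gr : Fin (D.q i)}
    (hl : D.DoublyTight i (window B (next P e) m) (B m \ next P e m)
      (B (m + 1) \ next P e (m + 1)) Fl Gl)
    (hr : D.DoublyTight i (window B (next P e) (m + 1)) (B (m + 1) \ next P e (m + 1))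
      (B (m + 2) \ next P e (m + 2)) Fr Gr)
    (hd : (e (m + 1) ∉ D.H i Fr ∧ e (m + 1) ∉ D.H i Gr) ∨
      (e (m + 1) ∈ D.H i Fl ∧ e (m + 1) ∈ D.H i Gl)) :
    ∃ f ∈ B (m + 1) \ P (m + 1),
      (∀ a, D.IsBase (exch (window B P a) (modifyAt k e (m + 1) f a)
        (modifyAt k e (m + 1) f (a + 1)))) ∧
      ¬ ∀ a, D.DT B (next P (modifyAt k e (m + 1) f)) i a := by
  have L' := L.nextLayer hper he hb
  have hdB := (mem_sdiff.1 (he (m + 1))).1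
  have hdl : e (m + 1) ∉ B m := fun h ↦ disjoint_left.1 (L.disjoint m) h hdB
  have hdr : e (m + 1) ∉ B (m + 2) := fun h ↦ disjoint_left.1 (L.disjoint (m + 1)) hdB h
  obtain ⟨f, hf, hBl, hBr, hno⟩ := hl.exists_exch (L'.base m) (L'.base (m + 1)) hr
    (sdiff_subset_window m) (fun y hy ↦ L'.notMem_window hy) (sdiff_subset_window (m + 1))
    (fun y hy ↦ L'.notMem_window hy) (hE (m + 1)) (d := e (m + 1))
    (mem_union_right _ (mem_insert_self _ _))
    (by
      rw [L.window_next he, mem_exch]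
      rintro (h | h)
      · exact hdr (h ▸ (mem_sdiff.1 (he (m + 2))).1)
      · exact h.1 rfl)
    (fun h ↦ hdl (mem_sdiff.1 h).1) (fun h ↦ hdr (mem_sdiff.1 h).1) hd
  change D.IsBase (exch (window B (next P e) m) _ _) at hBl
  change D.IsBase (exch (window B (next P e) (m + 1)) _ _) at hBr
  rw [sdiff_next, mem_erase] at hf
  obtain ⟨hfe, hf⟩ := hf
  have hfB := (mem_sdiff.1 hf).1
  have hk := L.two_le
  -- Neighbouring levels differ modulo `k`, so the choices at `m` and `m + 2` stay unchanged, even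
  -- for `k = 2` where these two levels coincide.
  have hmod : ∀ a, a % k ≠ (a + 1) % k := by
    intro a h
    have h1 : (1 : ℕ) % k = 0 % k :=
      Nat.ModEq.add_left_cancel' a (show a + 1 ≡ a + 0 [MOD k] from h.symm)
    rw [Nat.mod_eq_of_lt (by omega), Nat.zero_mod] at h1
    omega
  set e' := modifyAt k e (m + 1) f with he'
  have e'm : e' m = e m := if_neg (hmod m)
  have e'1 : e' (m + 1) = f := if_pos rfl
  have e'2 : e' (m + 2) = e (m + 2) := if_neg (hmod (m + 1)).symm
  have hper' : Function.Periodic e' k := periodic_modifyAt hper _ _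
  have he'Q : ∀ a, e' a ∈ B a \ P a := L.modifyAt_mem he hf
  have hWl : exch (window B (next P e) m) (e (m + 1)) f =
      exch (window B P m) (e' m) (e' (m + 1)) := by
    rw [L.window_next he, e'm, e'1, exch_exch_of_notMem (L.notMem_window (he (m + 1)))]
  have hWr : exch (window B (next P e) (m + 1)) f (e (m + 1)) =
      exch (window B P (m + 1)) (e' (m + 1)) (e' (m + 2)) := by
    have h2 : f ≠ e (m + 2) := fun h ↦
      disjoint_left.1 (L.disjoint (m + 1)) hfB (h ▸ (mem_sdiff.1 (he (m + 2))).1)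
    rw [L.window_next he, e'1, e'2]
    exact exch_exch_of_mem (sdiff_subset_window (m + 1) (he (m + 1))) hfe.symm h2
  have hQ : exch (B (m + 1) \ next P e (m + 1)) f (e (m + 1)) =
      B (m + 1) \ next P e' (m + 1) := by
    rw [sdiff_next, sdiff_next, e'1, exch_erase (he _) hfe.symm]
  have hQl : B m \ next P e m = B m \ next P e' m := by rw [sdiff_next, sdiff_next, e'm]
  have hQr : B (m + 2) \ next P e (m + 2) = B (m + 2) \ next P e' (m + 2) := by
    rw [sdiff_next, sdiff_next, e'2]
  refine ⟨f, hf, ?_, ?_⟩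
  · have hperΨ : Function.Periodic (fun a ↦ exch (window B P a) (e' a) (e' (a + 1))) k := by
      intro a
      have := hper' (a + 1)
      rw [show a + 1 + k = a + k + 1 by ring] at this
      simp only [L.periodic_window a, hper' a, this]
    intro a
    by_cases ha : a % k = m % k
    · have := hperΨ.map_mod_nat a
      rw [ha, hperΨ.map_mod_nat] at this
      rw [← this, ← hWl]; exact hBl
    by_cases ha' : a % k = (m + 1) % k
    · have := hperΨ.map_mod_nat a
      rw [ha', hperΨ.map_mod_nat] at this
      rw [← this]
      change D.IsBase (exch (window B P (m + 1)) (e' (m + 1)) (e' (m + 2)))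
      rw [← hWr]; exact hBr
    · have h2 : (a + 1) % k ≠ (m + 1) % k := fun h ↦
        ha (Nat.ModEq.add_right_cancel' 1 (show a + 1 ≡ m + 1 [MOD k] from h))
      simp only [modifyAt, if_neg ha', if_neg h2]
      exact hb a
  · intro hall
    refine hno ⟨?_, ?_⟩
    · have := hall m
      unfold DT at this
      rwa [L.window_next he'Q, ← hWl, ← hQ, ← hQl] at this
    · have := hall (m + 1)
      unfold DT at this
      rw [L.window_next he'Q] at this
      change ∃ F G, D.DoublyTight i (exch (window B P (m + 1)) (e' (m + 1)) (e' (m + 2)))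
        (B (m + 1) \ next P e' (m + 1)) (B (m + 2) \ next P e' (m + 2)) F G at this
      rwa [← hWr, ← hQ, ← hQr] at this

/-- If `doublyTight_of_next` applied at every level, the old layer would be doubly tight all around.
At a level `m` where it fails, `e m` lies outside both tight sets or `e (m + 1)` lies inside both.
These are the two configurations that an exchange can repair, at levels `m - 1, m` and at levels `m,
m + 1`. -/
lemma exists_modifyAt (L : D.Layer k B P) (hper : Function.Periodic e k)
    (he : ∀ a, e a ∈ B a \ P a)
    (hb : ∀ a, D.IsBase (exch (window B P a) (e a) (e (a + 1)))) (hE : ∀ a, e a ∈ D.E i)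
    (hnew : ∀ m, D.DT B (next P e) i m) (hold : ¬ ∀ m, D.DT B P i m) :
    ∃ m, ∃ f ∈ B m \ P m,
      (∀ a, D.IsBase (exch (window B P a) (modifyAt k e m f a) (modifyAt k e m f (a + 1)))) ∧
      ¬ ∀ a, D.DT B (next P (modifyAt k e m f)) i a := by
  have L' := L.nextLayer hper he hb
  have hk := L.two_le
  choose F G h using hnew
  by_cases hs : ∀ m, (e m ∈ D.H i (F m) ∨ e m ∈ D.H i (G m)) ∧
      ¬ (e (m + 1) ∈ D.H i (F m) ∧ e (m + 1) ∈ D.H i (G m))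
  · exact absurd (fun m ↦ ⟨F m, G m, L.doublyTight_of_next he hb hE (h m) (hs m).1 (hs m).2⟩) hold
  push Not at hs
  obtain ⟨m, hm⟩ := hs
  by_cases h1 : e m ∈ D.H i (F m) ∨ e m ∈ D.H i (G m)
  · exact ⟨m + 1, L.exists_modifyAt_of_doublyTight hper he hb hE (h m) (h (m + 1)) (.inr (hm h1))⟩
  -- `n` plays the role of level `m - 1`; adding the period covers `m = 0`.
  · obtain ⟨n, hn⟩ : ∃ n, m + k = n + 1 := ⟨m + k - 1, by omega⟩
    have hr := h m
    rw [← L'.periodic_window m, ← L'.periodicB m, ← L'.periodicP m, ← L'.periodicB (m + 1),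
      ← L'.periodicP (m + 1), show m + 1 + k = m + k + 1 by ring, hn] at hr
    rw [← hper m, hn] at h1
    push Not at h1
    exact ⟨n + 1, L.exists_modifyAt_of_doublyTight hper he hb hE (h n) hr (.inl h1)⟩

/-- A transversal, or a change of it at one level, leads to a layer where no class is split all
around. -/
theorem exists_good_modifyAt (L : D.Layer k B P) {S : Finset α} (hS : ∀ i, D.E i ⊆ S)
    (hok : ∀ c ∈ B 0, ¬ ∀ m, D.ClassSplit B P S c m) (hper : Function.Periodic e k)
    (he : ∀ a, e a ∈ B a \ P a)
    (hb : ∀ a, D.IsBase (exch (window B P a) (e a) (e (a + 1)))) :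
    (∀ c ∈ B 0, ¬ ∀ m, D.ClassSplit B (next P e) S c m) ∨ ∃ m, ∃ f ∈ B m \ P m,
      (∀ a, D.IsBase (exch (window B P a) (modifyAt k e m f a) (modifyAt k e m f (a + 1)))) ∧
      ∀ c ∈ B 0, ¬ ∀ a, D.ClassSplit B (next P (modifyAt k e m f)) S c a := by
  have L' := L.nextLayer hper he hb
  refine or_iff_not_imp_left.2 fun hbad ↦ ?_
  push Not at hbad
  obtain ⟨c, hc, hall⟩ := hbad
  obtain ⟨i, hcE⟩ := (L.baseB 0).1 c hc
  rcases L.connected_or_uniformPair hS i with hi | ⟨F, G, hi⟩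
  swap
  · exact absurd (hall 0) (L'.not_classSplit hi hc hcE 0)
  simp only [L'.classSplit_iff hi hc hcE] at hall
  have hold := hok c hc
  simp only [L.classSplit_iff hi hc hcE] at hold
  have hE0 : e 0 ∈ D.E i := by
    by_contra hE
    simp only [L.DT_next_iff he fun a ↦ mt (L.transversal_mem_iff he hb a).1 hE] at hall
    exact hold hall
  obtain ⟨m, f, hf, hb', hno⟩ := L.exists_modifyAt hper he hb
    (fun a ↦ (L.transversal_mem_iff he hb a).2 hE0) hall hold
  refine ⟨m, f, hf, hb', fun c' hc' ↦ ?_⟩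
  have he' := L.modifyAt_mem he hf
  have L'' := L.nextLayer (periodic_modifyAt hper m f) he' hb'
  obtain ⟨i', hcE'⟩ := (L.baseB 0).1 c' hc'
  rcases L.connected_or_uniformPair hS i' with hi' | ⟨F, G, hi'⟩
  swap
  · exact fun h ↦ L''.not_classSplit hi' hc' hcE' 0 (h 0)
  simp only [L''.classSplit_iff hi' hc' hcE']
  by_cases hii : i' = i
  · subst hii; exact hno
  -- Level `m + 1` keeps its element, so the changed transversal still lies in component `i`, and
  -- component `i'` is as tight as it was before.
  · have hold' := hok c' hc'
    simp only [L.classSplit_iff hi' hc' hcE'] at hold'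
    have hk := L.two_le
    have hE' : ∀ a, modifyAt k e m f a ∉ D.E i' := by
      have h1 : modifyAt k e m f (m + 1) ∈ D.E i := by
        have : ¬ (m + 1) % k = m % k := by
          intro h
          have h1 : (1 : ℕ) % k = 0 % k :=
            Nat.ModEq.add_left_cancel' m (show m + 1 ≡ m + 0 [MOD k] from h)
          rw [Nat.mod_eq_of_lt (by omega), Nat.zero_mod] at h1
          omega
        rw [modifyAt, if_neg this]
        exact (L.transversal_mem_iff he hb _).2 hE0
      intro a ha
      rw [L.transversal_mem_iff he' hb'] at h1 ha
      exact hii (D.disj _ _ _ ha h1)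
    simp only [L.DT_next_iff he' hE']
    exact hold'

/-- In the layer without chosen elements, no class is split all around. -/
theorem not_classSplit_empty (L : D.Layer k B fun _ ↦ ∅) {S : Finset α} (hS : ∀ i, D.E i ⊆ S)
    {c : α} (hc : c ∈ B 0) : ¬ ∀ m, D.ClassSplit B (fun _ ↦ ∅) S c m := by
  obtain ⟨i, hcE⟩ := (L.baseB 0).1 c hc
  rcases L.connected_or_uniformPair hS i with hi | ⟨F, G, hi⟩
  swap
  · exact fun h ↦ L.not_classSplit hi hc hcE 0 (h 0)
  simp only [L.classSplit_iff hi hc hcE]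
  intro hall
  have hall' : ∀ m, ∃ F G, D.DoublyTight i (B m) (B m) (B (m + 1)) F G := by
    simpa [DT, window] using hall
  obtain ⟨F, G, h⟩ := hall' 0
  -- Nothing has been chosen, so the left side of level `0` is all of `B 0` and none of its members
  -- lies in both sets. Nonmembers do not either, by tightness.
  have hdisj : ∀ x ∈ D.H i F, x ∉ D.H i G := by
    intro x hxF hxG
    have hxB := h.mem_of_mem (L.baseB 0) hxF hxG
    rcases h.notMem x hxB (D.subset _ _ hxF) with h' | h' <;> contradiction
  -- A tight set of `B m` that misses a member `z` equals whichever of the disjoint tight sets `F`,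
  -- `G` misses `z`. So the pair at level `m` is again `F`, `G`; it covers the component's part of
  -- `B (m + 1)`, and counting makes both tight there.
  have htight : ∀ m, D.Tight (B m) i F ∧ D.Tight (B m) i G := by
    intro m
    induction m with
    | zero => exact ⟨h.tightF, h.tightG⟩
    | succ m ih =>
      refine tight_of_cover (L.baseB m) (L.baseB (m + 1)) hdisj ih.1 ih.2 fun x hx hxE ↦ ?_
      obtain ⟨F', G', h'⟩ := hall' m
      have hpair : ∀ J, D.Tight (B m) i J → (∃ z ∈ B m, z ∈ D.E i ∧ z ∉ D.H i J) →
          J = F ∨ J = G := by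
        rintro J tJ ⟨z, hz, hzE, hzJ⟩
        by_cases hzF : z ∈ D.H i F
        · exact .inr (tJ.eq_of_notMem (L.baseB m) ih.2 hz hzE hzJ (hdisj z hzF))
        · exact .inl (tJ.eq_of_notMem (L.baseB m) ih.1 hz hzE hzJ hzF)
      have := h'.mem x hx hxE
      rcases hpair F' h'.tightF h'.leftF with rfl | rfl <;>
        rcases hpair G' h'.tightG h'.leftG with rfl | rfl <;> tauto
  have hcov : ∀ x ∈ D.E i, x ∈ D.H i F ∨ x ∈ D.H i G := by
    intro x hxE
    obtain ⟨m, hm⟩ := L.ground i x hxE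
    by_contra! hn
    exact h.ne ((htight m).1.eq_of_notMem (L.baseB m) (htight m).2 hm hxE hn.1 hn.2)
  have hU : D.UniformPair i F G := ⟨h.ne, hcov, hdisj, fun W hW ↦
    tight_of_cover (L.baseB 0) hW hdisj h.tightF h.tightG fun x _ hxE ↦ hcov x hxE⟩
  exact L.not_classSplit hU hc hcE 0 ((L.classSplit_iff hi hc hcE 0).2 (hall 0))

end Layer

end SplitSystem

/-! ### The algorithm -/

section Algorithm

variable {α : Type*}

/-- The `m`-th block, cyclically. -/
def blk (ls : List (List α)) (m : ℕ) : List α := ls.getD (m % ls.length) []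

/-- The window that starts at position `j` of block `m`. -/
def win (j : ℕ) (ls : List (List α)) (m : ℕ) : List α :=
  (blk ls m).drop j ++ (blk ls (m + 1)).take j

variable [DecidableEq α]

/-- The set in which `x ∈ Q` is exchanged for `y`. -/
def exchList (Q P : List α) (x y : α) : List α := Q.filter (fun z ↦ z ≠ x) ++ (P ++ [y])

/-- Move `x` to position `j`. -/
def moveTo (j : ℕ) (l : List α) (x : α) : List α :=
  l.take j ++ x :: (l.drop j).filter (fun z ↦ z ≠ x)

/-- All ways to choose the element at position `j`. -/
def moves (j : ℕ) (l : List α) : List (List α) := (l.drop j).map (moveTo j l)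

/-- `Arrow`, as far as the sets in `T` are known to be independent. -/
def ListArrow (T : List (List α)) (b : List α) (x y : α) : Prop :=
  x = y ∨ (y ∉ b ∧ exchList b [] x y ∈ T)

/-- Two members of `b` have a common neighbour. -/
def ListLink (T : List (List α)) (b S : List α) (x z : α) : Prop :=
  ∃ u ∈ S, ListArrow T b x u ∧ ListArrow T b z u

/-- `InClass`, as far as the sets in `T` are known to be independent. -/
def ListInClass (T : List (List α)) (b S : List α) (c y : α) : Prop :=
  ∃ z₁ ∈ b, ∃ z₂ ∈ b, ListLink T b S c z₁ ∧ ListLink T b S z₁ z₂ ∧ ListArrow T b z₂ y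

/-- The exchange of `x` for `y` in the window `Q ++ P` is known to give an independent set. -/
def ListExch (T : List (List α)) (Q P : List α) (x y : α) : Prop := exchList Q P x y ∈ T

/-- `SplitAt`, as far as the sets in `T` are known to be independent. -/
def ListSplitAt (T : List (List α)) (b S : List α) (c : α) (Q P Q' : List α) : Prop :=
  ∃ z₀ ∈ Q, ∃ z₁ ∈ Q, ∃ y₀ ∈ Q', ∃ y₁ ∈ Q', (ListInClass T b S c z₀ ∧ ListInClass T b S c z₁ ∧
    ListInClass T b S c y₀ ∧ ListInClass T b S c y₁) ∧
    ¬ ListExch T Q P z₀ y₀ ∧ ¬ ListExch T Q P z₁ y₁ ∧ ListExch T Q P z₀ y₁ ∧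
    (∀ z ∈ Q, ¬ ListInClass T b S c z ∨ ¬ ListExch T Q P z y₀ ∨ ¬ ListExch T Q P z y₁) ∧
    ∀ y ∈ Q', ¬ ListInClass T b S c y ∨ ¬ ListExch T Q P z₀ y ∨ ¬ ListExch T Q P z₁ y

/-- All windows at position `j` are known to be independent. -/
def WindowsIn (T : List (List α)) (j : ℕ) (ls : List (List α)) : Prop :=
  ∀ m < ls.length, win j ls m ∈ T

/-- The arrangement `ls` of the blocks is accepted at position `j`. -/
def Accepted (T : List (List α)) (bs : List (List α)) (j : ℕ) (ls : List (List α)) : Prop :=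
  WindowsIn T j ls ∧ ∀ c ∈ bs.headI, ¬ ∀ m < ls.length,
    ListSplitAt T bs.headI bs.flatten c ((blk ls m).drop j) ((blk ls (m + 1)).take j)
      ((blk ls (m + 1)).drop j)

/-- The queries about exchanges in the first block. -/
def baseQueries (bs : List (List α)) : List (List α) :=
  bs.headI.flatMap fun x ↦ bs.flatten.map fun y ↦ exchList bs.headI [] x y

/-- The queries about the windows at position `j` and exchanges in them. -/
def windowQueries (j : ℕ) (ls : List (List α)) : List (List α) :=
  (List.range ls.length).flatMap fun m ↦ win j ls m ::
    ((blk ls m).drop j).flatMap fun x ↦ ((blk ls (m + 1)).drop j).map fun y ↦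
      exchList ((blk ls m).drop j) ((blk ls (m + 1)).take j) x y

/-- All queries at position `j`. -/
def queries (bs : List (List α)) (j : ℕ) (cands : List (List (List α))) : List (List α) :=
  [] :: (baseQueries bs ++ cands.flatMap (windowQueries j))

open scoped Classical in
/-- The first accepted candidate. -/
noncomputable def pick (T : List (List α)) (bs : List (List α)) (j : ℕ)
    (cands : List (List (List α))) : List (List α) :=
  (cands.filter fun ls ↦ Accepted T bs j ls).headI

open scoped Classical in
/-- The first way to advance `ls` such that all windows at position `j + 1` are bases. -/
noncomputable def advance (T : List (List α)) (j : ℕ) (ls : List (List α)) : List (List α) :=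
  ((ls.map (moves j)).sections.filter fun ls' ↦ WindowsIn T (j + 1) ls').headI

/-- `ls'` and its changes in one block. -/
def variants (j : ℕ) (ls ls' : List (List α)) : List (List (List α)) :=
  ls' :: (List.range ls.length).flatMap fun m ↦ (moves j (blk ls m)).map fun o ↦ ls'.set m o

/-- The candidates for position `j + 1`. -/
noncomputable def nextCands (T : List (List α)) (bs : List (List α)) (j : ℕ)
    (cands : List (List (List α))) : List (List (List α)) :=
  variants j (pick T bs j cands) (advance T j (pick T bs j cands))

/-- The candidates of the algorithm with the oracle `O`. -/
noncomputable def run (O : List α → Bool) (bs : List (List α)) : ℕ → List (List (List α))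
  | 0 => [bs]
  | j + 1 => nextCands ((queries bs j (run O bs j)).filter O) bs j (run O bs j)

end Algorithm

/-! ### Its correctness -/

section Lists

section blk

variable {α : Type*}

lemma blk_add_length (ls : List (List α)) (m : ℕ) : blk ls (m + ls.length) = blk ls m := by
  simp [blk]

lemma blk_of_lt {ls : List (List α)} {m : ℕ} (h : m < ls.length) : blk ls m = ls[m] := by
  simp [blk, Nat.mod_eq_of_lt h, h]

lemma blk_mod (ls : List (List α)) (m : ℕ) : blk ls (m % ls.length) = blk ls m := by
  simp [blk]

end blk

variable {α : Type*} [DecidableEq α] {Q P : List α} {x y : α}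

lemma erase_eq_filter_ne (hnd : Q.Nodup) (x : α) : Q.erase x = Q.filter (fun z ↦ z ≠ x) := by
  rw [hnd.erase_eq_filter]
  exact List.filter_congr fun z _ ↦ by by_cases h : z = x <;> simp [h]

lemma toFinset_exchList (hnd : (Q ++ P).Nodup) (hx : x ∈ Q) :
    (exchList Q P x y).toFinset = exch (Q ++ P).toFinset x y := by
  ext z
  have hz : z = x → z ∉ P := by
    rintro rfl; exact List.disjoint_of_nodup_append hnd hx
  simp only [exchList, List.mem_toFinset, List.mem_append, List.mem_filter, List.mem_singleton,
    mem_exch, decide_eq_true_eq]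
  tauto

lemma nodup_exchList (hnd : (Q ++ P).Nodup) (hy : y ∉ Q ++ P) : (exchList Q P x y).Nodup := by
  have h : ((Q ++ P) ++ [y]).Nodup := by
    rw [List.nodup_append']
    exact ⟨hnd, by simp, by simpa using hy⟩
  rw [List.append_assoc] at h
  exact h.sublist ((List.filter_sublist).append_right _)

lemma length_filter_ne (hnd : Q.Nodup) (hx : x ∈ Q) :
    (Q.filter (fun z ↦ z ≠ x)).length + 1 = Q.length := by
  have := List.length_erase_add_one hx
  rwa [erase_eq_filter_ne hnd] at this

lemma length_exchList (hnd : (Q ++ P).Nodup) (hx : x ∈ Q) :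
    (exchList Q P x y).length = (Q ++ P).length := by
  have := length_filter_ne (List.nodup_append.1 hnd).1 hx
  simp only [exchList, List.length_append, List.length_singleton]
  omega

lemma moveTo_perm {j : ℕ} {l : List α} (hnd : l.Nodup) (hx : x ∈ l.drop j) :
    (moveTo j l x).Perm l := by
  have h1 : (x :: (l.drop j).filter (fun z ↦ z ≠ x)).Perm (l.drop j) := by
    have h2 := List.perm_cons_erase hx
    rw [erase_eq_filter_ne (hnd.sublist (List.drop_sublist j l))] at h2
    exact h2.symm
  conv_rhs => rw [← List.take_append_drop j l]
  exact h1.append_left _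

lemma take_moveTo_of_le {i j : ℕ} {l : List α} (hij : i ≤ j) (hj : j ≤ l.length) :
    (moveTo j l x).take i = l.take i := by
  rw [moveTo, List.take_append_of_le_length (by simp; omega), List.take_take, min_eq_left hij]

lemma take_moveTo {j : ℕ} {l : List α} (hj : j ≤ l.length) :
    (moveTo j l x).take (j + 1) = l.take j ++ [x] := by
  have : (l.take j).length = j := by simp [hj]
  rw [moveTo, List.take_append, this]
  simp

lemma drop_moveTo {j : ℕ} {l : List α} (hj : j ≤ l.length) :
    (moveTo j l x).drop (j + 1) = (l.drop j).filter (fun z ↦ z ≠ x) := by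
  have : (l.take j).length = j := by simp [hj]
  rw [moveTo, List.drop_append, this]
  simp

end Lists

open SplitSystem

lemma mem_flatten_of_mem_blk {α : Type*} {bs : List (List α)} {x : α} {m : ℕ}
    (hx : x ∈ blk bs m) : x ∈ bs.flatten := by
  rw [List.mem_flatten]
  refine ⟨blk bs m, ?_, hx⟩
  by_cases hl : bs.length = 0
  · simp [blk, List.length_eq_zero_iff.1 hl] at hx
  · rw [← blk_mod, blk_of_lt (Nat.mod_lt _ (by omega))]
    exact List.getElem_mem _

lemma periodic_iff {p : ℕ → Prop} {k : ℕ} (hk : 0 < k) (hp : Function.Periodic p k) :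
    (∀ m < k, p m) ↔ ∀ m, p m :=
  ⟨fun h m ↦ by rw [← hp.map_mod_nat]; exact h _ (Nat.mod_lt _ hk), fun h m _ ↦ h m⟩

variable {α : Type*} [DecidableEq α]

/-- The promise on the input of the algorithm: the blocks `bs` are disjoint bases of size `r` that
cover the ground set, and `O` recognizes bases among the `r`-element sets. -/
structure Promise (D : SplitSystem α) (O : List α → Bool) (bs : List (List α)) (r : ℕ) :
    Prop where
  two_le : 2 ≤ bs.length
  oracle : ∀ X : List α, X.Nodup → X.length = r → (O X = true ↔ D.IsBase X.toFinset)
  nodup : ∀ m, (blk bs m).Nodup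
  length : ∀ m, (blk bs m).length = r
  disjoint : ∀ m, (blk bs m).Disjoint (blk bs (m + 1))
  base : ∀ m, D.IsBase (blk bs m).toFinset
  ground : ∀ i, ∀ x ∈ D.E i, ∃ m, x ∈ blk bs m
  exchange : ∀ X Y, D.IsBase X → D.IsBase Y → ∀ x ∈ X, x ∉ Y →
    ∃ y ∈ Y, y ∉ X ∧ D.IsBase (exch X x y)

/-- `ls` arises by permuting the elements in each block. -/
structure Arrangement (bs ls : List (List α)) : Prop where
  length_eq : ls.length = bs.length
  perm : ∀ m, (blk ls m).Perm (blk bs m)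

/-- The blocks as sets. -/
def blocks (bs : List (List α)) (m : ℕ) : Finset α := (blk bs m).toFinset

/-- The first `j` elements of the blocks. -/
def chosen (j : ℕ) (ls : List (List α)) (m : ℕ) : Finset α := ((blk ls m).take j).toFinset

variable {D : SplitSystem α} {O : List α → Bool} {bs ls : List (List α)} {r j : ℕ}

namespace Promise

lemma nodup' (h : Promise D O bs r) (ha : Arrangement bs ls) (m : ℕ) : (blk ls m).Nodup :=
  (ha.perm m).nodup_iff.2 (h.nodup m)

lemma length' (h : Promise D O bs r) (ha : Arrangement bs ls) (m : ℕ) : (blk ls m).length = r := by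
  rw [(ha.perm m).length_eq, h.length]

lemma disjoint' (h : Promise D O bs r) (ha : Arrangement bs ls) (m : ℕ) :
    (blk ls m).Disjoint (blk ls (m + 1)) := fun _ hx hy ↦
  h.disjoint m ((ha.perm m).mem_iff.1 hx) ((ha.perm _).mem_iff.1 hy)

lemma toFinset_drop (h : Promise D O bs r) (ha : Arrangement bs ls) (m : ℕ) :
    ((blk ls m).drop j).toFinset = blocks bs m \ chosen j ls m := by
  have hnd := h.nodup' ha m
  rw [← List.take_append_drop j (blk ls m)] at hnd
  ext x
  have h1 := (ha.perm m).mem_iff (a := x)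
  have h2 : x ∈ blk ls m ↔ x ∈ (blk ls m).take j ∨ x ∈ (blk ls m).drop j := by
    rw [← List.mem_append, List.take_append_drop]
  have h3 : x ∈ (blk ls m).take j → x ∉ (blk ls m).drop j := fun h h' ↦
    List.disjoint_of_nodup_append hnd h h'
  simp only [blocks, chosen, Finset.mem_sdiff, List.mem_toFinset]
  tauto

lemma toFinset_win (h : Promise D O bs r) (ha : Arrangement bs ls) (m : ℕ) :
    (win j ls m).toFinset = window (blocks bs) (chosen j ls) m := by
  rw [win, List.toFinset_append, h.toFinset_drop ha, window]; rfl

lemma nodup_win (h : Promise D O bs r) (ha : Arrangement bs ls) (m : ℕ) : (win j ls m).Nodup := by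
  rw [win, List.nodup_append']
  exact ⟨(h.nodup' ha m).sublist (List.drop_sublist _ _),
    (h.nodup' ha (m + 1)).sublist (List.take_sublist _ _),
    fun x hx hy ↦ h.disjoint' ha m (List.mem_of_mem_drop hx) (List.mem_of_mem_take hy)⟩

lemma length_win (h : Promise D O bs r) (ha : Arrangement bs ls) (hj : j ≤ r) (m : ℕ) :
    (win j ls m).length = r := by
  simp only [win, List.length_append, List.length_drop, List.length_take, h.length' ha]
  omega

lemma notMem_win (h : Promise D O bs r) (ha : Arrangement bs ls) {m : ℕ} {y : α}
    (hy : y ∈ (blk ls (m + 1)).drop j) : y ∉ win j ls m := by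
  have hnd := h.nodup' ha (m + 1)
  rw [← List.take_append_drop j (blk ls (m + 1))] at hnd
  rw [win, List.mem_append]
  rintro (h' | h')
  · exact h.disjoint' ha m (List.mem_of_mem_drop h') (List.mem_of_mem_drop hy)
  · exact List.disjoint_of_nodup_append hnd h' hy

lemma oracle_win (h : Promise D O bs r) (ha : Arrangement bs ls) (hj : j ≤ r) (m : ℕ) :
    O (win j ls m) = true ↔ D.IsBase (window (blocks bs) (chosen j ls) m) := by
  rw [h.oracle _ (h.nodup_win ha m) (h.length_win ha hj m), h.toFinset_win ha]

lemma oracle_exchList (h : Promise D O bs r) (ha : Arrangement bs ls) (hj : j ≤ r) {m : ℕ}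
    {x y : α} (hx : x ∈ (blk ls m).drop j) (hy : y ∈ (blk ls (m + 1)).drop j) :
    O (exchList ((blk ls m).drop j) ((blk ls (m + 1)).take j) x y) = true ↔
      D.Exchanges (window (blocks bs) (chosen j ls) m) x y := by
  have hnd := h.nodup_win ha m (j := j)
  have hl := h.length_win ha hj m
  have hyw := h.notMem_win ha hy
  have hf := h.toFinset_win ha m (j := j)
  rw [win] at hnd hl hyw hf
  rw [h.oracle _ (nodup_exchList hnd hyw) (by rw [length_exchList hnd hx, hl]),
    toFinset_exchList hnd hx, hf, Exchanges]

lemma headI_eq (h : Promise D O bs r) : bs.headI = blk bs 0 := by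
  have := h.two_le
  cases bs with
  | nil => simp at this
  | cons b bs => simp [blk]

lemma oracle_base (h : Promise D O bs r) {x y : α} (hx : x ∈ bs.headI) (hy : y ∉ bs.headI) :
    O (exchList bs.headI [] x y) = true ↔ D.Exchanges (blocks bs 0) x y := by
  rw [h.headI_eq] at *
  have hnd := h.nodup 0
  rw [h.oracle _ (nodup_exchList (by simpa using hnd) (by simpa using hy))
    (by rw [length_exchList (by simpa using hnd) hx]; simpa using h.length 0),
    toFinset_exchList (by simpa using hnd) hx, Exchanges, List.append_nil, blocks]

lemma layer (h : Promise D O bs r) (ha : Arrangement bs ls)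
    (hw : ∀ m, D.IsBase (window (blocks bs) (chosen j ls) m)) :
    D.Layer bs.length (blocks bs) (chosen j ls) where
  two_le := h.two_le
  periodicB m := by rw [blocks, blk_add_length, blocks]
  periodicP m := by rw [chosen, ← ha.length_eq, blk_add_length, chosen]
  disjoint m := by
    rw [Finset.disjoint_left]
    intro x
    simp only [blocks, List.mem_toFinset]
    exact fun h1 h2 ↦ h.disjoint m h1 h2
  sub m := by
    intro x
    simp only [chosen, blocks, List.mem_toFinset]
    exact fun hx ↦ (ha.perm m).mem_iff.1 (List.mem_of_mem_take hx)
  baseB := h.base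
  base := hw
  ground i x hx := by
    obtain ⟨m, hm⟩ := h.ground i x hx
    exact ⟨m, List.mem_toFinset.2 hm⟩
  exchange := h.exchange

lemma subset_flatten (h : Promise D O bs r) (i : Fin D.t) : D.E i ⊆ bs.flatten.toFinset := by
  intro x hx
  obtain ⟨m, hm⟩ := h.ground i x hx
  exact List.mem_toFinset.2 (mem_flatten_of_mem_blk hm)

end Promise

lemma periodic_chosen (ha : Arrangement bs ls) : Function.Periodic (chosen j ls) bs.length := by
  intro m
  rw [chosen, ← ha.length_eq, blk_add_length, chosen]

lemma periodic_blocks : Function.Periodic (blocks bs) bs.length := by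
  intro m
  rw [blocks, blk_add_length, blocks]

/-- `T` consists of the independent sets among queries that include those about `ls` at
position `j`. -/
structure Answers (O : List α → Bool) (bs : List (List α)) (j : ℕ) (ls : List (List α))
    (T : List (List α)) : Prop where
  base : ∀ X ∈ baseQueries bs, X ∈ T ↔ O X = true
  window : ∀ X ∈ windowQueries j ls, X ∈ T ↔ O X = true

lemma answers_filter {cands : List (List (List α))} (hls : ls ∈ cands) :
    Answers O bs j ls ((queries bs j cands).filter O) where
  base X hX := by
    simp only [List.mem_filter, queries, List.mem_cons, List.mem_append]
    tauto
  window X hX := by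
    have : X ∈ cands.flatMap (windowQueries j) := List.mem_flatMap.2 ⟨ls, hls, hX⟩
    simp only [List.mem_filter, queries, List.mem_cons, List.mem_append]
    tauto

lemma win_mem_windowQueries {m : ℕ} (hm : m < ls.length) : win j ls m ∈ windowQueries j ls := by
  simp only [windowQueries, List.mem_flatMap, List.mem_range]
  exact ⟨m, hm, List.mem_cons_self⟩

lemma exchList_mem_windowQueries {m : ℕ} (hm : m < ls.length) {x y : α}
    (hx : x ∈ (blk ls m).drop j) (hy : y ∈ (blk ls (m + 1)).drop j) :
    exchList ((blk ls m).drop j) ((blk ls (m + 1)).take j) x y ∈ windowQueries j ls := by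
  simp only [windowQueries, List.mem_flatMap, List.mem_range]
  refine ⟨m, hm, List.mem_cons_of_mem _ ?_⟩
  simp only [List.mem_flatMap, List.mem_map]
  exact ⟨x, hx, y, hy, rfl⟩

/-- The state at position `j`: all windows are bases, no class is split all around. -/
def GoodState (D : SplitSystem α) (bs : List (List α)) (j : ℕ)
    (ls : List (List α)) : Prop :=
  (∀ m, D.IsBase (window (blocks bs) (chosen j ls) m)) ∧
    ∀ c ∈ blocks bs 0, ¬ ∀ m, D.ClassSplit (blocks bs) (chosen j ls) bs.flatten.toFinset c m

namespace Promise

variable {T : List (List α)}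

lemma listArrow_iff (h : Promise D O bs r) (hT : Answers O bs j ls T) {x y : α}
    (hx : x ∈ bs.headI) (hy : y ∈ bs.flatten) :
    ListArrow T bs.headI x y ↔ Arrow (D.Exchanges (blocks bs 0)) (blocks bs 0) x y := by
  unfold ListArrow Arrow
  by_cases hyb : y ∈ bs.headI
  · have : y ∈ blocks bs 0 := by rw [blocks, ← h.headI_eq]; exact List.mem_toFinset.2 hyb
    simp [hyb, this]
  · have : y ∉ blocks bs 0 := by rw [blocks, ← h.headI_eq]; exact mt List.mem_toFinset.1 hyb
    rw [hT.base _ (List.mem_flatMap.2 ⟨x, hx, List.mem_map.2 ⟨y, hy, rfl⟩⟩), h.oracle_base hx hyb]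
    simp [hyb, this]

lemma listInClass_iff (h : Promise D O bs r) (hT : Answers O bs j ls T) {c y : α}
    (hc : c ∈ bs.headI) (hy : y ∈ bs.flatten) :
    ListInClass T bs.headI bs.flatten c y ↔
      InClass (D.Exchanges (blocks bs 0)) (blocks bs 0) bs.flatten.toFinset c y := by
  have hb : ∀ x, x ∈ blocks bs 0 ↔ x ∈ bs.headI := fun x ↦ by
    rw [blocks, ← h.headI_eq, List.mem_toFinset]
  have hlink : ∀ x ∈ bs.headI, ∀ z ∈ bs.headI, ListLink T bs.headI bs.flatten x z ↔
      ∃ u ∈ bs.flatten.toFinset, Arrow (D.Exchanges (blocks bs 0)) (blocks bs 0) x u ∧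
        Arrow (D.Exchanges (blocks bs 0)) (blocks bs 0) z u := by
    intro x hx z hz
    unfold ListLink
    simp only [List.mem_toFinset]
    refine exists_congr fun u ↦ and_congr_right fun hu ↦ ?_
    rw [h.listArrow_iff hT hx hu, h.listArrow_iff hT hz hu]
  unfold ListInClass InClass
  simp only [hb]
  refine exists_congr fun z₁ ↦ and_congr_right fun hz₁ ↦ exists_congr fun z₂ ↦
    and_congr_right fun hz₂ ↦ ?_
  rw [hlink c hc z₁ hz₁, hlink z₁ hz₁ z₂ hz₂, h.listArrow_iff hT hz₂ hy]

lemma listSplitAt_iff (h : Promise D O bs r) (ha : Arrangement bs ls) (hT : Answers O bs j ls T)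
    (hj : j ≤ r) {c : α} (hc : c ∈ bs.headI) {m : ℕ} (hm : m < ls.length) :
    ListSplitAt T bs.headI bs.flatten c ((blk ls m).drop j) ((blk ls (m + 1)).take j)
      ((blk ls (m + 1)).drop j) ↔
      D.ClassSplit (blocks bs) (chosen j ls) bs.flatten.toFinset c m := by
  have hC : ∀ a, ∀ y ∈ (blk ls a).drop j, ListInClass T bs.headI bs.flatten c y ↔
      InClass (D.Exchanges (blocks bs 0)) (blocks bs 0) bs.flatten.toFinset c y := fun a y hy ↦
    h.listInClass_iff hT hc
      (mem_flatten_of_mem_blk ((ha.perm a).mem_iff.1 (List.mem_of_mem_drop hy)))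
  have hE : ∀ x ∈ (blk ls m).drop j, ∀ y ∈ (blk ls (m + 1)).drop j,
      ListExch T ((blk ls m).drop j) ((blk ls (m + 1)).take j) x y ↔
        D.Exchanges (window (blocks bs) (chosen j ls) m) x y := fun x hx y hy ↦ by
    rw [ListExch, hT.window _ (exchList_mem_windowQueries hm hx hy), h.oracle_exchList ha hj hx hy]
  unfold ListSplitAt ClassSplit SplitAt
  rw [← h.toFinset_drop ha, ← h.toFinset_drop ha]
  simp only [List.mem_toFinset]
  refine exists_congr fun z₀ ↦ and_congr_right fun hz₀ ↦ exists_congr fun z₁ ↦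
    and_congr_right fun hz₁ ↦ exists_congr fun y₀ ↦ and_congr_right fun hy₀ ↦
    exists_congr fun y₁ ↦ and_congr_right fun hy₁ ↦ ?_
  rw [hC _ z₀ hz₀, hC _ z₁ hz₁, hC _ y₀ hy₀, hC _ y₁ hy₁, hE _ hz₀ _ hy₀, hE _ hz₁ _ hy₁,
    hE _ hz₀ _ hy₁]
  simp only [and_assoc]
  refine and_congr_right fun _ ↦ and_congr_right fun _ ↦ and_congr_right fun _ ↦
    and_congr_right fun _ ↦ and_congr_right fun _ ↦ and_congr_right fun _ ↦
    and_congr_right fun _ ↦ and_congr ?_ ?_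
  · refine forall_congr' fun z ↦ forall_congr' fun hz ↦ ?_
    rw [hC _ z hz, hE _ hz _ hy₀, hE _ hz _ hy₁, imp_iff_not_or]
  · refine forall_congr' fun y ↦ forall_congr' fun hy ↦ ?_
    rw [hC _ y hy, hE _ hz₀ _ hy, hE _ hz₁ _ hy, imp_iff_not_or]

/-- Every set that the acceptance test looks up has been queried, so the recorded answers replace
the oracle. Periodicity extends the test from one turn of the cycle to all levels. -/
lemma accepted_iff (h : Promise D O bs r) (ha : Arrangement bs ls) (hT : Answers O bs j ls T)
    (hj : j ≤ r) : Accepted T bs j ls ↔ GoodState D bs j ls := by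
  have hk := h.two_le
  have hP := periodic_chosen ha (j := j)
  have hB := periodic_blocks (bs := bs)
  have hP' : ∀ m, chosen j ls (m + bs.length + 1) = chosen j ls (m + 1) := fun m ↦ by
    rw [show m + bs.length + 1 = m + 1 + bs.length by ring, hP]
  have hB' : ∀ m, blocks bs (m + bs.length + 1) = blocks bs (m + 1) := fun m ↦ by
    rw [show m + bs.length + 1 = m + 1 + bs.length by ring, hB]
  unfold Accepted GoodState WindowsIn
  refine and_congr ?_ ?_
  · refine Iff.trans ?_ (periodic_iff (k := ls.length) (by rw [ha.length_eq]; omega) ?_)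
    · refine forall_congr' fun m ↦ forall_congr' fun hm ↦ ?_
      rw [hT.window _ (win_mem_windowQueries hm), h.oracle_win ha hj]
    · intro m
      simp only [ha.length_eq, window, hP m, hB m, hP' m]
  · refine forall_congr' fun c ↦ ?_
    rw [blocks, ← h.headI_eq, List.mem_toFinset]
    refine forall_congr' fun hc ↦ not_congr ?_
    refine Iff.trans ?_ (periodic_iff (k := ls.length) (by rw [ha.length_eq]; omega) ?_)
    · refine forall_congr' fun m ↦ forall_congr' fun hm ↦ ?_
      rw [h.listSplitAt_iff ha hT hj hc hm]
    · intro m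
      simp only [ha.length_eq, ClassSplit, window, hP m, hB m, hP' m, hB' m]

end Promise

/-! ### Advancing by one position and the invariant -/

open SplitSystem

variable {α : Type*} [DecidableEq α]

/-- `ls'` arises from `ls` by moving the elements `e m` to position `j` of their blocks. -/
structure Advances (j : ℕ) (ls ls' : List (List α)) (e : ℕ → α) : Prop where
  length_eq : ls'.length = ls.length
  periodic : Function.Periodic e ls.length
  mem : ∀ m, e m ∈ (blk ls m).drop j
  blk_eq : ∀ m, blk ls' m = moveTo j (blk ls m) (e m)

lemma exists_advances_iff {j : ℕ} {ls ls' : List (List α)} (hls : 0 < ls.length) :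
    ls' ∈ (ls.map (moves j)).sections ↔ ∃ e, Advances j ls ls' e := by
  rw [List.mem_sections, List.forall₂_iff_get]
  simp only [List.length_map, List.get_eq_getElem, List.getElem_map, moves, List.mem_map]
  constructor
  · rintro ⟨hl, h⟩
    have h' : ∀ m, ∃ x, x ∈ (blk ls m).drop j ∧ blk ls' m = moveTo j (blk ls m) x := by
      intro m
      have hm := Nat.mod_lt m hls
      obtain ⟨x, hx, hx'⟩ := h (m % ls.length) (by omega) hm
      refine ⟨x, ?_, ?_⟩
      · rwa [← blk_mod, blk_of_lt hm]
      · rw [← blk_mod ls, blk_of_lt hm, hx', ← blk_mod ls']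
        simp only [hl]
        rw [blk_of_lt]
    choose e he he' using h'
    refine ⟨fun m ↦ e (m % ls.length), hl, fun m ↦ by simp, fun m ↦ ?_, fun m ↦ ?_⟩
    · rw [← blk_mod]; exact he _
    · rw [← blk_mod ls, ← he', ← hl, blk_mod]
  · rintro ⟨e, he⟩
    refine ⟨he.length_eq, fun m h1 h2 ↦ ⟨e m, ?_, ?_⟩⟩
    · rw [← blk_of_lt h2]; exact he.mem m
    · rw [← blk_of_lt h2, ← blk_of_lt h1, he.blk_eq]

lemma Advances.exists_of_mem {j : ℕ} {ls : List (List α)} {e : ℕ → α}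
    (hper : Function.Periodic e ls.length) (hmem : ∀ m, e m ∈ (blk ls m).drop j) :
    ∃ ls', Advances j ls ls' e := by
  refine ⟨(List.range ls.length).map fun m ↦ moveTo j (blk ls m) (e m), by simp, hper, hmem, ?_⟩
  intro m
  by_cases hls : ls.length = 0
  · have := hmem m
    simp [blk, List.length_eq_zero_iff.1 hls] at this
  · have hm := Nat.mod_lt m (Nat.pos_of_ne_zero hls)
    rw [← blk_mod, blk_of_lt (by simpa using hm)]
    simp [blk_mod, hper.map_mod_nat]

lemma Advances.set {j : ℕ} {ls ls' : List (List α)} {e : ℕ → α} (h : Advances j ls ls' e)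
    {p : ℕ} {f : α} (hp : p < ls.length) (hf : f ∈ (blk ls p).drop j) :
    Advances j ls (ls'.set p (moveTo j (blk ls p) f)) (modifyAt ls.length e p f) where
  length_eq := by simp [h.length_eq]
  periodic := periodic_modifyAt h.periodic p f
  mem m := by
    rw [modifyAt]
    split_ifs with hm
    · rwa [← blk_mod, hm, blk_mod]
    · exact h.mem m
  blk_eq m := by
    have hm := Nat.mod_lt m (by omega : 0 < ls.length)
    rw [← blk_mod, blk_of_lt (by simp [h.length_eq, hm])]
    rw [List.getElem_set, modifyAt]
    simp only [List.length_set, h.length_eq, Nat.mod_eq_of_lt hp]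
    by_cases hpm : p = m % ls.length
    · rw [if_pos hpm, if_pos hpm.symm, ← blk_mod ls m, ← hpm]
    · rw [if_neg hpm, if_neg (Ne.symm hpm), ← h.blk_eq, ← blk_mod ls' m]
      simp only [h.length_eq]
      exact (blk_of_lt (by rwa [h.length_eq])).symm

variable {D : SplitSystem α} {O : List α → Bool} {bs ls ls' : List (List α)} {r j : ℕ} {e : ℕ → α}

namespace Promise

lemma arrangement_of_advances (h : Promise D O bs r) (ha : Arrangement bs ls)
    (he : Advances j ls ls' e) : Arrangement bs ls' where
  length_eq := by rw [he.length_eq, ha.length_eq]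
  perm m := by
    rw [he.blk_eq]
    exact (moveTo_perm (h.nodup' ha m) (he.mem m)).trans (ha.perm m)

lemma chosen_of_advances (h : Promise D O bs r) (ha : Arrangement bs ls)
    (he : Advances j ls ls' e) (hj : j ≤ r) {i : ℕ} (hi : i ≤ j) :
    chosen i ls' = chosen i ls := by
  ext1 m
  rw [chosen, he.blk_eq, take_moveTo_of_le hi (by rwa [h.length' ha]), chosen]

lemma chosen_succ_of_advances (h : Promise D O bs r) (ha : Arrangement bs ls)
    (he : Advances j ls ls' e) (hj : j ≤ r) :
    chosen (j + 1) ls' = next (chosen j ls) e := by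
  ext1 m
  rw [chosen, he.blk_eq, take_moveTo (by rwa [h.length' ha]), next, chosen]
  ext x
  simp

/-- A window at position `j + 1` is an exchange in a window at position `j`, hence among the queries
already made there. This is why the search for a transversal needs no oracle calls. -/
lemma win_of_advances (h : Promise D O bs r) (ha : Arrangement bs ls)
    (he : Advances j ls ls' e) (hj : j ≤ r) (m : ℕ) :
    win (j + 1) ls' m =
      exchList ((blk ls m).drop j) ((blk ls (m + 1)).take j) (e m) (e (m + 1)) := by
  rw [win, he.blk_eq, he.blk_eq, drop_moveTo (by rwa [h.length' ha]),
    take_moveTo (by rwa [h.length' ha]), exchList]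

lemma mem_of_advances (h : Promise D O bs r) (ha : Arrangement bs ls)
    (he : Advances j ls ls' e) (m : ℕ) : e m ∈ blocks bs m \ chosen j ls m := by
  rw [← h.toFinset_drop ha]
  exact List.mem_toFinset.2 (he.mem m)

lemma windowsIn_iff (h : Promise D O bs r) (ha : Arrangement bs ls)
    (he : Advances j ls ls' e) (hj : j ≤ r) {T : List (List α)} (hT : Answers O bs j ls T) :
    WindowsIn T (j + 1) ls' ↔
      ∀ m, D.IsBase (exch (window (blocks bs) (chosen j ls) m) (e m) (e (m + 1))) := by
  have hk := h.two_le
  have hP := periodic_chosen ha (j := j)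
  have hB := periodic_blocks (bs := bs)
  have hper := he.periodic
  rw [ha.length_eq] at hper
  refine Iff.trans ?_ (periodic_iff (k := ls'.length)
    (by rw [he.length_eq, ha.length_eq]; omega) ?_)
  · refine forall_congr' fun m ↦ forall_congr' fun hm ↦ ?_
    rw [h.win_of_advances ha he hj, hT.window _ (exchList_mem_windowQueries
      (by rwa [← he.length_eq]) (he.mem _) (he.mem _)),
      h.oracle_exchList ha hj (he.mem _) (he.mem _), Exchanges]
  · intro m
    have h1 := hP (m + 1)
    have h2 := hper (m + 1)
    rw [show m + 1 + bs.length = m + bs.length + 1 by ring] at h1 h2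
    simp only [he.length_eq, ha.length_eq, window, hP m, hB m, hper m, h1, h2]

/-- The invariant of the algorithm. -/
structure _root_.SplitMatroid.Invariant (D : SplitSystem α) (bs : List (List α)) (j : ℕ)
    (cands : List (List (List α))) : Prop where
  arrangement : ∀ ls ∈ cands, Arrangement bs ls
  base : ∀ ls ∈ cands, ∀ i < j, ∀ m, D.IsBase (window (blocks bs) (chosen i ls) m)
  good : ∃ ls ∈ cands, GoodState D bs j ls

lemma invariant_zero (h : Promise D O bs r) : Invariant D bs 0 [bs] where
  arrangement ls hls := by
    obtain rfl := List.mem_singleton.1 hls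
    exact ⟨rfl, fun m ↦ List.Perm.refl _⟩
  base _ _ i hi := by omega
  good := by
    have ha : Arrangement bs bs := ⟨rfl, fun m ↦ List.Perm.refl _⟩
    have hc : chosen 0 bs = fun _ ↦ ∅ := by ext1 m; simp [chosen]
    have hw : ∀ m, D.IsBase (window (blocks bs) (chosen 0 bs) m) := by
      intro m
      rw [hc, window]
      simpa [blocks] using h.base m
    refine ⟨bs, List.mem_singleton.2 rfl, hw, ?_⟩
    have L := h.layer ha hw
    rw [hc] at L ⊢
    exact fun c hc ↦ L.not_classSplit_empty h.subset_flatten hc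

lemma headI_filter_mem {β : Type*} [Inhabited β] {l : List β} {p : β → Bool}
    (hp : ∃ x ∈ l, p x = true) : (l.filter p).headI ∈ l ∧ p (l.filter p).headI = true := by
  obtain ⟨x, hx, hpx⟩ := hp
  have hx' := List.mem_filter.2 ⟨hx, hpx⟩
  rw [← List.mem_filter]
  cases hf : l.filter p with
  | nil => rw [hf] at hx'; simp at hx'
  | cons a t => simp

-- All new candidates come from one good arrangement and agree with it on the windows up to position
-- `j`. Whether they are good at `j + 1` is left to the tests of the next round. It does not matter
-- which transversal the search finds, since each is good or becomes good by a change in one block.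
open scoped Classical in
lemma invariant_succ (h : Promise D O bs r) {cands : List (List (List α))} (hj : j < r)
    (hI : Invariant D bs j cands) :
    Invariant D bs (j + 1) (nextCands ((queries bs j cands).filter O) bs j cands) := by
  set T := (queries bs j cands).filter O with hTdef
  have hk := h.two_le
  obtain ⟨hpick, hacc⟩ : pick T bs j cands ∈ cands ∧ GoodState D bs j (pick T bs j cands) := by
    obtain ⟨ls, hls, hg⟩ := hI.good
    have := headI_filter_mem (l := cands)
      (p := fun ls ↦ decide (Accepted T bs j ls))
      ⟨ls, hls, decide_eq_true
        ((h.accepted_iff (hI.arrangement _ hls) (answers_filter hls) hj.le).2 hg)⟩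
    exact ⟨this.1, (h.accepted_iff (hI.arrangement _ this.1) (answers_filter this.1) hj.le).1
      (of_decide_eq_true this.2)⟩
  rw [nextCands]
  generalize pick T bs j cands = ls at hpick hacc
  have ha := hI.arrangement ls hpick
  have hT : Answers O bs j ls T := answers_filter hpick
  have L := h.layer ha hacc.1
  have hlen : 0 < ls.length := by rw [ha.length_eq]; omega
  obtain ⟨e, he, hw⟩ : ∃ e, Advances j ls (advance T j ls) e ∧
      WindowsIn T (j + 1) (advance T j ls) := by
    have h0 : ∃ x, x ∈ blocks bs 0 \ chosen j ls 0 := by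
      have : 0 < ((blk ls 0).drop j).length := by
        rw [List.length_drop, h.length' ha]; omega
      obtain ⟨x, hx⟩ := List.exists_mem_of_length_pos this
      exact ⟨x, by rw [← h.toFinset_drop ha]; exact List.mem_toFinset.2 hx⟩
    obtain ⟨x, hx⟩ := h0
    obtain ⟨e, h1, h2, h3⟩ := L.exists_transversal h.subset_flatten hacc.2 hx
    obtain ⟨ls', hadv⟩ := Advances.exists_of_mem (j := j) (ls := ls) (e := e)
      (by rwa [ha.length_eq])
      (fun m ↦ by have := h2 m; rw [← h.toFinset_drop ha] at this; exact List.mem_toFinset.1 this)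
    have := headI_filter_mem (l := (ls.map (moves j)).sections)
      (p := fun ls ↦ decide (WindowsIn T (j + 1) ls))
      ⟨ls', (exists_advances_iff hlen).2 ⟨e, hadv⟩, by
        simpa [h.windowsIn_iff ha hadv hj.le hT] using h3⟩
    obtain ⟨e', he'⟩ := (exists_advances_iff hlen).1 this.1
    exact ⟨e', he', of_decide_eq_true this.2⟩
  generalize advance T j ls = ls' at he hw
  have hb := (h.windowsIn_iff ha he hj.le hT).1 hw
  have hper := he.periodic
  rw [ha.length_eq] at hper
  have hadv : ∀ ls'' ∈ variants j ls ls', ∃ e', Advances j ls ls'' e' := by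
    intro ls'' hls''
    simp only [variants, List.mem_cons, List.mem_flatMap, List.mem_range, moves, List.mem_map]
      at hls''
    rcases hls'' with rfl | ⟨p, hp, o, ⟨f, hf, rfl⟩, rfl⟩
    · exact ⟨e, he⟩
    · exact ⟨_, he.set hp hf⟩
  refine ⟨?_, ?_, ?_⟩
  · intro ls'' hls''
    obtain ⟨e', he'⟩ := hadv ls'' hls''
    exact h.arrangement_of_advances ha he'
  · intro ls'' hls'' i hi m
    obtain ⟨e', he'⟩ := hadv ls'' hls''
    rw [h.chosen_of_advances ha he' hj.le (by omega)]
    rcases Nat.lt_succ_iff_lt_or_eq.1 hi with hi | rfl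
    · exact hI.base ls hpick i hi m
    · exact hacc.1 m
  · have hstate : ∀ {ls'' e'}, Advances j ls ls'' e' →
        (∀ m, D.IsBase (exch (window (blocks bs) (chosen j ls) m) (e' m) (e' (m + 1)))) →
        (∀ c ∈ blocks bs 0, ¬ ∀ m,
          D.ClassSplit (blocks bs) (next (chosen j ls) e') bs.flatten.toFinset c m) →
        GoodState D bs (j + 1) ls'' := by
      intro ls'' e' he' hb' hc'
      refine ⟨fun m ↦ ?_, ?_⟩
      · rw [h.chosen_succ_of_advances ha he' hj.le, L.window_next (h.mem_of_advances ha he')]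
        exact hb' m
      · rwa [h.chosen_succ_of_advances ha he' hj.le]
    rcases L.exists_good_modifyAt h.subset_flatten hacc.2 hper (h.mem_of_advances ha he) hb with
      hgood | ⟨m, f, hf, hb', hgood⟩
    · exact ⟨ls', List.mem_cons_self, hstate he hb hgood⟩
    · have hp : m % ls.length < ls.length := Nat.mod_lt _ hlen
      have hf' : f ∈ (blk ls (m % ls.length)).drop j := by
        rw [blk_mod]
        rw [← h.toFinset_drop ha] at hf
        exact List.mem_toFinset.1 hf
      have hmod : modifyAt ls.length e (m % ls.length) f = modifyAt bs.length e m f := by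
        ext1 a
        simp [modifyAt, ha.length_eq]
      have hset := he.set hp hf'
      rw [hmod] at hset
      refine ⟨_, ?_, hstate hset hb' hgood⟩
      simp only [variants, List.mem_cons, List.mem_flatMap, List.mem_range, moves, List.mem_map]
      exact .inr ⟨_, hp, _, ⟨f, hf', rfl⟩, rfl⟩

theorem invariant_run (h : Promise D O bs r) {j : ℕ} (hj : j ≤ r) :
    Invariant D bs j (run O bs j) := by
  induction j with
  | zero => exact h.invariant_zero
  | succ j ih => exact h.invariant_succ hj (ih (by omega))

end Promise

open Finset

/-! ### From matroids to split systems -/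

section System

variable {α : Type*}

/-- Elementary split matroids and uniform matroids in terms of finite sets. -/
def HasPresentation [DecidableEq α] (N : Matroid α) : Prop :=
  ∃ (E : Finset α) (r q : ℕ) (H : Fin q → Finset α) (ρ : Fin q → ℕ),
    (E : Set α) = N.E ∧ (∀ j, H j ⊆ E) ∧ (∀ j j', j ≠ j' → #(H j ∩ H j') + r ≤ ρ j + ρ j') ∧
      ∀ X : Finset α, N.IsBase X ↔ X ⊆ E ∧ #X = r ∧ ∀ j, #(X ∩ H j) ≤ ρ j

variable [DecidableEq α]

lemma IsElementarySplit.hasPresentation {N : Matroid α} (h : IsElementarySplit N) :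
    HasPresentation N := by
  obtain ⟨hfin, r, q, H, ρ, -, hH, hinter, -, hbase⟩ := h
  have hf : ∀ i, (H i).Finite := fun i ↦ hfin.subset (hH i)
  refine ⟨hfin.toFinset, r, q, fun i ↦ (hf i).toFinset, ρ, by simp, ?_, ?_, ?_⟩
  · intro j x
    simp only [Set.Finite.mem_toFinset]
    exact fun hx ↦ hH j hx
  · intro j j' hj
    have := hinter j j' hj
    rwa [← Set.ncard_coe_finset, coe_inter, Set.Finite.coe_toFinset, Set.Finite.coe_toFinset]
  · intro X
    rw [hbase, Set.ncard_coe_finset]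
    refine and_congr ?_ (and_congr Iff.rfl (forall_congr' fun j ↦ ?_))
    · rw [← coe_subset, Set.Finite.coe_toFinset]
    · rw [← Set.ncard_coe_finset (X ∩ _), coe_inter, Set.Finite.coe_toFinset]

lemma IsUniform.hasPresentation {N : Matroid α} (h : IsUniform N) : HasPresentation N := by
  obtain ⟨hfin, r, hbase⟩ := h
  refine ⟨hfin.toFinset, r, 0, fun i ↦ i.elim0, fun i ↦ i.elim0, by simp, fun j ↦ j.elim0,
    fun j ↦ j.elim0, fun X ↦ ?_⟩
  rw [hbase, Set.ncard_coe_finset, ← coe_subset, Set.Finite.coe_toFinset]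
  simp

/-- Split matroids are the matroids of split systems. -/
lemma IsSplit.exists_splitSystem {M : Matroid α} (h : IsSplit M) :
    ∃ D : SplitSystem α, (∀ X : Finset α, M.IsBase X ↔ D.IsBase X) ∧
      ∀ x, x ∈ M.E ↔ ∃ i, x ∈ D.E i := by
  obtain ⟨t, N, hdisj, h0, hs, rfl⟩ := h
  have hp : ∀ i, HasPresentation (N i) := fun i ↦ by
    refine Fin.cases h0.hasPresentation (fun i ↦ (hs i).hasPresentation) i
  choose E r q H ρ hE hH hinter hbase using hp
  have hEi : ∀ i x, x ∈ E i ↔ x ∈ (N i).E := fun i x ↦ by rw [← hE, mem_coe]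
  refine ⟨⟨t + 1, E, r, q, H, ρ, ?_, hH, hinter⟩, ?_, ?_⟩
  · intro i i' x hx hx'
    by_contra hne
    exact Set.disjoint_left.1 (hdisj hne) ((hEi _ _).1 hx) ((hEi _ _).1 hx')
  · intro X
    rw [Matroid.disjointSigma_isBase_iff]
    have h1 : ∀ i, (N i).IsBase (↑X ∩ (N i).E) ↔
        #(X ∩ E i) = r i ∧ ∀ j, #(X ∩ H i j) ≤ ρ i j := by
      intro i
      rw [← hE, ← coe_inter, hbase]
      have h2 : ∀ j, X ∩ E i ∩ H i j = X ∩ H i j := fun j ↦ by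
        rw [inter_assoc, inter_eq_right.2 (hH i j)]
      simp only [h2, inter_subset_right, true_and]
    have h2 : (X : Set α) ⊆ ⋃ i, (N i).E ↔ ∀ x ∈ X, ∃ i, x ∈ E i := by
      simp only [Set.subset_def, Set.mem_iUnion, mem_coe, hEi]
    simp only [h1, h2, SplitSystem.IsBase]
    constructor
    · rintro ⟨ha, hb⟩
      exact ⟨hb, fun i ↦ (ha i).1, fun i ↦ (ha i).2⟩
    · rintro ⟨hb, ha, hc⟩
      exact ⟨fun i ↦ ⟨ha i, hc i⟩, hb⟩
  · intro x
    simp [Matroid.disjointSigma_ground_eq, hEi]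

end System

section Base

variable {α : Type*} {M : Matroid α}

lemma setOf_mem_eq_toFinset [DecidableEq α] (l : List α) : {x | x ∈ l} = (l.toFinset : Set α) := by
  ext x; simp

lemma ncard_setOf_mem {l : List α} (hl : l.Nodup) : {x | x ∈ l}.ncard = l.length := by
  classical
  rw [setOf_mem_eq_toFinset, Set.ncard_coe_finset, List.toFinset_card_of_nodup hl]

lemma rk_eq_length {l : List α} (hl : l.Nodup) (h : M.IsBase {x | x ∈ l}) : rk M = l.length := by
  rw [rk, ← h.encard_eq_eRank, ← ncard_setOf_mem hl, Set.ncard]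

/-- Through this equivalence the independence oracle serves as a base oracle on sets of rank size.
-/
lemma indep_iff_isBase {l l' : List α} (hl : l.Nodup) (h : M.IsBase {x | x ∈ l}) (hl' : l'.Nodup)
    (hlen : l'.length = rk M) : M.Indep {x | x ∈ l'} ↔ M.IsBase {x | x ∈ l'} := by
  refine ⟨fun hI ↦ ?_, fun hB ↦ hB.indep⟩
  obtain ⟨B, hB, hsub⟩ := hI.exists_isBase_superset
  have hcard := hB.ncard_eq_ncard_of_isBase h
  rw [ncard_setOf_mem hl, ← rk_eq_length hl h, ← hlen, ← ncard_setOf_mem hl'] at hcard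
  have hfin : B.Finite := by
    rw [← Set.encard_lt_top_iff, hB.encard_eq_encard_of_isBase h, Set.encard_lt_top_iff]
    exact l.finite_toSet
  rwa [Set.eq_of_subset_of_ncard_le hsub hcard.le hfin]

end Base

/-! ### Windows as cyclic intervals of the concatenated blocks -/

section Flatten

variable {α : Type*} {ls : List (List α)} {r : ℕ}

lemma flatten_rotate (hr : ∀ l ∈ ls, l.length = r) (a : ℕ) :
    ls.flatten.rotate (a * r) = (ls.rotate a).flatten := by
  induction a generalizing ls with
  | zero => simp
  | succ a ih =>
    cases ls with
    | nil => simp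
    | cons l ls =>
      rw [show (a + 1) * r = r + a * r by ring, show a + 1 = 1 + a by ring, ← List.rotate_rotate,
        ← List.rotate_rotate, ← ih]
      · congr 1
        rw [List.flatten_cons, ← hr l (by simp), List.rotate_append_length_eq]
        simp
      · intro l' hl'
        exact hr l' (List.mem_rotate.1 hl')

lemma blk_rotate (a m : ℕ) : blk (ls.rotate a) m = blk ls (m + a) := by
  by_cases h : ls.length = 0
  · simp [List.length_eq_zero_iff.1 h, blk]
  · have hm := Nat.mod_lt m (Nat.pos_of_ne_zero h)
    have hma := Nat.mod_lt (m + a) (Nat.pos_of_ne_zero h)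
    rw [← blk_mod, ← blk_mod ls, blk_of_lt (by simpa using hm), blk_of_lt hma, List.getElem_rotate]
    simp

/-- Rotating by whole blocks reduces to `a = 0`. The interval then runs from offset `b` of the first
block into the second, or back into the same block if there is only one. -/
lemma take_flatten_rotate (hr : ∀ l ∈ ls, l.length = r) (hne : ls ≠ []) (a : ℕ) {b : ℕ}
    (hb : b ≤ r) : (ls.flatten.rotate (a * r + b)).take r = win b ls a := by
  rw [← List.rotate_rotate, flatten_rotate hr]
  have hw : win b ls a = win b (ls.rotate a) 0 := by
    rw [win, win, blk_rotate, blk_rotate, zero_add, zero_add, add_comm 1 a]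
  rw [hw]
  have hr' : ∀ l ∈ ls.rotate a, l.length = r := fun l hl ↦ hr l (List.mem_rotate.1 hl)
  have hne' : ls.rotate a ≠ [] := by simpa using hne
  generalize ls.rotate a = L at hr' hne'
  cases L with
  | nil => exact absurd rfl hne'
  | cons l L =>
    have hl : l.length = r := hr' l (by simp)
    rw [List.flatten_cons, List.rotate_eq_drop_append_take (by simp; omega),
      List.drop_append_of_le_length (by omega), List.take_append_of_le_length (l₁ := l) (by omega),
      List.append_assoc, List.take_append, List.length_drop, hl, win]
    have h0 : blk (l :: L) 0 = l := by simp [blk]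
    rw [h0, List.take_of_length_le (by simp; omega)]
    congr 1
    cases L with
    | nil => simp [blk, List.take_take, show r - (r - b) = b by omega]
    | cons l' L =>
      have h1 : blk (l :: l' :: L) (0 + 1) = l' := by simp [blk, Nat.mod_eq_of_lt]
      rw [h1, List.flatten_cons, List.append_assoc,
        List.take_append_of_le_length (by rw [hr' l' (by simp)]; omega)]
      congr 1; omega

lemma take_drop_flatten (hr : ∀ l ∈ ls, l.length = r) {a : ℕ} (ha : a < ls.length) :
    (ls.flatten.drop (a * r)).take r = blk ls a := by
  have hne : ls ≠ [] := by rintro rfl; simp at ha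
  have h := take_flatten_rotate hr hne a (Nat.zero_le r)
  have hlen : ls.flatten.length = ls.length * r := by
    rw [List.length_flatten, List.map_congr_left hr, List.map_const', List.sum_replicate,
      smul_eq_mul]
  have hmul : (a + 1) * r ≤ ls.length * r := Nat.mul_le_mul_right r ha
  rw [add_mul, one_mul] at hmul
  rw [add_zero, List.rotate_eq_drop_append_take (by omega),
    List.take_append_of_le_length (by rw [List.length_drop]; omega)] at h
  rw [h]
  simp [win]

end Flatten

/-! ### Correctness of the result and existence of the ordering -/

section Final

variable {α : Type*} {M : Matroid α} {k : ℕ} {b : Fin k → List α} {ls : List (List α)}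

lemma blk_ofFn (hk : 0 < k) (m : ℕ) : blk (List.ofFn b) m = b ⟨m % k, Nat.mod_lt m hk⟩ := by
  simp [blk, Nat.mod_lt m hk]

lemma mem_flatten_ofFn {x : α} : x ∈ (List.ofFn b).flatten ↔ ∃ i, x ∈ b i := by
  simp [List.mem_flatten, List.mem_ofFn]

lemma mem_flatten_iff (hM : IsBasePartition M fun i ↦ {x | x ∈ b i}) {x : α} :
    x ∈ (List.ofFn b).flatten ↔ x ∈ M.E := by
  rw [mem_flatten_ofFn, ← hM.2.2]
  simp

lemma nodup_flatten (hnd : ∀ i, (b i).Nodup) (hM : IsBasePartition M fun i ↦ {x | x ∈ b i}) :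
    (List.ofFn b).flatten.Nodup := by
  rw [List.nodup_flatten]
  refine ⟨?_, ?_⟩
  · intro l hl
    obtain ⟨i, rfl⟩ := List.mem_ofFn.1 hl
    exact hnd i
  · rw [List.pairwise_ofFn]
    intro i j hij x hx hy
    exact Set.disjoint_left.1 (hM.2.1 hij.ne) hx hy

lemma ncard_ground (hnd : ∀ i, (b i).Nodup) (hM : IsBasePartition M fun i ↦ {x | x ∈ b i}) :
    M.E.ncard = (List.ofFn b).flatten.length := by
  rw [← ncard_setOf_mem (nodup_flatten hnd hM)]
  congr 1
  ext x
  exact (mem_flatten_iff hM).symm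

/-- An arrangement all of whose windows are bases gives a cyclic ordering. -/
lemma isCyclicOrdering_of_arrangement (hk : 0 < k) (hnd : ∀ i, (b i).Nodup)
    (hM : IsBasePartition M fun i ↦ {x | x ∈ b i}) (ha : Arrangement (List.ofFn b) ls)
    (hw : ∀ j < rk M, ∀ m, M.IsBase {x | x ∈ win j ls m}) :
    IsCyclicOrdering M ls.flatten ∧ BlocksInOrder M (fun i ↦ {x | x ∈ b i}) ls.flatten := by
  have hlen : ls.length = k := by rw [ha.length_eq, List.length_ofFn]
  have hr : ∀ l ∈ ls, l.length = rk M := by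
    intro l hl
    obtain ⟨m, hm, rfl⟩ := List.mem_iff_getElem.1 hl
    rw [← blk_of_lt hm, (ha.perm m).length_eq, blk_ofFn hk, ← rk_eq_length (hnd _) (hM.1 _)]
  have hne : ls ≠ [] := by rintro rfl; simp at hlen; omega
  have hperm : ls.flatten.Perm (List.ofFn b).flatten := by
    refine List.Perm.flatten_congr (List.forall₂_iff_get.2 ⟨ha.length_eq, fun m h1 h2 ↦ ?_⟩)
    simp only [List.get_eq_getElem]
    rw [← blk_of_lt h1, ← blk_of_lt h2]
    exact ha.perm m
  refine ⟨⟨hperm.nodup_iff.2 (nodup_flatten hnd hM), ?_, ?_⟩, ?_⟩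
  · ext x
    exact hperm.mem_iff.trans (mem_flatten_iff hM)
  · intro i hi
    have hflen : ls.flatten.length = ls.length * rk M := by
      rw [List.length_flatten, List.map_congr_left hr, List.map_const', List.sum_replicate,
        smul_eq_mul]
    have hr0 : 0 < rk M := by
      by_contra h0
      rw [hflen, Nat.eq_zero_of_not_pos h0, mul_zero] at hi
      omega
    rw [← Nat.div_add_mod i (rk M), mul_comm (rk M),
      take_flatten_rotate hr hne _ (Nat.mod_lt _ hr0).le]
    exact hw _ (Nat.mod_lt _ hr0) _
  · intro i
    rw [take_drop_flatten hr (by rw [hlen]; exact i.2)]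
    ext x
    rw [Set.mem_ofPred_eq, (ha.perm i).mem_iff, blk_ofFn hk]
    simp [Nat.mod_eq_of_lt i.2]

lemma Promise.of_isSplit [DecidableEq α] (hM : IsSplit M) (hk : 2 ≤ k) (hnd : ∀ i, (b i).Nodup)
    (hb : IsBasePartition M fun i ↦ {x | x ∈ b i}) {O : List α → Bool}
    (hO : ∀ X, O X = true ↔ M.Indep {x | x ∈ X}) :
    ∃ D : SplitSystem α, (∀ X : Finset α, M.IsBase X ↔ D.IsBase X) ∧
      Promise D O (List.ofFn b) (rk M) := by
  obtain ⟨D, hD, hE⟩ := hM.exists_splitSystem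
  have hk0 : 0 < k := by omega
  refine ⟨D, hD, ?_⟩
  constructor
  · simpa using hk
  · intro X hX hlen
    rw [hO, indep_iff_isBase (hnd ⟨0, hk0⟩) (hb.1 _) hX hlen, setOf_mem_eq_toFinset, hD]
  · intro m
    rw [blk_ofFn hk0]; exact hnd _
  · intro m
    rw [blk_ofFn hk0]; exact (rk_eq_length (hnd _) (hb.1 _)).symm
  · intro m x hx hy
    rw [blk_ofFn hk0] at hx hy
    refine Set.disjoint_left.1 (hb.2.1 ?_) hx hy
    intro h
    have h' : m % k = (m + 1) % k := by simpa using h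
    have h1 : (1 : ℕ) % k = 0 % k :=
      Nat.ModEq.add_left_cancel' m (show m + 1 ≡ m + 0 [MOD k] from h'.symm)
    rw [Nat.mod_eq_of_lt (by omega), Nat.zero_mod] at h1
    omega
  · intro m
    rw [← hD, ← setOf_mem_eq_toFinset, blk_ofFn hk0]
    exact hb.1 _
  · intro i x hx
    have hxE := (hE x).2 ⟨i, hx⟩
    rw [← hb.2.2, Set.mem_iUnion] at hxE
    obtain ⟨m, hm⟩ := hxE
    refine ⟨m, ?_⟩
    rw [blk_ofFn hk0]
    simpa [Nat.mod_eq_of_lt m.2] using hm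
  · intro X Y hX hY x hx hxY
    rw [← hD] at hX hY
    obtain ⟨y, hy, hB⟩ := hX.exchange hY (e := x) (by simp [hx, hxY])
    refine ⟨y, by simpa using hy.1, by simpa using hy.2, ?_⟩
    rw [← hD]
    simpa [exch] using hB

/-- The result of the algorithm. -/
noncomputable def result [DecidableEq α] (O : List α → Bool) (bs : List (List α)) : List α :=
  if bs.length ≤ 1 then bs.flatten else (run O bs bs.headI.length).headI.flatten

theorem result_spec [DecidableEq α] (hM : IsSplit M) (hnd : ∀ i, (b i).Nodup)
    (hb : IsBasePartition M fun i ↦ {x | x ∈ b i}) {O : List α → Bool}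
    (hO : ∀ X, O X = true ↔ M.Indep {x | x ∈ X}) :
    IsCyclicOrdering M (result O (List.ofFn b)) ∧
      BlocksInOrder M (fun i ↦ {x | x ∈ b i}) (result O (List.ofFn b)) := by
  rcases Nat.lt_or_ge 1 k with hk | hk
  · obtain ⟨D, hD, hp⟩ := Promise.of_isSplit hM hk hnd hb hO
    rw [result, if_neg (by simpa using hk), hp.headI_eq, hp.length]
    have hI := hp.invariant_run le_rfl
    have hmem : (run O (List.ofFn b) (rk M)).headI ∈ run O (List.ofFn b) (rk M) := by
      obtain ⟨ls, hls, -⟩ := hI.good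
      cases h : run O (List.ofFn b) (rk M) with
      | nil => rw [h] at hls; simp at hls
      | cons a t => simp
    -- `Invariant.base` covers the positions strictly below `r`, which are all that is needed. So
    -- any candidate of the last round will do, without a further test.
    refine isCyclicOrdering_of_arrangement (by omega) hnd hb (hI.arrangement _ hmem)
      fun j hj m ↦ ?_
    rw [setOf_mem_eq_toFinset, hD, hp.toFinset_win (hI.arrangement _ hmem)]
    exact hI.base _ hmem j hj m
  · rw [result, if_pos (by simpa using hk)]
    -- For `k = 0` the ground set is empty. For `k = 1` the block is its own successor, so every
    -- window is the whole block.
    rcases Nat.eq_zero_or_pos k with rfl | hk0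
    · refine ⟨⟨by simp, ?_, by simp⟩, fun i ↦ i.elim0⟩
      rw [← hb.2.2]
      simp
    · refine isCyclicOrdering_of_arrangement hk0 hnd hb ⟨rfl, fun m ↦ List.Perm.refl _⟩
        fun j hj m ↦ ?_
      obtain rfl : k = 1 := by omega
      have : {x | x ∈ win j (List.ofFn b) m} = {x | x ∈ b 0} := by
        ext x
        rw [Set.mem_ofPred_eq, win, blk_ofFn hk0, blk_ofFn hk0]
        simp only [Nat.mod_one, Fin.zero_eta, Set.mem_ofPred_eq]
        conv_rhs => rw [← List.take_append_drop j (b 0)]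
        simp only [List.mem_append]
        tauto
      rw [this]
      exact hb.1 0

theorem exists_cyclicOrdering (hM : IsSplit M) (B : Fin k → Set α) (hB : IsBasePartition M B) :
    ∃ s : List α, IsCyclicOrdering M s ∧ BlocksInOrder M B s := by
  classical
  have hEfin : M.E.Finite := by
    obtain ⟨D, -, hE⟩ := hM.exists_splitSystem
    refine (Finset.univ.biUnion D.E).finite_toSet.subset fun x hx ↦ ?_
    simpa using (hE x).1 hx
  have hfin : ∀ i, (B i).Finite := fun i ↦ hEfin.subset (hB.1 i).subset_ground
  have hBe : (fun i ↦ {x | x ∈ (hfin i).toFinset.toList}) = B := by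
    ext i x; simp
  rw [← hBe] at hB
  have h := result_spec hM (fun i ↦ Finset.nodup_toList _) hB
    (O := fun X ↦ decide (M.Indep {x | x ∈ X})) (by simp)
  rw [hBe] at h
  exact ⟨_, h⟩

end Final

/-! ### The algorithm as an oracle procedure -/

/-- The state of the procedure: the position `j`, the candidates, the number of queries at
position `j` that have been answered, and those of them that are independent. -/
abbrev Config : Type := ℕ × List (List (List ℕ)) × ℕ × List (List ℕ)

/-- The known independent sets after the answer `a`. -/
def learn (bs : List (List ℕ)) (c : Config) (a : Bool) : List (List ℕ) :=
  if a = true then c.2.2.2 ++ [(queries bs c.1 c.2.1).getD c.2.2.1 []] else c.2.2.2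

/-- The next state after the answer `a`. -/
noncomputable def drive (bs : List (List ℕ)) (c : Config) (a : Bool) : Config :=
  if c.2.2.1 + 1 < (queries bs c.1 c.2.1).length then
    (c.1, c.2.1, c.2.2.1 + 1, learn bs c a)
  else (c.1 + 1, nextCands (learn bs c a) bs c.1 c.2.1, 0, [])

/-- What the procedure does in a given state. -/
def act (bs : List (List ℕ)) (c : Config) : List ℕ ⊕ List ℕ :=
  if bs.length ≤ 1 ∨ bs.headI.length ≤ c.1 then Sum.inr c.2.1.headI.flatten
  else Sum.inl ((queries bs c.1 c.2.1).getD c.2.2.1 [])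

/-- The procedure that finds a cyclic ordering. -/
noncomputable def procedure : OracleProcedure := fun bs a ↦
  act bs (a.foldl (drive bs) (0, [bs], 0, []))

section Halts

variable {M : Matroid ℕ} {O : List ℕ → Bool} {bs : List (List ℕ)}

/-- The state reached after `i` queries at position `j`. -/
def stage (O : List ℕ → Bool) (bs : List (List ℕ)) (cands : List (List (List ℕ))) (j i : ℕ) :
    Config :=
  (j, cands, i, ((queries bs j cands).take i).filter O)

lemma learn_stage {cands : List (List (List ℕ))} {j i : ℕ}
    (hi : i < (queries bs j cands).length) :
    learn bs (stage O bs cands j i) (O ((queries bs j cands).getD i [])) =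
      ((queries bs j cands).take (i + 1)).filter O := by
  rw [learn, stage, List.take_add_one, List.getElem?_eq_getElem hi, List.filter_append]
  simp only [List.getD_eq_getElem?_getD, List.getElem?_eq_getElem hi, Option.getD_some,
    Option.toList_some, List.filter_singleton]
  split <;> simp_all

lemma reaches_step (hO : ∀ X, O X = true ↔ M.Indep {x | x ∈ X}) (hk : ¬ bs.length ≤ 1) {j i : ℕ}
    (hj : j < bs.headI.length) {cands : List (List (List ℕ))}
    {a : List Bool} (ha : Reaches procedure M bs a)
    (hs : a.foldl (drive bs) (0, [bs], 0, []) = stage O bs cands j i)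
    (hi : i < (queries bs j cands).length) :
    ∃ a', Reaches procedure M bs a' ∧ a'.length = a.length + 1 ∧
      a'.foldl (drive bs) (0, [bs], 0, []) =
        if i + 1 < (queries bs j cands).length then stage O bs cands j (i + 1)
        else stage O bs (nextCands ((queries bs j cands).filter O) bs j cands) (j + 1) 0 := by
  refine ⟨a ++ [O ((queries bs j cands).getD i [])], .call ha (X := (queries bs j cands).getD i [])
    ?_ (hO _), by simp, ?_⟩
  · rw [procedure, hs, act, if_neg (by simp only [stage]; omega)]
    rfl
  · rw [List.foldl_append, hs, List.foldl_cons, List.foldl_nil, drive, learn_stage hi]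
    by_cases h : i + 1 < (queries bs j cands).length
    · rw [if_pos h]
      exact if_pos h
    · rw [if_neg h, List.take_of_length_le (by omega)]
      exact if_neg h

lemma reaches_within (hO : ∀ X, O X = true ↔ M.Indep {x | x ∈ X}) (hk : ¬ bs.length ≤ 1) {j : ℕ}
    (hj : j < bs.headI.length) {cands : List (List (List ℕ))}
    {a : List Bool} (ha : Reaches procedure M bs a)
    (hs : a.foldl (drive bs) (0, [bs], 0, []) = stage O bs cands j 0) {i : ℕ}
    (hi : i < (queries bs j cands).length) :
    ∃ a', Reaches procedure M bs a' ∧ a'.length = a.length + i ∧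
      a'.foldl (drive bs) (0, [bs], 0, []) = stage O bs cands j i := by
  induction i with
  | zero => exact ⟨a, ha, rfl, hs⟩
  | succ i ih =>
    obtain ⟨a₁, h1, h2, h3⟩ := ih (by omega)
    obtain ⟨a₂, h4, h5, h6⟩ := reaches_step hO hk hj h1 h3 (by omega)
    rw [if_pos hi] at h6
    exact ⟨a₂, h4, by omega, h6⟩

lemma reaches_run (hO : ∀ X, O X = true ↔ M.Indep {x | x ∈ X}) (hk : ¬ bs.length ≤ 1) {j : ℕ}
    (hj : j ≤ bs.headI.length) :
    ∃ a, Reaches procedure M bs a ∧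
      a.length = ∑ i ∈ Finset.range j, (queries bs i (run O bs i)).length ∧
      a.foldl (drive bs) (0, [bs], 0, []) = stage O bs (run O bs j) j 0 := by
  induction j with
  | zero => exact ⟨[], .start, rfl, by simp [stage, run]⟩
  | succ j ih =>
    obtain ⟨a, h1, h2, h3⟩ := ih (by omega)
    -- The trivial query `[]` makes every round nonempty. This matters because `drive` advances the
    -- position only upon an answer.
    have hpos : 0 < (queries bs j (run O bs j)).length := by simp [queries]
    obtain ⟨a₁, h4, h5, h6⟩ := reaches_within hO hk hj h1 h3
      (i := (queries bs j (run O bs j)).length - 1) (by omega)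
    obtain ⟨a₂, h7, h8, h9⟩ := reaches_step hO hk hj h4 h6 (by omega)
    rw [if_neg (by omega)] at h9
    refine ⟨a₂, h7, ?_, h9⟩
    rw [Finset.sum_range_succ]
    omega

/-- The number of queries that the procedure makes. -/
noncomputable def cost (O : List ℕ → Bool) (bs : List (List ℕ)) : ℕ :=
  if bs.length ≤ 1 then 0
  else ∑ i ∈ Finset.range bs.headI.length, (queries bs i (run O bs i)).length

theorem procedure_haltsWith (hO : ∀ X, O X = true ↔ M.Indep {x | x ∈ X}) :
    HaltsWith procedure M bs (result O bs) (cost O bs) := by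
  by_cases hk : bs.length ≤ 1
  · refine ⟨[], .start, ?_, by simp [cost, hk]⟩
    simp [procedure, act, result, hk]
  · obtain ⟨a, h1, h2, h3⟩ := reaches_run hO hk (j := bs.headI.length) le_rfl
    refine ⟨a, h1, ?_, by rw [h2, cost, if_neg hk]⟩
    rw [procedure, h3, act, if_pos (Or.inr (by exact le_rfl)), result, if_neg hk]
    rfl

end Halts

/-! ### Counting the oracle calls -/

section Cost

lemma length_flatMap_le {α β : Type*} {l : List α} {f : α → List β} {c : ℕ}
    (h : ∀ x ∈ l, (f x).length ≤ c) : (l.flatMap f).length ≤ l.length * c := by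
  rw [List.length_flatMap]
  simpa using List.sum_le_card_nsmul (l.map fun x ↦ (f x).length) c (by simpa using h)

variable {α : Type*} [DecidableEq α] {D : SplitSystem α} {O : List α → Bool}
  {bs ls ls' : List (List α)} {r j : ℕ}

lemma length_baseQueries (bs : List (List α)) :
    (baseQueries bs).length ≤ bs.headI.length * bs.flatten.length :=
  length_flatMap_le fun x _ ↦ by rw [List.length_map]

lemma length_windowQueries (hr : ∀ m, (blk ls m).length ≤ r) :
    (windowQueries j ls).length ≤ ls.length * (1 + r * r) := by
  have hd : ∀ m, ((blk ls m).drop j).length ≤ r := fun m ↦ by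
    have := hr m
    rw [List.length_drop]; omega
  have h := length_flatMap_le (l := List.range ls.length) (c := 1 + r * r)
    (f := fun m ↦ win j ls m ::
      ((blk ls m).drop j).flatMap fun x ↦ ((blk ls (m + 1)).drop j).map fun y ↦
        exchList ((blk ls m).drop j) ((blk ls (m + 1)).take j) x y) fun m _ ↦ by
    rw [List.length_cons, add_comm]
    refine Nat.add_le_add_left ((length_flatMap_le (c := r) fun x _ ↦ ?_).trans
      (Nat.mul_le_mul_right r (hd m))) 1
    rw [List.length_map]
    exact hd (m + 1)
  rwa [List.length_range] at h

lemma length_variants (hr : ∀ m, (blk ls m).length ≤ r) :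
    (variants j ls ls').length ≤ 1 + ls.length * r := by
  rw [variants, List.length_cons, add_comm]
  refine Nat.add_le_add_left ?_ 1
  have h := length_flatMap_le (l := List.range ls.length) (c := r)
    (f := fun m ↦ (moves j (blk ls m)).map fun o ↦ ls'.set m o) fun m _ ↦ by
      have := hr m
      rw [List.length_map, moves, List.length_map, List.length_drop]; omega
  rwa [List.length_range] at h

lemma pick_mem_or_eq (T : List (List α)) (bs : List (List α)) (j : ℕ)
    (cands : List (List (List α))) : pick T bs j cands ∈ cands ∨ pick T bs j cands = [] := by
  classical
  rw [pick]
  generalize hF : cands.filter _ = F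
  cases F with
  | nil => exact Or.inr rfl
  | cons a t =>
    left
    have : a ∈ a :: t := by simp
    rw [← hF] at this
    exact (List.mem_filter.1 this).1

lemma Promise.length_run (h : Promise D O bs r) (hj : j ≤ r) :
    (run O bs j).length ≤ 1 + bs.length * r := by
  cases j with
  | zero => simp [run]
  | succ j =>
    rw [run, nextCands]
    rcases pick_mem_or_eq ((queries bs j (run O bs j)).filter O) bs j (run O bs j) with hp | hp
    · have ha := (h.invariant_run (by omega : j ≤ r)).arrangement _ hp
      rw [← ha.length_eq]
      exact length_variants fun m ↦ (h.length' ha m).le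
    · rw [hp]
      simp [variants]

lemma Promise.length_queries (h : Promise D O bs r) (hj : j ≤ r) :
    (queries bs j (run O bs j)).length ≤
      1 + (r * bs.flatten.length + (1 + bs.length * r) * (bs.length * (1 + r * r))) := by
  rw [queries, List.length_cons, List.length_append, add_comm]
  refine Nat.add_le_add_left (Nat.add_le_add ?_ ?_) 1
  · have := length_baseQueries bs
    rwa [h.headI_eq, h.length] at this
  · refine (length_flatMap_le fun ls hls ↦ ?_).trans
      (Nat.mul_le_mul_right _ (h.length_run hj))
    have ha := (h.invariant_run hj).arrangement _ hls
    rw [← ha.length_eq]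
    exact length_windowQueries fun m ↦ (h.length' ha m).le

/-- The bound on the number of queries. -/
noncomputable def costBound : Polynomial ℕ :=
  .X * (1 + (.X * .X + (1 + .X) * (.X * (1 + .X * .X))))

lemma Promise.cost_le {D : SplitSystem ℕ} {O : List ℕ → Bool} {bs : List (List ℕ)}
    (h : Promise D O bs r) (hn : bs.flatten.length = bs.length * r) :
    cost O bs ≤ costBound.eval bs.flatten.length := by
  have h2 := h.two_le
  rw [cost, if_neg (by omega), h.headI_eq, h.length]
  rcases Nat.eq_zero_or_pos r with rfl | hr
  · simp
  refine (Finset.sum_le_card_nsmul _ _ _ fun i hi ↦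
    h.length_queries (Finset.mem_range.1 hi).le).trans ?_
  -- With `n = k * r`, `k ≥ 2` and `r ≥ 1`, both `r` and `k` are at most `n`, and the number of
  -- candidates `1 + k * r` is `1 + n`.
  have hrn : r ≤ bs.flatten.length := by rw [hn]; exact Nat.le_mul_of_pos_left r (by omega)
  have hkn : bs.length ≤ bs.flatten.length := by rw [hn]; exact Nat.le_mul_of_pos_right _ hr
  rw [← hn]
  simp only [costBound, Polynomial.eval_mul, Polynomial.eval_add, Polynomial.eval_X,
    Polynomial.eval_one, Finset.card_range, smul_eq_mul]
  gcongr

theorem cost_le {M : Matroid ℕ} {k : ℕ} {b : Fin k → List ℕ} {O : List ℕ → Bool}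
    (hM : IsSplit M) (hnd : ∀ i, (b i).Nodup)
    (hb : IsBasePartition M fun i ↦ {x | x ∈ b i}) (hO : ∀ X, O X = true ↔ M.Indep {x | x ∈ X}) :
    cost O (List.ofFn b) ≤ costBound.eval M.E.ncard := by
  rcases Nat.lt_or_ge 1 k with hk | hk
  · obtain ⟨D, -, hp⟩ := Promise.of_isSplit hM hk hnd hb hO
    rw [ncard_ground hnd hb]
    refine hp.cost_le ?_
    have hl : ∀ l ∈ List.ofFn b, l.length = rk M := by
      intro l hl
      obtain ⟨i, rfl⟩ := List.mem_ofFn.1 hl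
      exact (rk_eq_length (hnd i) (hb.1 i)).symm
    rw [List.length_flatten, List.map_congr_left hl, List.map_const', List.sum_replicate,
      smul_eq_mul]
  · rw [cost, if_pos (by simpa using hk)]
    exact Nat.zero_le _

end Cost

/-! ### The procedure is computable -/

section Primrec

open _root_.Primrec

variable {α β σ : Type*} [Primcodable α] [Primcodable β] [Primcodable σ]

lemma primrecPred_exists_mem {f : β → List σ} {p : β → σ → Prop} (hf : Primrec f)
    (hp : PrimrecPred fun q : β × σ ↦ p q.1 q.2) : PrimrecPred fun b ↦ ∃ a ∈ f b, p b a :=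
  (PrimrecRel.exists_mem_list (R := fun a b ↦ p b a)
    (PrimrecPred.comp hp (pair snd fst))).comp hf .id

lemma primrecPred_forall_mem {f : β → List σ} {p : β → σ → Prop} (hf : Primrec f)
    (hp : PrimrecPred fun q : β × σ ↦ p q.1 q.2) : PrimrecPred fun b ↦ ∀ a ∈ f b, p b a :=
  (PrimrecRel.forall_mem_list (R := fun a b ↦ p b a)
    (PrimrecPred.comp hp (pair snd fst))).comp hf .id

lemma primrecPred_forall_lt {f : β → ℕ} {p : β → ℕ → Prop} (hf : Primrec f)
    (hp : PrimrecPred fun q : β × ℕ ↦ p q.1 q.2) : PrimrecPred fun b ↦ ∀ a < f b, p b a :=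
  (primrecPred_forall_mem (list_range.comp hf) hp).of_eq fun b ↦ by simp

lemma primrec_filter {f : β → List σ} {p : β → σ → Prop} [∀ b a, Decidable (p b a)]
    (hf : Primrec f) (hp : PrimrecPred fun q : β × σ ↦ p q.1 q.2) :
    Primrec fun b ↦ (f b).filter fun a ↦ decide (p b a) :=
  (PrimrecRel.listFilter (R := fun a b ↦ p b a)
    (PrimrecPred.comp hp (pair snd fst))).comp hf .id

lemma primrecPred_mem {f : β → σ} {l : β → List σ} (hf : Primrec f) (hl : Primrec l) :
    PrimrecPred fun b ↦ f b ∈ l b :=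
  (primrecPred_exists_mem (p := fun b a ↦ a = f b) hl
    (Primrec.eq.comp snd (hf.comp fst))).of_eq fun b ↦ by simp

lemma primrec_sections : Primrec (List.sections : List (List σ) → List (List σ)) := by
  have : Primrec fun L : List (List σ) ↦ L.foldr
      (fun l s ↦ s.flatMap fun t ↦ l.map fun a ↦ a :: t) [[]] :=
    list_foldr (h := fun (_ : List (List σ)) (q : List σ × List (List σ)) ↦
        q.2.flatMap fun t ↦ q.1.map fun a ↦ a :: t) .id (.const _) <| by
      refine list_flatMap (snd.comp snd) ?_
      refine list_map (fst.comp (snd.comp fst)) ?_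
      exact list_cons.comp snd (snd.comp fst)
  refine this.of_eq fun L ↦ ?_
  induction L with
  | nil => rfl
  | cons l L ih => rw [List.foldr_cons, ih, List.sections]

variable {ls bs T : β → List (List α)} {Q P Q' b S l : β → List α} {x y c : β → α} {j m : β → ℕ}
  {cands : β → List (List (List α))}

lemma primrec_blk (hls : Primrec ls) (hm : Primrec m) : Primrec fun c ↦ blk (ls c) (m c) :=
  (list_getD []).comp hls (nat_mod.comp hm (list_length.comp hls))

lemma primrec_blkDrop (hj : Primrec j) (hls : Primrec ls) (hm : Primrec m) :
    Primrec fun c ↦ (blk (ls c) (m c)).drop (j c) :=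
  list_drop.comp hj (primrec_blk hls hm)

lemma primrec_blkTake (hj : Primrec j) (hls : Primrec ls) (hm : Primrec m) :
    Primrec fun c ↦ (blk (ls c) (m c)).take (j c) :=
  list_take.comp hj (primrec_blk hls hm)

lemma primrec_win (hj : Primrec j) (hls : Primrec ls) (hm : Primrec m) :
    Primrec fun c ↦ win (j c) (ls c) (m c) :=
  list_append.comp (primrec_blkDrop hj hls hm) (primrec_blkTake hj hls (succ.comp hm))

lemma primrecPred_windowsIn (hT : Primrec T) (hj : Primrec j) (hls : Primrec ls) :
    PrimrecPred fun c ↦ WindowsIn (T c) (j c) (ls c) :=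
  primrecPred_forall_lt (list_length.comp hls)
    (primrecPred_mem (primrec_win (hj.comp fst) (hls.comp fst) snd) (hT.comp fst))

variable [DecidableEq α]

lemma primrec_filterNe (hl : Primrec l) (hx : Primrec x) :
    Primrec fun c ↦ (l c).filter fun z ↦ z ≠ x c :=
  primrec_filter (p := fun c z ↦ z ≠ x c) hl (Primrec.eq.comp snd (hx.comp fst)).not

lemma primrec_exchList (hQ : Primrec Q) (hP : Primrec P) (hx : Primrec x) (hy : Primrec y) :
    Primrec fun c ↦ exchList (Q c) (P c) (x c) (y c) :=
  list_append.comp (primrec_filterNe hQ hx) (list_concat.comp hP hy)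

lemma primrec_moveTo (hj : Primrec j) (hl : Primrec l) (hx : Primrec x) :
    Primrec fun c ↦ moveTo (j c) (l c) (x c) :=
  list_append.comp (list_take.comp hj hl)
    (list_cons.comp hx (primrec_filterNe (list_drop.comp hj hl) hx))

lemma primrec_moves (hj : Primrec j) (hl : Primrec l) : Primrec fun c ↦ moves (j c) (l c) :=
  list_map (list_drop.comp hj hl) (primrec_moveTo (hj.comp fst) (hl.comp fst) snd)

lemma primrecPred_listArrow (hT : Primrec T) (hb : Primrec b) (hx : Primrec x) (hy : Primrec y) :
    PrimrecPred fun c ↦ ListArrow (T c) (b c) (x c) (y c) :=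
  (Primrec.eq.comp hx hy).or ((primrecPred_mem hy hb).not.and
    (primrecPred_mem (primrec_exchList hb (.const []) hx hy) hT))

lemma primrecPred_listLink (hT : Primrec T) (hb : Primrec b) (hS : Primrec S) (hx : Primrec x)
    (hy : Primrec y) : PrimrecPred fun c ↦ ListLink (T c) (b c) (S c) (x c) (y c) :=
  primrecPred_exists_mem hS
    ((primrecPred_listArrow (hT.comp fst) (hb.comp fst) (hx.comp fst) snd).and
      (primrecPred_listArrow (hT.comp fst) (hb.comp fst) (hy.comp fst) snd))

lemma primrecPred_listInClass (hT : Primrec T) (hb : Primrec b) (hS : Primrec S) (hx : Primrec x)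
    (hy : Primrec y) : PrimrecPred fun c ↦ ListInClass (T c) (b c) (S c) (x c) (y c) := by
  refine primrecPred_exists_mem hb (primrecPred_exists_mem (hb.comp fst) ?_)
  have hf : Primrec fun q : (β × α) × α ↦ q.1.1 := fst.comp fst
  exact (primrecPred_listLink (hT.comp hf) (hb.comp hf) (hS.comp hf) (hx.comp hf)
    (snd.comp fst)).and
    ((primrecPred_listLink (hT.comp hf) (hb.comp hf) (hS.comp hf) (snd.comp fst) snd).and
      (primrecPred_listArrow (hT.comp hf) (hb.comp hf) snd (hy.comp hf)))

lemma primrecPred_listExch (hT : Primrec T) (hQ : Primrec Q) (hP : Primrec P) (hx : Primrec x)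
    (hy : Primrec y) : PrimrecPred fun c ↦ ListExch (T c) (Q c) (P c) (x c) (y c) :=
  primrecPred_mem (primrec_exchList hQ hP hx hy) hT

lemma primrecPred_listSplitAt (hT : Primrec T) (hb : Primrec b) (hS : Primrec S) (hc : Primrec c)
    (hQ : Primrec Q) (hP : Primrec P) (hQ' : Primrec Q') :
    PrimrecPred fun d ↦ ListSplitAt (T d) (b d) (S d) (c d) (Q d) (P d) (Q' d) := by
  refine primrecPred_exists_mem hQ (primrecPred_exists_mem (hQ.comp fst)
    (primrecPred_exists_mem (hQ'.comp (fst.comp fst))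
      (primrecPred_exists_mem (hQ'.comp (fst.comp (fst.comp fst))) ?_)))
  have hf : Primrec fun q : (((β × α) × α) × α) × α ↦ q.1.1.1.1 :=
    fst.comp (fst.comp (fst.comp fst))
  have hz₀ : Primrec fun q : (((β × α) × α) × α) × α ↦ q.1.1.1.2 :=
    snd.comp (fst.comp (fst.comp fst))
  have hz₁ : Primrec fun q : (((β × α) × α) × α) × α ↦ q.1.1.2 := snd.comp (fst.comp fst)
  have hy₀ : Primrec fun q : (((β × α) × α) × α) × α ↦ q.1.2 := snd.comp fst
  have hy₁ : Primrec fun q : (((β × α) × α) × α) × α ↦ q.2 := snd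
  have hC {γ : Type _} [Primcodable γ] {g : γ → β} {w : γ → α} (hg : Primrec g) (hw : Primrec w) :
      PrimrecPred fun e ↦ ListInClass (T (g e)) (b (g e)) (S (g e)) (c (g e)) (w e) :=
    primrecPred_listInClass (hT.comp hg) (hb.comp hg) (hS.comp hg) (hc.comp hg) hw
  have hE {γ : Type _} [Primcodable γ] {g : γ → β} {v w : γ → α} (hg : Primrec g)
      (hv : Primrec v) (hw : Primrec w) :
      PrimrecPred fun e ↦ ListExch (T (g e)) (Q (g e)) (P (g e)) (v e) (w e) :=
    primrecPred_listExch (hT.comp hg) (hQ.comp hg) (hP.comp hg) hv hw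
  refine ((hC hf hz₀).and ((hC hf hz₁).and ((hC hf hy₀).and (hC hf hy₁)))).and
    ((hE hf hz₀ hy₀).not.and ((hE hf hz₁ hy₁).not.and ((hE hf hz₀ hy₁).and
      (PrimrecPred.and ?_ ?_))))
  · exact primrecPred_forall_mem (hQ.comp hf) ((hC (hf.comp fst) snd).not.or
      ((hE (hf.comp fst) snd (hy₀.comp fst)).not.or (hE (hf.comp fst) snd (hy₁.comp fst)).not))
  · exact primrecPred_forall_mem (hQ'.comp hf) ((hC (hf.comp fst) snd).not.or
      ((hE (hf.comp fst) (hz₀.comp fst) snd).not.or (hE (hf.comp fst) (hz₁.comp fst) snd).not))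

lemma primrecPred_accepted (hT : Primrec T) (hbs : Primrec bs) (hj : Primrec j)
    (hls : Primrec ls) : PrimrecPred fun c ↦ Accepted (T c) (bs c) (j c) (ls c) := by
  refine (primrecPred_windowsIn hT hj hls).and
    (primrecPred_forall_mem (list_headI.comp hbs) (PrimrecPred.not
      (primrecPred_forall_lt (list_length.comp (hls.comp fst)) ?_)))
  have hf : Primrec fun q : (β × α) × ℕ ↦ q.1.1 := fst.comp fst
  exact primrecPred_listSplitAt (hT.comp hf) (list_headI.comp (hbs.comp hf))
    (list_flatten.comp (hbs.comp hf)) (snd.comp fst)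
    (primrec_blkDrop (hj.comp hf) (hls.comp hf) snd)
    (primrec_blkTake (hj.comp hf) (hls.comp hf) (succ.comp snd))
    (primrec_blkDrop (hj.comp hf) (hls.comp hf) (succ.comp snd))

lemma primrec_baseQueries (hbs : Primrec bs) : Primrec fun c ↦ baseQueries (bs c) := by
  refine list_flatMap (list_headI.comp hbs) (list_map (list_flatten.comp (hbs.comp fst)) ?_)
  exact primrec_exchList (list_headI.comp (hbs.comp (fst.comp fst))) (.const [])
    (snd.comp fst) snd

lemma primrec_windowQueries (hj : Primrec j) (hls : Primrec ls) :
    Primrec fun c ↦ windowQueries (j c) (ls c) := by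
  refine list_flatMap (list_range.comp (list_length.comp hls)) (list_cons.comp
    (primrec_win (hj.comp fst) (hls.comp fst) snd) ?_)
  refine list_flatMap (primrec_blkDrop (hj.comp fst) (hls.comp fst) snd) (list_map
    (primrec_blkDrop (hj.comp (fst.comp fst)) (hls.comp (fst.comp fst))
      (succ.comp (snd.comp fst))) ?_)
  have hf : Primrec fun q : ((β × ℕ) × α) × α ↦ q.1.1.1 := fst.comp (fst.comp fst)
  have hm : Primrec fun q : ((β × ℕ) × α) × α ↦ q.1.1.2 := snd.comp (fst.comp fst)
  exact primrec_exchList (primrec_blkDrop (hj.comp hf) (hls.comp hf) hm)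
    (primrec_blkTake (hj.comp hf) (hls.comp hf) (succ.comp hm)) (snd.comp fst) snd

lemma primrec_queries (hbs : Primrec bs) (hj : Primrec j) (hcands : Primrec cands) :
    Primrec fun c ↦ queries (bs c) (j c) (cands c) :=
  list_cons.comp (.const []) (list_append.comp (primrec_baseQueries hbs)
    (list_flatMap hcands (primrec_windowQueries (hj.comp fst) snd)))

/-- `pick` filters by a classical decision, but the predicate is built from list membership by
bounded quantifiers, so the filter is primitive recursive. -/
lemma primrec_pick (hT : Primrec T) (hbs : Primrec bs) (hj : Primrec j)
    (hcands : Primrec cands) : Primrec fun c ↦ pick (T c) (bs c) (j c) (cands c) := by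
  classical
  exact list_headI.comp (primrec_filter hcands
    (primrecPred_accepted (hT.comp fst) (hbs.comp fst) (hj.comp fst) snd))

lemma primrec_advance (hT : Primrec T) (hj : Primrec j) (hls : Primrec ls) :
    Primrec fun c ↦ advance (T c) (j c) (ls c) := by
  classical
  exact list_headI.comp (primrec_filter
    (primrec_sections.comp (list_map hls (primrec_moves (hj.comp fst) snd)))
    (primrecPred_windowsIn (hT.comp fst) (succ.comp (hj.comp fst)) snd))

lemma primrec_variants {ls' : β → List (List α)} (hj : Primrec j) (hls : Primrec ls)
    (hls' : Primrec ls') : Primrec fun c ↦ variants (j c) (ls c) (ls' c) := by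
  refine list_cons.comp hls' (list_flatMap (list_range.comp (list_length.comp hls)) (list_map
    (primrec_moves (hj.comp fst) (primrec_blk (hls.comp fst) snd)) ?_))
  exact list_set.comp (hls'.comp (fst.comp fst)) (pair (snd.comp fst) snd)

lemma primrec_nextCands (hT : Primrec T) (hbs : Primrec bs) (hj : Primrec j)
    (hcands : Primrec cands) : Primrec fun c ↦ nextCands (T c) (bs c) (j c) (cands c) :=
  have h := primrec_pick hT hbs hj hcands
  primrec_variants hj h (primrec_advance hT hj h)

end Primrec

section Procedure

open _root_.Primrec

lemma primrec_learn :
    Primrec fun q : List (List ℕ) × Config × Bool ↦ learn q.1 q.2.1 q.2.2 := by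
  have hc : Primrec fun q : List (List ℕ) × Config × Bool ↦ q.2.1 := fst.comp snd
  have hT := snd.comp (snd.comp (snd.comp hc))
  refine Primrec.ite (Primrec.eq.comp (snd.comp snd) (.const true)) ?_ hT
  exact list_concat.comp hT ((list_getD []).comp
    (primrec_queries fst (fst.comp hc) (fst.comp (snd.comp hc)))
    (fst.comp (snd.comp (snd.comp hc))))

lemma primrec_drive :
    Primrec fun q : List (List ℕ) × Config × Bool ↦ drive q.1 q.2.1 q.2.2 := by
  have hc : Primrec fun q : List (List ℕ) × Config × Bool ↦ q.2.1 := fst.comp snd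
  have hj := fst.comp hc
  have hcands := fst.comp (snd.comp hc)
  have hi := fst.comp (snd.comp (snd.comp hc))
  refine Primrec.ite (nat_lt.comp (succ.comp hi)
    (list_length.comp (primrec_queries fst hj hcands))) ?_ ?_
  · exact pair hj (pair hcands (pair (succ.comp hi) primrec_learn))
  · exact pair (succ.comp hj) (pair (primrec_nextCands primrec_learn fst hj hcands) (.const _))

lemma primrec_act : Primrec fun q : List (List ℕ) × Config ↦ act q.1 q.2 := by
  have hj : Primrec fun q : List (List ℕ) × Config ↦ q.2.1 := fst.comp snd
  have hcands : Primrec fun q : List (List ℕ) × Config ↦ q.2.2.1 := fst.comp (snd.comp snd)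
  refine Primrec.ite ((nat_le.comp (list_length.comp fst) (.const 1)).or
    (nat_le.comp (list_length.comp (list_headI.comp fst)) hj)) ?_ ?_
  · exact sumInr.comp (list_flatten.comp (list_headI.comp hcands))
  · exact sumInl.comp ((list_getD []).comp (primrec_queries fst hj hcands)
      (fst.comp (snd.comp (snd.comp snd))))

/-- The state is a fold of the step `drive` over the answers, so primitive recursion suffices
despite the exhaustive search within a step. -/
theorem primrec_procedure : Primrec₂ procedure := by
  refine primrec_act.comp (pair fst ?_)
  refine list_foldl (h := fun (q : List (List ℕ) × List Bool) (s : Config × Bool) ↦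
    drive q.1 s.1 s.2) snd ?_ ?_
  · exact pair (.const 0) (pair (list_cons.comp fst (.const [])) (.const _))
  · exact primrec_drive.comp (pair (fst.comp fst) snd)

end Procedure

end SplitMatroid

theorem theorem1 :
    (∀ {α : Type*} (M : Matroid α), SplitMatroid.IsSplit M →
      ∀ (k : ℕ) (B : Fin k → Set α), SplitMatroid.IsBasePartition M B →
        ∃ s : List α, SplitMatroid.IsCyclicOrdering M s ∧ SplitMatroid.BlocksInOrder M B s) ∧
    ∃ (P : SplitMatroid.OracleProcedure) (p : Polynomial ℕ), Computable₂ P ∧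
      ∀ M : Matroid ℕ, SplitMatroid.IsSplit M →
        ∀ (k : ℕ) (b : Fin k → List ℕ), (∀ i, (b i).Nodup) →
          SplitMatroid.IsBasePartition M (fun i ↦ {x | x ∈ b i}) →
            ∃ (s : List ℕ) (c : ℕ),
              SplitMatroid.HaltsWith P M (List.ofFn b) s c ∧
              c ≤ p.eval M.E.ncard ∧
              SplitMatroid.IsCyclicOrdering M s ∧
              SplitMatroid.BlocksInOrder M (fun i ↦ {x | x ∈ b i}) s := by
  refine ⟨fun M hM k B hB ↦ SplitMatroid.exists_cyclicOrdering hM B hB, SplitMatroid.procedure,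
    SplitMatroid.costBound, SplitMatroid.primrec_procedure.to_comp, fun M hM k b hnd hb ↦ ?_⟩
  classical
  have hO (X : List ℕ) : decide (M.Indep {x | x ∈ X}) = true ↔ M.Indep {x | x ∈ X} := by simp
  exact ⟨_, _, SplitMatroid.procedure_haltsWith hO, SplitMatroid.cost_le hM hnd hb hO,
    SplitMatroid.result_spec hM hnd hb hO⟩
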